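/- Let $d\ge 3$ be an integer and $p\ge 1$ a real number. For Borel measures $\mu,\lambda$ on $\mathbb{R}^d$ and a Borel set $\Omega\subseteq\mathbb{R}^d$, let $$W_\Omega^p(\mu,\lambda)=\inf_{\pi}\int_{\mathbb{R}^d\times\mathbb{R}^d}|x-y|^p\,d\pi(x,y)\in[0,\infty],$$ where $\pi$ ranges over the couplings of the restrictions $\mu|_\Omega$ and $\lambda|_\Omega$ (the infimum is $\infty$ if there is none), $|\cdot|$ is the Euclidean norm, and a constant $c\geq 0$ in place of a measure stands for $c$ times Lebesgue measure. Let $Q_L=[0,L]^d$, with Lebesgue measure $|Q_L|=L^d$. For a Poisson point process $\mu$ of intensity one on $\mathbb{R}^d$ and $L\ge1$ put $$f^{\mathrm{ref}}(L)=\mathbb{E}\left[\frac{1}{|Q_L|}\,W_{Q_L}^p\left(\mu,\frac{\mu(Q_L)}{|Q_L|}\right)\right].$$ Then there is a constant $f_\infty^{\mathrm{ref}}\in(0,\infty)$, depending only on $p$ and $d$, such that $$\lim_{L\to\infty}f^{\mathrm{ref}}(L)=f_\infty^{\mathrm{ref}}$$ (the limit being over real $L$, for every such Poisson point process), and, for every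 sequence $(X_i)_{i\ge1}$ of i.i.d. uniform random variables on $[0,1]^d$, $$\lim_{n\to\infty}n^{p/d}\,\mathbb{E}\left[W_{[0,1]^d}^p\left(\frac1n\sum_{i=1}^n\delta_{X_i},\,1\right)\right]=f_\infty^{\mathrm{ref}}.$$ -/

import Mathlib

open MeasureTheory ProbabilityTheory Filter
open scoped ENNReal Topology

/-- The cube `Q_L = [0, L]^d` in Euclidean space. -/
def cube (d : ℕ) (L : ℝ) : Set (EuclideanSpace ℝ (Fin d)) :=
  {x | ∀ i, x i ∈ Set.Icc (0 : ℝ) L}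

/-- `π` is a coupling of `μ` and `ν`: its first marginal is `μ` and its second marginal is `ν`. -/
def IsCoupling {E : Type*} [MeasurableSpace E] (π : Measure (E × E)) (μ ν : Measure E) : Prop :=
  π.map Prod.fst = μ ∧ π.map Prod.snd = ν

/-- The transportation cost `W_p^p(μ, ν) = inf_π ∫ |x - y|^p dπ(x, y)` over couplings of `μ`
and `ν`. It is `∞` when `μ` and `ν` have different total mass (there is no coupling then), and
`0` when both vanish. -/
noncomputable def transportCost {d : ℕ} (p : ℝ) (μ ν : Measure (EuclideanSpace ℝ (Fin d))) :
    ℝ≥0∞ :=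
  ⨅ (π : Measure (EuclideanSpace ℝ (Fin d) × EuclideanSpace ℝ (Fin d)))
    (_ : IsCoupling π μ ν), ∫⁻ z, edist z.1 z.2 ^ p ∂π

/-- `W_S^p(μ, ν)`: the transportation cost between the restrictions of `μ` and `ν` to `S`. -/
noncomputable def transportCostOn {d : ℕ} (p : ℝ) (S : Set (EuclideanSpace ℝ (Fin d)))
    (μ ν : Measure (EuclideanSpace ℝ (Fin d))) : ℝ≥0∞ :=
  transportCost p (μ.restrict S) (ν.restrict S)

/-- `μ` is a Poisson point process of intensity one on `ℝ^d`, defined on the probability space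
`(Ω, P)`: a random locally finite atomic measure `∑ i, δ_{x i}` whose values on disjoint Borel
sets are independent and such that `μ(A)` is Poisson distributed with parameter the Lebesgue
measure of `A`. -/
structure IsPoissonPointProcess {Ω : Type*} [MeasurableSpace Ω] {d : ℕ}
    (μ : Ω → Measure (EuclideanSpace ℝ (Fin d))) (P : Measure Ω) : Prop where
  measurable : Measurable μ
  locallyFinite : ∀ ω, IsLocallyFiniteMeasure (μ ω)
  atomic : ∀ ω, ∃ (I : Set ℕ) (x : ℕ → EuclideanSpace ℝ (Fin d)),
    μ ω = Measure.sum fun i : I => Measure.dirac (x i)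
  indep : ∀ (k : ℕ) (A : Fin k → Set (EuclideanSpace ℝ (Fin d))),
    (∀ i, MeasurableSet (A i)) → (Pairwise fun i j => Disjoint (A i) (A j)) →
      iIndepFun (fun i ω => μ ω (A i)) P
  law : ∀ A : Set (EuclideanSpace ℝ (Fin d)), MeasurableSet A → volume A ≠ ∞ →
    HasLaw (fun ω => μ ω A)
      ((poissonMeasure (volume A).toNNReal).map (Nat.cast : ℕ → ℝ≥0∞)) P

/-- `f^ref(L) = E[ |Q_L|⁻¹ W_{Q_L}^p(μ, κ) ]` with `κ = μ(Q_L) / |Q_L|`, for a random measure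
`μ` on `ℝ^d` (a constant density is identified with a multiple of Lebesgue measure). -/
noncomputable def fRef {Ω : Type*} [MeasurableSpace Ω] {d : ℕ} (p : ℝ)
    (μ : Ω → Measure (EuclideanSpace ℝ (Fin d))) (P : Measure Ω) (L : ℝ) : ℝ≥0∞ :=
  ∫⁻ ω, (volume (cube d L))⁻¹ *
    transportCostOn p (cube d L) (μ ω)
      ((μ ω (cube d L) / volume (cube d L)) • volume) ∂P

/-- The empirical measure `n⁻¹ ∑ i < n, δ_{x i}`. -/
noncomputable def empiricalMeasure {d : ℕ} (x : ℕ → EuclideanSpace ℝ (Fin d)) (n : ℕ) :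
    Measure (EuclideanSpace ℝ (Fin d)) :=
  (n : ℝ≥0∞)⁻¹ • ∑ i ∈ Finset.range n, Measure.dirac (x i)

/-! ### Couplings and the transport cost: subadditivity, scaling, gluing, triangle inequality. -/

section Transport

variable {d : ℕ} {p : ℝ}

/-! Write u(n) for `costPerPoint d p n`, the mean cost, divided by n, of transporting n independent
uniform points of the unit cube to n times Lebesgue measure. Both limits come from the single
statement that n^(p/d) u(n) converges to some f > 0 (`exists_tendsto_costPerPoint`).

Convergence rests on an approximate subadditivity, `exists_costPerPoint_le`. Cut the unit cube into
m^d cells, with l = n/m^d points in each on average. Given their number, the points in a cell are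
independent and uniform there, so by scaling the cost of spreading them over their own cell is
governed by u again (`meanBoxCost_cell`). It remains to equalise the densities of the cells. This is
done along a hierarchy of boxes, each obtained by bisecting the longest side of its parent. In a box
of s cells the proportion of points in one part fluctuates by about (sl)^(-1/2), so the mass moves
by the side s^(1/d)/m times this amount (`transportCost_merge_le`,
`exists_lintegral_proportion_le`). By Minkowski's inequality the p-th roots of the mean costs add
up, and after normalisation scale s contributes a multiple of s^(1/d-1/2). As d ≥ 3 the exponent is
negative, the series is geometric, and the total is of order l^(-1/2)/m
(`exists_meanBoxCost_grid_le`).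

Since u is nonincreasing on n ≥ 1 (`costPerPoint_succ_le`, by leaving out one point at a time), a
Chernoff bound replaces the random number of points in a cell by a fixed K slightly below l. After
multiplication by n^(1/d), which is about K^(1/d) m, the inequality bounds n^(1/d) u(n)^(1/p) for
all large n by nearly its value at K, plus an error of order K^(1/d-1/2). Choosing K close to
realising the lower limit gives convergence. The limit is positive because small balls around the n
points cover at most half of the cube, so half of the mass must travel a distance of order n^(-1/d)
(`configCost_univ_ge`).

For independent points the expectation in the theorem is exactly u(n). For the Poisson process only
the joint law of counts in disjoint sets is given. The cost is a limit of costs that depend on the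
counts in the cells of finer and finer grids, and these counts have the same law as for a Poisson
number of independent uniform points (`lintegral_poisson_valueCounts`), so the mean cost is a
Poisson mixture (`fRef_eq`). Size-biasing turns it into L^p times the average of u(n+1) over a
Poisson variable n of mean L^d, and monotonicity of u with Poisson tail bounds gives the same limit
f (`tendsto_rpow_mul_poissonAverage`). -/

theorem transportCost_le {μ ν : Measure (EuclideanSpace ℝ (Fin d))}
    {π : Measure (EuclideanSpace ℝ (Fin d) × EuclideanSpace ℝ (Fin d))} (h : IsCoupling π μ ν) :
    transportCost p μ ν ≤ ∫⁻ z, edist z.1 z.2 ^ p ∂π :=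
  iInf₂_le π h

theorem measurable_edist_rpow :
    Measurable fun z : EuclideanSpace ℝ (Fin d) × EuclideanSpace ℝ (Fin d) =>
      edist z.1 z.2 ^ p :=
  measurable_edist.pow_const p

theorem IsCoupling.add {E : Type*} [MeasurableSpace E] {π π' : Measure (E × E)}
    {μ ν μ' ν' : Measure E} (h : IsCoupling π μ ν) (h' : IsCoupling π' μ' ν') :
    IsCoupling (π + π') (μ + μ') (ν + ν') := by
  refine ⟨?_, ?_⟩
  · rw [Measure.map_add _ _ measurable_fst, h.1, h'.1]
  · rw [Measure.map_add _ _ measurable_snd, h.2, h'.2]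

theorem IsCoupling.smul {E : Type*} [MeasurableSpace E] {π : Measure (E × E)}
    {μ ν : Measure E} (h : IsCoupling π μ ν) (c : ℝ≥0∞) :
    IsCoupling (c • π) (c • μ) (c • ν) := by
  refine ⟨?_, ?_⟩
  · rw [Measure.map_smul, h.1]
  · rw [Measure.map_smul, h.2]

theorem IsCoupling.map {E F : Type*} [MeasurableSpace E] [MeasurableSpace F] {π : Measure (E × E)}
    {μ ν : Measure E} (h : IsCoupling π μ ν) {f : E → F} (hf : Measurable f) :
    IsCoupling (π.map (Prod.map f f)) (μ.map f) (ν.map f) := by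
  refine ⟨?_, ?_⟩
  · rw [Measure.map_map measurable_fst (hf.prodMap hf), ← h.1, Measure.map_map hf measurable_fst]
    rfl
  · rw [Measure.map_map measurable_snd (hf.prodMap hf), ← h.2, Measure.map_map hf measurable_snd]
    rfl

theorem isCoupling_map_map {E Y : Type*} [MeasurableSpace E] [MeasurableSpace Y] (ρ : Measure Y)
    {f g : Y → E} (hf : Measurable f) (hg : Measurable g) :
    IsCoupling (ρ.map fun y => (f y, g y)) (ρ.map f) (ρ.map g) := by
  refine ⟨?_, ?_⟩
  · rw [Measure.map_map measurable_fst (hf.prodMk hg)]; rfl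
  · rw [Measure.map_map measurable_snd (hf.prodMk hg)]; rfl

theorem transportCost_add_le (μ ν μ' ν' : Measure (EuclideanSpace ℝ (Fin d))) :
    transportCost p (μ + μ') (ν + ν') ≤ transportCost p μ ν + transportCost p μ' ν' := by
  simp only [transportCost, ENNReal.iInf_add, ENNReal.add_iInf]
  refine le_iInf₂ fun π' h' => le_iInf₂ fun π h => ?_
  rw [← lintegral_add_measure]
  exact iInf₂_le (π + π') (h.add h')

theorem transportCost_zero : transportCost p (0 : Measure (EuclideanSpace ℝ (Fin d))) 0 = 0 := by
  refine le_antisymm ((transportCost_le (π := 0) ⟨by simp, by simp⟩).trans (by simp)) zero_le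

theorem transportCost_sum_le {ι : Type*} (s : Finset ι)
    (μ ν : ι → Measure (EuclideanSpace ℝ (Fin d))) :
    transportCost p (∑ i ∈ s, μ i) (∑ i ∈ s, ν i) ≤ ∑ i ∈ s, transportCost p (μ i) (ν i) := by
  classical
  induction s using Finset.induction_on with
  | empty => simp [transportCost_zero]
  | insert a s ha ih =>
    simp only [Finset.sum_insert ha]
    exact (transportCost_add_le _ _ _ _).trans (by gcongr)

theorem transportCost_smul_le (c : ℝ≥0∞) (hc : c ≠ ∞) (μ ν : Measure (EuclideanSpace ℝ (Fin d))) :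
    transportCost p (c • μ) (c • ν) ≤ c * transportCost p μ ν := by
  rcases eq_or_ne c 0 with rfl | h0
  · simp [transportCost_zero]
  simp only [transportCost, ENNReal.mul_iInf_of_ne h0 hc]
  refine le_iInf₂ fun π h => ?_
  refine (iInf₂_le (c • π) (h.smul c)).trans_eq ?_
  rw [lintegral_smul_measure, smul_eq_mul]

theorem transportCost_smul {c : ℝ≥0∞} (h0 : c ≠ 0) (hc : c ≠ ∞)
    (μ ν : Measure (EuclideanSpace ℝ (Fin d))) :
    transportCost p (c • μ) (c • ν) = c * transportCost p μ ν := by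
  refine le_antisymm (transportCost_smul_le c hc μ ν) ?_
  have := transportCost_smul_le (p := p) c⁻¹ (ENNReal.inv_ne_top.2 h0) (c • μ) (c • ν)
  rw [smul_smul, smul_smul, ENNReal.inv_mul_cancel h0 hc, one_smul, one_smul] at this
  calc c * transportCost p μ ν ≤ c * (c⁻¹ * transportCost p (c • μ) (c • ν)) := by gcongr
    _ = _ := by rw [← mul_assoc, ENNReal.mul_inv_cancel h0 hc, one_mul]

theorem transportCost_map_le (hp : 0 ≤ p) {f : EuclideanSpace ℝ (Fin d) → EuclideanSpace ℝ (Fin d)}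
    (hf : Measurable f) {K : ℝ≥0∞} (h0 : K ≠ 0) (hK : K ≠ ∞)
    (hfK : ∀ x y, edist (f x) (f y) ≤ K * edist x y)
    (μ ν : Measure (EuclideanSpace ℝ (Fin d))) :
    transportCost p (μ.map f) (ν.map f) ≤ K ^ p * transportCost p μ ν := by
  have hKp0 : K ^ p ≠ 0 := by simp [ENNReal.rpow_eq_zero_iff, h0, hK]
  have hKp : K ^ p ≠ ∞ := ENNReal.rpow_ne_top_of_nonneg hp hK
  rw [transportCost, transportCost]
  simp only [ENNReal.mul_iInf_of_ne hKp0 hKp]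
  refine le_iInf₂ fun π h => (iInf₂_le (π.map (Prod.map f f)) (h.map hf)).trans ?_
  rw [lintegral_map measurable_edist_rpow (hf.prodMap hf),
    ← lintegral_const_mul _ measurable_edist_rpow]
  refine lintegral_mono fun z => ?_
  simp only [Prod.map_fst, Prod.map_snd]
  rw [← ENNReal.mul_rpow_of_nonneg _ _ hp]
  exact ENNReal.rpow_le_rpow (hfK _ _) hp

theorem transportCost_map_map_le {Y : Type*} [MeasurableSpace Y] (ρ : Measure Y)
    {f g : Y → EuclideanSpace ℝ (Fin d)} (hf : Measurable f) (hg : Measurable g) :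
    transportCost p (ρ.map f) (ρ.map g) ≤ ∫⁻ y, edist (f y) (g y) ^ p ∂ρ := by
  refine (transportCost_le (isCoupling_map_map ρ hf hg)).trans ?_
  rw [lintegral_map measurable_edist_rpow (hf.prodMk hg)]

theorem transportCost_dirac_le (x y : EuclideanSpace ℝ (Fin d)) :
    transportCost p (Measure.dirac x) (Measure.dirac y) ≤ edist x y ^ p := by
  have := transportCost_map_map_le (p := p) (Measure.dirac ()) (f := fun _ => x) (g := fun _ => y)
    measurable_const measurable_const
  simpa [Measure.map_dirac] using this

theorem isCoupling_prod {E : Type*} [MeasurableSpace E] {μ ν : Measure E} [IsFiniteMeasure μ]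
    [IsFiniteMeasure ν] (h : μ Set.univ = ν Set.univ) :
    IsCoupling ((μ Set.univ)⁻¹ • μ.prod ν) μ ν := by
  rcases eq_or_ne (μ Set.univ) 0 with h0 | h0
  · have h1 : ν Set.univ = 0 := h ▸ h0
    rw [Measure.measure_univ_eq_zero] at h0 h1
    subst h0 h1
    exact ⟨by simp, by simp⟩
  · refine ⟨?_, ?_⟩
    · rw [Measure.map_smul, Measure.map_fst_prod, smul_smul, ← h,
        ENNReal.inv_mul_cancel h0 (measure_ne_top _ _), one_smul]
    · rw [Measure.map_smul, Measure.map_snd_prod, smul_smul,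
        ENNReal.inv_mul_cancel h0 (measure_ne_top _ _), one_smul]

theorem transportCost_le_of_bounded (hp : 0 ≤ p) {μ ν : Measure (EuclideanSpace ℝ (Fin d))}
    [IsFiniteMeasure μ] [IsFiniteMeasure ν] (h : μ Set.univ = ν Set.univ)
    {S S' : Set (EuclideanSpace ℝ (Fin d))} (hμ : ∀ᵐ x ∂μ, x ∈ S) (hν : ∀ᵐ y ∂ν, y ∈ S') {D : ℝ≥0∞}
    (hD : ∀ x ∈ S, ∀ y ∈ S', edist x y ≤ D) :
    transportCost p μ ν ≤ μ Set.univ * D ^ p := by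
  refine (transportCost_le (isCoupling_prod h)).trans ?_
  rw [lintegral_smul_measure]
  have h1 : ∫⁻ z, edist z.1 z.2 ^ p ∂(μ.prod ν) ≤ μ Set.univ * (ν Set.univ * D ^ p) := by
    rw [lintegral_prod _ measurable_edist_rpow.aemeasurable]
    calc _ ≤ ∫⁻ _, ν Set.univ * D ^ p ∂μ := by
          refine lintegral_mono_ae ?_
          filter_upwards [hμ] with x hx
          calc _ ≤ ∫⁻ _, D ^ p ∂ν := by
                refine lintegral_mono_ae ?_
                filter_upwards [hν] with y hy
                exact ENNReal.rpow_le_rpow (hD x hx y hy) hp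
            _ = _ := by rw [lintegral_const, mul_comm]
      _ = _ := by rw [lintegral_const, mul_comm]
  rcases eq_or_ne (μ Set.univ) 0 with h0 | h0
  · have : ∫⁻ z, edist z.1 z.2 ^ p ∂(μ.prod ν) = 0 := by simpa [h0] using h1
    simp [this]
  · calc _ ≤ (μ Set.univ)⁻¹ * (μ Set.univ * (ν Set.univ * D ^ p)) := by
          rw [smul_eq_mul]; gcongr
      _ = μ Set.univ * D ^ p := by
        rw [← mul_assoc, ENNReal.inv_mul_cancel h0 (measure_ne_top _ _), one_mul, h]

theorem IsCoupling.isFiniteMeasure {E : Type*} [MeasurableSpace E] {π : Measure (E × E)}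
    {μ ν : Measure E} [IsFiniteMeasure μ] (h : IsCoupling π μ ν) : IsFiniteMeasure π := by
  constructor
  have : π Set.univ = μ Set.univ := by
    rw [← h.1, Measure.map_apply measurable_fst MeasurableSet.univ, Set.preimage_univ]
  rw [this]
  exact measure_lt_top _ _

/-- Two couplings with a common marginal can be glued along it. -/
theorem IsCoupling.exists_glue {E : Type*} [MeasurableSpace E] [StandardBorelSpace E] [Nonempty E]
    {π σ : Measure (E × E)} {μ ν ρ : Measure E} [IsFiniteMeasure ν]
    (h : IsCoupling π μ ν) (h' : IsCoupling σ ν ρ) :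
    ∃ γ : Measure (E × E × E), γ.map (fun z => (z.2.1, z.1)) = π ∧
      γ.map (fun z => (z.1, z.2.2)) = σ := by
  have hσ : IsFiniteMeasure σ := h'.isFiniteMeasure
  let π' := π.map Prod.swap
  have hπ' : IsCoupling π' ν μ := by
    refine ⟨?_, ?_⟩
    · rw [Measure.map_map measurable_fst measurable_swap, ← h.2]; rfl
    · rw [Measure.map_map measurable_snd measurable_swap, ← h.1]; rfl
  have : IsFiniteMeasure π' := hπ'.isFiniteMeasure
  have e1 : ν ⊗ₘ π'.condKernel = π' := by
    have := π'.disintegrate π'.condKernel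
    rwa [Measure.fst, hπ'.1] at this
  have e2 : ν ⊗ₘ σ.condKernel = σ := by
    have := σ.disintegrate σ.condKernel
    rwa [Measure.fst, h'.1] at this
  -- Conditionally on the shared point, the two outer points are drawn independently from the two
  -- disintegrations.
  refine ⟨ν ⊗ₘ (π'.condKernel ×ₖ σ.condKernel), ?_, ?_⟩
  · have : π = π'.map Prod.swap := by
      rw [Measure.map_map measurable_swap measurable_swap]; simp
    conv_rhs => rw [this, ← e1]
    ext s hs
    rw [Measure.map_apply (by fun_prop) hs, Measure.map_apply measurable_swap hs,
      Measure.compProd_apply (measurable_swap hs),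
      Measure.compProd_apply ((by fun_prop : Measurable fun z : E × E × E => (z.2.1, z.1)) hs)]
    refine lintegral_congr fun x => ?_
    rw [Kernel.prod_apply]
    have : (Prod.mk x ⁻¹' ((fun z : E × E × E => (z.2.1, z.1)) ⁻¹' s)) =
        (Prod.mk x ⁻¹' (Prod.swap ⁻¹' s)) ×ˢ Set.univ := by
      ext z; simp
    rw [this, Measure.prod_prod]
    simp
  · conv_rhs => rw [← e2]
    ext s hs
    rw [Measure.map_apply (by fun_prop) hs, Measure.compProd_apply hs,
      Measure.compProd_apply ((by fun_prop : Measurable fun z : E × E × E => (z.1, z.2.2)) hs)]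
    refine lintegral_congr fun x => ?_
    rw [Kernel.prod_apply]
    have : (Prod.mk x ⁻¹' ((fun z : E × E × E => (z.1, z.2.2)) ⁻¹' s)) =
        Set.univ ×ˢ (Prod.mk x ⁻¹' s) := by
      ext z; simp
    rw [this, Measure.prod_prod]
    simp

/-- The power 1/p is an order isomorphism of [0, ∞], hence commutes with infima. The triangle
inequality can thus be proved coupling by coupling, without minimisers. -/
theorem transportCost_rpow_eq (hp : 0 < p) (μ ν : Measure (EuclideanSpace ℝ (Fin d))) :
    transportCost p μ ν ^ (1 / p) =
      ⨅ (π : Measure (EuclideanSpace ℝ (Fin d) × EuclideanSpace ℝ (Fin d)))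
        (_ : IsCoupling π μ ν), (∫⁻ z, edist z.1 z.2 ^ p ∂π) ^ (1 / p) := by
  have h := fun x => ENNReal.orderIsoRpow_apply (1 / p) (by positivity) x
  rw [transportCost, ← h, OrderIso.map_iInf]
  refine iInf_congr fun π => ?_
  rw [OrderIso.map_iInf]
  simp only [h]

/-- Glue the two couplings along the middle measure and apply Minkowski's inequality in L^p of the
glued measure. Finiteness of the middle measure is what permits the disintegration. -/
theorem transportCost_triangle (hp : 1 ≤ p) {μ ν ρ : Measure (EuclideanSpace ℝ (Fin d))}
    [IsFiniteMeasure ν] :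
    transportCost p μ ρ ^ (1 / p) ≤
      transportCost p μ ν ^ (1 / p) + transportCost p ν ρ ^ (1 / p) := by
  have hp0 : 0 < p := by linarith
  rw [transportCost_rpow_eq hp0 μ ν, transportCost_rpow_eq hp0 ν ρ]
  simp only [ENNReal.iInf_add, ENNReal.add_iInf]
  refine le_iInf₂ fun σ hσ => le_iInf₂ fun π hπ => ?_
  obtain ⟨γ, h1, h2⟩ := hπ.exists_glue hσ
  have hc : IsCoupling (γ.map fun z => (z.2.1, z.2.2)) μ ρ := by
    refine ⟨?_, ?_⟩
    · rw [← hπ.1, ← h1, Measure.map_map measurable_fst (by fun_prop),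
        Measure.map_map measurable_fst (by fun_prop)]; rfl
    · rw [← hσ.2, ← h2, Measure.map_map measurable_snd (by fun_prop),
        Measure.map_map measurable_snd (by fun_prop)]; rfl
  have hm : ∀ {f g : EuclideanSpace ℝ (Fin d) × EuclideanSpace ℝ (Fin d) ×
      EuclideanSpace ℝ (Fin d) → EuclideanSpace ℝ (Fin d)}, Measurable f → Measurable g →
      ∫⁻ z, edist z.1 z.2 ^ p ∂(γ.map fun z => (f z, g z)) = ∫⁻ z, edist (f z) (g z) ^ p ∂γ :=
    fun hf hg => lintegral_map measurable_edist_rpow (hf.prodMk hg)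
  let f : EuclideanSpace ℝ (Fin d) × EuclideanSpace ℝ (Fin d) × EuclideanSpace ℝ (Fin d) →
    ℝ≥0∞ := fun z => edist z.2.1 z.1
  let g : EuclideanSpace ℝ (Fin d) × EuclideanSpace ℝ (Fin d) × EuclideanSpace ℝ (Fin d) →
    ℝ≥0∞ := fun z => edist z.1 z.2.2
  have hf : AEMeasurable f γ := by fun_prop
  have hg : AEMeasurable g γ := by fun_prop
  calc _ ≤ (∫⁻ z, edist z.2.1 z.2.2 ^ p ∂γ) ^ (1 / p) := by
        rw [← hm (by fun_prop) (by fun_prop)]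
        exact ENNReal.rpow_le_rpow (transportCost_le hc) (by positivity)
    _ ≤ (∫⁻ z, (f + g) z ^ p ∂γ) ^ (1 / p) := by
        refine ENNReal.rpow_le_rpow (lintegral_mono fun z => ?_) (by positivity)
        exact ENNReal.rpow_le_rpow (edist_triangle _ _ _) hp0.le
    _ ≤ (∫⁻ z, edist z.2.1 z.1 ^ p ∂γ) ^ (1 / p) + (∫⁻ z, edist z.1 z.2.2 ^ p ∂γ) ^ (1 / p) :=
        ENNReal.lintegral_Lp_add_le hf hg hp
    _ = _ := by
        conv_rhs => rw [← h1, ← h2]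
        rw [hm (by fun_prop) (by fun_prop), hm (by fun_prop) (by fun_prop)]

end Transport

/-! ### Uniform measures on boxes, and the cost of equalising the density between two parts. -/

section Boxes

variable {d : ℕ}

/-- The uniform probability measure on the unit cube. -/
noncomputable def unitCubeMeasure (d : ℕ) : Measure (EuclideanSpace ℝ (Fin d)) :=
  volume.restrict (cube d 1)

/-- The map `y ↦ a + w y` (coordinatewise). -/
noncomputable def affineBox (a w : Fin d → ℝ) (y : EuclideanSpace ℝ (Fin d)) :
    EuclideanSpace ℝ (Fin d) :=
  WithLp.toLp 2 fun i => a i + w i * y i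

/-- The uniform probability measure on the box with lower corner `a` and side lengths `w`
(with no condition on `w`). -/
noncomputable def unifBox (a w : Fin d → ℝ) : Measure (EuclideanSpace ℝ (Fin d)) :=
  (unitCubeMeasure d).map (affineBox a w)

/-- The half-open box with lower corner `a` and side lengths `w`. -/
def box (a w : Fin d → ℝ) : Set (EuclideanSpace ℝ (Fin d)) :=
  {x | ∀ i, x i ∈ Set.Ico (a i) (a i + w i)}

/-- The uniform probability measure on the interval between `a` and `a + w`. -/
noncomputable def unifSegment (a w : ℝ) : Measure ℝ :=
  (volume.restrict (Set.Icc (0 : ℝ) 1)).map fun t => a + w * t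

instance : IsProbabilityMeasure (volume.restrict (Set.Icc (0 : ℝ) 1)) :=
  ⟨by simp⟩

instance (a w : ℝ) : IsProbabilityMeasure (unifSegment a w) :=
  Measure.isProbabilityMeasure_map (by fun_prop)

@[fun_prop]
theorem measurable_affineBox (a w : Fin d → ℝ) : Measurable (affineBox a w) := by
  unfold affineBox
  fun_prop

theorem measurableSet_cube (d : ℕ) (L : ℝ) : MeasurableSet (cube d L) := by
  have : cube d L = ⋂ i, (fun x : EuclideanSpace ℝ (Fin d) => x i) ⁻¹' Set.Icc 0 L := by
    ext x; simp [cube]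
  rw [this]
  exact MeasurableSet.iInter fun i => (by fun_prop : Measurable _) measurableSet_Icc

theorem measurableSet_box (a w : Fin d → ℝ) : MeasurableSet (box a w) := by
  have : box a w = ⋂ i, (fun x : EuclideanSpace ℝ (Fin d) => x i) ⁻¹' Set.Ico (a i) (a i + w i) := by
    ext x; simp [box]
  rw [this]
  exact MeasurableSet.iInter fun i => (by fun_prop : Measurable _) measurableSet_Ico

theorem volume_restrict_pi_set (s : Fin d → Set ℝ) (hs : ∀ i, MeasurableSet (s i)) :
    (volume : Measure (EuclideanSpace ℝ (Fin d))).restrict {x | ∀ i, x i ∈ s i} =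
      (Measure.pi fun i => volume.restrict (s i)).map (WithLp.toLp 2) := by
  have hS : MeasurableSet {x : EuclideanSpace ℝ (Fin d) | ∀ i, x i ∈ s i} := by
    have : {x : EuclideanSpace ℝ (Fin d) | ∀ i, x i ∈ s i} =
        ⋂ i, (fun x : EuclideanSpace ℝ (Fin d) => x i) ⁻¹' s i := by
      ext x; simp
    rw [this]
    exact MeasurableSet.iInter fun i => (by fun_prop : Measurable _) (hs i)
  rw [← (PiLp.volume_preserving_toLp (Fin d)).map_eq,
    Measure.restrict_map (by fun_prop) hS, ← Measure.restrict_pi_pi, volume_pi]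
  congr 2
  ext x; simp

theorem unitCubeMeasure_eq :
    unitCubeMeasure d =
      (Measure.pi fun _ => volume.restrict (Set.Icc (0 : ℝ) 1)).map (WithLp.toLp 2) :=
  volume_restrict_pi_set (fun _ => Set.Icc 0 1) fun _ => measurableSet_Icc

instance : IsProbabilityMeasure (unitCubeMeasure d) := by
  rw [unitCubeMeasure_eq]
  exact Measure.isProbabilityMeasure_map (by fun_prop)

instance (a w : Fin d → ℝ) : IsProbabilityMeasure (unifBox a w) :=
  Measure.isProbabilityMeasure_map (by fun_prop)

theorem unifBox_eq (a w : Fin d → ℝ) :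
    unifBox a w = (Measure.pi fun i => unifSegment (a i) (w i)).map (WithLp.toLp 2) := by
  unfold unifSegment
  rw [unifBox, unitCubeMeasure_eq, Measure.map_map (by fun_prop) (by fun_prop),
    ← Measure.pi_map_pi (fun i => by fun_prop), Measure.map_map (by fun_prop) (by fun_prop)]
  rfl

theorem unifSegment_smul {a w : ℝ} (hw : 0 < w) :
    ENNReal.ofReal w • unifSegment a w = volume.restrict (Set.Icc a (a + w)) := by
  have h1 : (fun t : ℝ => a + w * t) ⁻¹' Set.Icc a (a + w) = Set.Icc 0 1 := by
    ext t
    simp only [Set.mem_preimage, Set.mem_Icc]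
    constructor
    · rintro ⟨h, h'⟩; exact ⟨by nlinarith, by nlinarith⟩
    · rintro ⟨h, h'⟩; exact ⟨by nlinarith, by nlinarith⟩
  have h2 : ENNReal.ofReal w • Measure.map (fun t : ℝ => a + w * t) volume = volume := by
    have : (fun t : ℝ => a + w * t) = (fun t => a + t) ∘ fun t => w * t := rfl
    rw [this, ← Measure.map_map (by fun_prop) (by fun_prop), ← Measure.map_smul]
    have := Real.smul_map_volume_mul_left hw.ne'
    rw [abs_of_pos hw] at this
    rw [this, map_add_left_eq_self]
  rw [unifSegment, ← h1, ← Measure.restrict_map (by fun_prop) measurableSet_Icc,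
    ← Measure.restrict_smul, h2]

/-- The endpoints θ = 0 and θ = 1, where one part degenerates to a point mass of weight zero, are
needed later: they occur when one half of a box contains no point. -/
theorem unifSegment_split (a w : ℝ) {θ : ℝ} (h0 : 0 ≤ θ) (h1 : θ ≤ 1) :
    unifSegment a w = ENNReal.ofReal θ • unifSegment a (θ * w) +
      ENNReal.ofReal (1 - θ) • unifSegment (a + θ * w) ((1 - θ) * w) := by
  rcases h0.eq_or_lt with rfl | h0
  · simp
  rcases h1.eq_or_lt with rfl | h1
  · simp
  have key : (volume.restrict (Set.Icc (0 : ℝ) 1)) =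
      ENNReal.ofReal θ • unifSegment 0 θ + ENNReal.ofReal (1 - θ) • unifSegment θ (1 - θ) := by
    rw [unifSegment_smul h0, unifSegment_smul (by linarith : 0 < 1 - θ), zero_add,
      add_sub_cancel, ← restrict_Ico_eq_restrict_Icc, ← restrict_Ico_eq_restrict_Icc,
      ← restrict_Ico_eq_restrict_Icc,
      ← Measure.restrict_union (Set.Ico_disjoint_Ico_same) measurableSet_Ico,
      Set.Ico_union_Ico_eq_Ico h0.le h1.le]
  have hm : Measurable fun t : ℝ => a + w * t := by fun_prop
  conv_lhs => rw [unifSegment, key]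
  rw [Measure.map_add _ _ hm, Measure.map_smul, Measure.map_smul]
  congr 2
  · rw [unifSegment, unifSegment, Measure.map_map hm (by fun_prop)]
    congr 1
    ext t; simp; ring
  · rw [unifSegment, unifSegment, Measure.map_map hm (by fun_prop)]
    congr 1
    ext t; simp; ring

/-- Three product measures that differ only in the factor of index i, so on rectangles the identity
reduces to the one for segments. -/
theorem unifBox_split (a w : Fin d → ℝ) (i : Fin d) {θ : ℝ} (h0 : 0 ≤ θ) (h1 : θ ≤ 1) :
    unifBox a w = ENNReal.ofReal θ • unifBox a (Function.update w i (θ * w i)) +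
      ENNReal.ofReal (1 - θ) • unifBox (Function.update a i (a i + θ * w i))
        (Function.update w i ((1 - θ) * w i)) := by
  simp only [unifBox_eq]
  rw [← Measure.map_smul, ← Measure.map_smul, ← Measure.map_add _ _ (by fun_prop)]
  congr 1
  refine Measure.pi_eq fun s hs => ?_
  rw [Measure.add_apply, Measure.smul_apply, Measure.smul_apply, Measure.pi_pi, Measure.pi_pi,
    ← Finset.mul_prod_erase _ _ (Finset.mem_univ i), ← Finset.mul_prod_erase _ _ (Finset.mem_univ i),
    ← Finset.mul_prod_erase _ _ (Finset.mem_univ i)]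
  have e1 : ∏ x ∈ Finset.univ.erase i, unifSegment (a x) (Function.update w i (θ * w i) x) (s x) =
      ∏ x ∈ Finset.univ.erase i, unifSegment (a x) (w x) (s x) := by
    refine Finset.prod_congr rfl fun x hx => ?_
    rw [Function.update_of_ne (Finset.ne_of_mem_erase hx)]
  have e2 : ∏ x ∈ Finset.univ.erase i, unifSegment (Function.update a i (a i + θ * w i) x)
        (Function.update w i ((1 - θ) * w i) x) (s x) =
      ∏ x ∈ Finset.univ.erase i, unifSegment (a x) (w x) (s x) := by
    refine Finset.prod_congr rfl fun x hx => ?_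
    rw [Function.update_of_ne (Finset.ne_of_mem_erase hx),
      Function.update_of_ne (Finset.ne_of_mem_erase hx)]
  rw [e1, e2, Function.update_self, Function.update_self, Function.update_self, smul_eq_mul,
    smul_eq_mul, ← mul_assoc, ← mul_assoc, ← add_mul, unifSegment_split (a i) (w i) h0 h1]
  simp

theorem volume_restrict_box (a : Fin d → ℝ) {w : Fin d → ℝ} (hw : ∀ i, 0 < w i) :
    volume.restrict (box a w) = ENNReal.ofReal (∏ i, w i) • unifBox a w := by
  rw [box, volume_restrict_pi_set _ fun i => measurableSet_Ico, unifBox_eq, ← Measure.map_smul]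
  congr 1
  refine Measure.pi_eq fun s hs => ?_
  rw [Measure.smul_apply, Measure.pi_pi, smul_eq_mul,
    ENNReal.ofReal_prod_of_nonneg fun i _ => (hw i).le, ← Finset.prod_mul_distrib]
  refine Finset.prod_congr rfl fun i _ => ?_
  rw [restrict_Ico_eq_restrict_Icc, ← unifSegment_smul (hw i), Measure.smul_apply, smul_eq_mul]

theorem volume_restrict_cube {L : ℝ} (hL : 0 < L) :
    volume.restrict (cube d L) =
      ENNReal.ofReal (L ^ d) • unifBox (fun _ => 0) (fun _ : Fin d => L) := by
  rw [cube, volume_restrict_pi_set _ fun i => measurableSet_Icc, unifBox_eq, ← Measure.map_smul]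
  congr 1
  refine Measure.pi_eq fun s hs => ?_
  have : ENNReal.ofReal (L ^ d) = ∏ _ : Fin d, ENNReal.ofReal L := by
    rw [Finset.prod_const, ENNReal.ofReal_pow hL.le, Finset.card_univ, Fintype.card_fin]
  rw [Measure.smul_apply, Measure.pi_pi, smul_eq_mul, this, ← Finset.prod_mul_distrib]
  refine Finset.prod_congr rfl fun i _ => ?_
  have := unifSegment_smul (a := 0) hL
  rw [zero_add] at this
  rw [← this, Measure.smul_apply, smul_eq_mul]

theorem volume_cube {L : ℝ} (hL : 0 < L) : volume (cube d L) = ENNReal.ofReal (L ^ d) := by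
  have := congrArg (fun m => m Set.univ) (volume_restrict_cube (d := d) hL)
  simpa using this

theorem unitCubeMeasure_restrict_box {a w : Fin d → ℝ} (hw : ∀ i, 0 < w i) (ha : ∀ i, 0 ≤ a i)
    (haw : ∀ i, a i + w i ≤ 1) :
    (unitCubeMeasure d).restrict (box a w) = ENNReal.ofReal (∏ i, w i) • unifBox a w := by
  rw [unitCubeMeasure, Measure.restrict_restrict (measurableSet_box _ _), ← volume_restrict_box a hw]
  congr 1
  refine Set.inter_eq_left.2 fun x hx i => ?_
  exact ⟨(ha i).trans (hx i).1, (hx i).2.le.trans (haw i)⟩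

theorem ae_mem_cube : ∀ᵐ x ∂(unitCubeMeasure d), x ∈ cube d 1 :=
  ae_restrict_mem (measurableSet_cube d 1)

theorem edist_le_sum (x y : EuclideanSpace ℝ (Fin d)) :
    edist x y ≤ ∑ i, ENNReal.ofReal |x i - y i| := by
  rw [edist_dist, ← ENNReal.ofReal_sum_of_nonneg fun i _ => abs_nonneg _]
  refine ENNReal.ofReal_le_ofReal ?_
  rw [EuclideanSpace.dist_eq]
  refine Real.sqrt_le_iff.2 ⟨Finset.sum_nonneg fun i _ => abs_nonneg _, ?_⟩
  simp only [Real.dist_eq]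
  exact Finset.sum_sq_le_sq_sum_of_nonneg fun i _ => abs_nonneg _

theorem edist_le_of_mem_cube {x y : EuclideanSpace ℝ (Fin d)} (hx : x ∈ cube d 1)
    (hy : y ∈ cube d 1) : edist x y ≤ d := by
  refine (edist_le_sum x y).trans ?_
  calc _ ≤ ∑ _ : Fin d, (1 : ℝ≥0∞) := by
        refine Finset.sum_le_sum fun i _ => ?_
        rw [← ENNReal.ofReal_one]
        refine ENNReal.ofReal_le_ofReal ?_
        have := hx i; have := hy i
        simp only [Set.mem_Icc] at *
        rw [abs_le]; constructor <;> linarith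
    _ = d := by simp

/-- Transporting the mass in the two parts of a box to the uniform density. -/
theorem transportCost_merge_le {p : ℝ} (hp : 0 ≤ p) (a w : Fin d → ℝ) (i : Fin d) {θ : ℝ}
    (hw : 0 ≤ w i) (k₁ k₂ : ℕ) :
    transportCost p
      ((k₁ : ℝ≥0∞) • unifBox a (Function.update w i (θ * w i)) +
        (k₂ : ℝ≥0∞) • unifBox (Function.update a i (a i + θ * w i))
          (Function.update w i ((1 - θ) * w i)))
      (((k₁ + k₂ : ℕ) : ℝ≥0∞) • unifBox a w) ≤
    ((k₁ + k₂ : ℕ) : ℝ≥0∞) *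
      ENNReal.ofReal (w i * |(k₁ : ℝ) / (k₁ + k₂ : ℕ) - θ|) ^ p := by
  rcases Nat.eq_zero_or_pos (k₁ + k₂) with h | hk
  · obtain ⟨rfl, rfl⟩ : k₁ = 0 ∧ k₂ = 0 := by omega
    simp [transportCost_zero]
  have hkR : (0 : ℝ) < (k₁ + k₂ : ℕ) := by exact_mod_cast hk
  -- Cutting the target box at the empirical proportion τ, not at θ, gives its two parts exactly the
  -- masses k₁ and k₂, so each part of the source can be stretched onto the corresponding part of
  -- the target.
  set τ : ℝ := (k₁ : ℝ) / (k₁ + k₂ : ℕ) with hτ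
  have hτ0 : 0 ≤ τ := by positivity
  have hτ1 : τ ≤ 1 := by
    rw [hτ, div_le_one hkR]; push_cast; linarith [(Nat.cast_nonneg k₂ : (0 : ℝ) ≤ k₂)]
  have c1 : ((k₁ + k₂ : ℕ) : ℝ≥0∞) * ENNReal.ofReal τ = k₁ := by
    rw [← ENNReal.ofReal_natCast, ← ENNReal.ofReal_mul hkR.le, hτ, mul_div_cancel₀ _ hkR.ne',
      ENNReal.ofReal_natCast]
  have c2 : ((k₁ + k₂ : ℕ) : ℝ≥0∞) * ENNReal.ofReal (1 - τ) = k₂ := by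
    rw [← ENNReal.ofReal_natCast, ← ENNReal.ofReal_mul hkR.le, hτ, mul_sub,
      mul_div_cancel₀ _ hkR.ne', mul_one]
    push_cast
    rw [add_sub_cancel_left, ENNReal.ofReal_natCast]
  have hU : ((k₁ + k₂ : ℕ) : ℝ≥0∞) • unifBox a w =
      (k₁ : ℝ≥0∞) • unifBox a (Function.update w i (τ * w i)) +
        (k₂ : ℝ≥0∞) • unifBox (Function.update a i (a i + τ * w i))
          (Function.update w i ((1 - τ) * w i)) := by
    conv_lhs => rw [unifBox_split a w i hτ0 hτ1]
    rw [smul_add, smul_smul, smul_smul, c1, c2]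
  -- The coupling sends the image of y in one box to the image of the same y in the other. Only the
  -- coordinate i moves, so the ℓ¹ bound on the distance has a single nonzero term.
  have key : ∀ (a₁ a₂ w₁ w₂ : Fin d → ℝ), (∀ j, j ≠ i → a₁ j = a₂ j) → (∀ j, j ≠ i → w₁ j = w₂ j) →
      (∀ t ∈ Set.Icc (0 : ℝ) 1, |(a₁ i + w₁ i * t) - (a₂ i + w₂ i * t)| ≤ w i * |τ - θ|) →
      transportCost p (unifBox a₁ w₁) (unifBox a₂ w₂) ≤ ENNReal.ofReal (w i * |τ - θ|) ^ p := by
    intro a₁ a₂ w₁ w₂ ha hw' hd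
    refine (transportCost_map_map_le _ (by fun_prop) (by fun_prop)).trans ?_
    calc _ ≤ ∫⁻ _, ENNReal.ofReal (w i * |τ - θ|) ^ p ∂(unitCubeMeasure d) := by
          refine lintegral_mono_ae ?_
          filter_upwards [ae_mem_cube] with y hy
          refine ENNReal.rpow_le_rpow ((edist_le_sum _ _).trans ?_) hp
          rw [Finset.sum_eq_single i]
          · exact ENNReal.ofReal_le_ofReal (hd _ (hy i))
          · intro j _ hj
            simp [affineBox, ha j hj, hw' j hj]
          · simp
      _ = _ := by simp
  rw [hU]
  refine (transportCost_add_le _ _ _ _).trans ?_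
  calc _ ≤ (k₁ : ℝ≥0∞) * ENNReal.ofReal (w i * |τ - θ|) ^ p +
        (k₂ : ℝ≥0∞) * ENNReal.ofReal (w i * |τ - θ|) ^ p := by
        refine add_le_add ((transportCost_smul_le _ (ENNReal.natCast_ne_top _) _ _).trans ?_)
          ((transportCost_smul_le _ (ENNReal.natCast_ne_top _) _ _).trans ?_)
        · gcongr
          refine key _ _ _ _ (fun j hj => rfl) (fun j hj => by simp [hj]) fun t ht => ?_
          simp only [Function.update_self]
          have : a i + θ * w i * t - (a i + τ * w i * t) = -(w i * (τ - θ) * t) := by ring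
          rw [this, abs_neg, abs_mul, abs_mul, abs_of_nonneg hw, abs_of_nonneg ht.1]
          exact mul_le_of_le_one_right (by positivity) ht.2
        · gcongr
          refine key _ _ _ _ (fun j hj => by simp [hj]) (fun j hj => by simp [hj]) fun t ht => ?_
          simp only [Function.update_self]
          -- The two right-hand boxes share their right face: the displacement vanishes at t = 1 and
          -- is largest at the moved interface t = 0.
          have : a i + θ * w i + (1 - θ) * w i * t - (a i + τ * w i + (1 - τ) * w i * t) =
            -(w i * (τ - θ) * (1 - t)) := by ring
          rw [this, abs_neg, abs_mul, abs_mul, abs_of_nonneg hw,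
            abs_of_nonneg (by linarith [ht.2] : 0 ≤ 1 - t)]
          exact mul_le_of_le_one_right (by positivity) (by linarith [ht.1])
    _ = _ := by rw [← add_mul]; push_cast; rfl

end Boxes

/-! ### Moments and tails of the number of independent points in a set. -/

section Counting

variable {E ι : Type*} [Fintype ι]

open Classical in
/-- The indices of the points of the configuration `x` that lie in `B`. -/
noncomputable def indicesIn (B : Set E) (x : ι → E) : Finset ι :=
  Finset.univ.filter fun i => x i ∈ B

theorem mem_indicesIn {B : Set E} {x : ι → E} {i : ι} : i ∈ indicesIn B x ↔ x i ∈ B := by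
  simp [indicesIn]

theorem card_indicesIn (B : Set E) (x : ι → E) :
    ((indicesIn B x).card : ℝ) = ∑ i, B.indicator (fun _ => (1 : ℝ)) (x i) := by
  classical
  simp [indicesIn, Set.indicator_apply]

variable [MeasurableSpace E]

theorem measurable_card_indicesIn {B : Set E} (hB : MeasurableSet B) :
    Measurable fun x : ι → E => ((indicesIn B x).card : ℝ) := by
  simp only [card_indicesIn]
  exact Finset.measurable_sum _ fun i _ =>
    (measurable_const.indicator hB).comp (measurable_pi_apply i)

theorem measurableSet_indicesIn_eq {B : Set E} (hB : MeasurableSet B) (S : Finset ι) :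
    MeasurableSet {x : ι → E | indicesIn B x = S} := by
  have : {x : ι → E | indicesIn B x = S} =
      ⋂ i, {x : ι → E | x i ∈ B ↔ i ∈ S} := by
    ext x
    simp [Finset.ext_iff, mem_indicesIn]
  rw [this]
  refine MeasurableSet.iInter fun i => ?_
  by_cases hi : i ∈ S
  · simp only [hi, iff_true]
    exact (measurable_pi_apply i : Measurable fun x : ι → E => x i) hB
  · simp only [hi, iff_false]
    exact (measurable_pi_apply i : Measurable fun x : ι → E => x i) hB.compl

variable {μ : Measure E} [IsProbabilityMeasure μ]

/-- Independence turns the expectation into a power. For each factor, e^x ≤ 1 + x + x² on |x| ≤ 1,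
the linear term integrates to zero, and 1 + y ≤ e^y. -/
theorem integral_exp_sum_le {ψ : E → ℝ} (hψ : Measurable ψ) (h1 : ∀ x, |ψ x| ≤ 1)
    (h0 : ∫ x, ψ x ∂μ = 0) {v : ℝ} (hv : ∫ x, ψ x ^ 2 ∂μ ≤ v) {s : ℝ} (hs : |s| ≤ 1) :
    ∫ x : ι → E, Real.exp (s * ∑ i, ψ (x i)) ∂(Measure.pi fun _ => μ) ≤
      Real.exp (Fintype.card ι * (s ^ 2 * v)) := by
  have i1 : Integrable ψ μ :=
    Integrable.of_bound hψ.aestronglyMeasurable 1 (Eventually.of_forall h1)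
  have i2 : Integrable (fun x => ψ x ^ 2) μ :=
    Integrable.of_bound (hψ.pow_const 2).aestronglyMeasurable 1 (Eventually.of_forall fun x => by
      rw [Real.norm_eq_abs, abs_pow]; exact pow_le_one₀ (abs_nonneg _) (h1 x))
  have e : ∀ x : ι → E, Real.exp (s * ∑ i, ψ (x i)) = ∏ i, Real.exp (s * ψ (x i)) := fun x => by
    rw [Finset.mul_sum, Real.exp_sum]
  simp_rw [e]
  rw [integral_fintype_prod_eq_pow (fun y => Real.exp (s * ψ y)), Real.exp_nat_mul]
  refine pow_le_pow_left₀ (integral_nonneg fun x => (Real.exp_pos _).le) ?_ _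
  have i3 : Integrable (fun x => 1 + s * ψ x + s ^ 2 * ψ x ^ 2) μ :=
    ((integrable_const 1).add (i1.const_mul s)).add (i2.const_mul (s ^ 2))
  calc _ ≤ ∫ x, (1 + s * ψ x + s ^ 2 * ψ x ^ 2) ∂μ := by
        refine integral_mono_of_nonneg (Eventually.of_forall fun x => (Real.exp_pos _).le) i3
          (Eventually.of_forall fun x => ?_)
        have hb : |s * ψ x| ≤ 1 := by
          rw [abs_mul]; exact mul_le_one₀ hs (abs_nonneg _) (h1 x)
        have := (abs_le.1 (Real.abs_exp_sub_one_sub_id_le hb)).2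
        simp only
        nlinarith
    _ = 1 + s ^ 2 * ∫ x, ψ x ^ 2 ∂μ := by
        have i4 : Integrable (fun x => 1 + s * ψ x) μ := (integrable_const 1).add (i1.const_mul s)
        rw [integral_add i4 (i2.const_mul (s ^ 2)),
          integral_add (integrable_const 1) (i1.const_mul s), integral_const_mul,
          integral_const_mul, h0]
        simp
    _ ≤ s ^ 2 * v + 1 := by nlinarith [mul_le_mul_of_nonneg_left hv (sq_nonneg s)]
    _ ≤ Real.exp (s ^ 2 * v) := Real.add_one_le_exp _

theorem exists_rpow_le_mul_exp (p : ℝ) : ∃ C : ℝ, 0 < C ∧ ∀ x : ℝ, 1 ≤ x →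
    x ^ p ≤ C * Real.exp x := by
  obtain ⟨N, hN⟩ := exists_nat_ge p
  refine ⟨(Nat.factorial N : ℝ), by positivity, fun x hx => ?_⟩
  have := Real.pow_div_factorial_le_exp x (by linarith) N
  rw [div_le_iff₀ (by positivity)] at this
  calc x ^ p ≤ x ^ (N : ℝ) := Real.rpow_le_rpow_of_exponent_le hx hN
    _ = x ^ N := Real.rpow_natCast _ _
    _ ≤ _ := by linarith

theorem exists_rpow_le_mul_exp_of_nonneg {p : ℝ} (hp : 0 ≤ p) : ∃ C : ℝ, 0 < C ∧ ∀ x : ℝ, 0 ≤ x →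
    x ^ p ≤ C * Real.exp x := by
  obtain ⟨C, hC, h⟩ := exists_rpow_le_mul_exp p
  refine ⟨max C 1, by positivity, fun x hx => ?_⟩
  rcases le_total 1 x with h1 | h1
  · exact (h x h1).trans (by gcongr; exact le_max_left _ _)
  · calc x ^ p ≤ 1 := Real.rpow_le_one hx h1 hp
      _ ≤ 1 * Real.exp x := by rw [one_mul]; exact Real.one_le_exp hx
      _ ≤ _ := by gcongr; exact le_max_right _ _

/-- With l = (number of variables) · v and s = l^(-1/2), the exponential moments at ±s are at most
e, and |y|^p = l^(p/2) (s|y|)^p is at most a constant times l^(p/2) e^(s|y|). The assumption 1 ≤ l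
ensures s ≤ 1. The point is that the constant depends on p only. -/
theorem exists_lintegral_abs_sum_rpow_le {p : ℝ} (hp : 0 ≤ p) : ∃ C : ℝ, 0 < C ∧
    ∀ {E ι : Type} [MeasurableSpace E] [Fintype ι] {μ : Measure E} [IsProbabilityMeasure μ]
      {ψ : E → ℝ}, Measurable ψ → (∀ x, |ψ x| ≤ 1) → (∫ x, ψ x ∂μ = 0) →
      ∀ {v : ℝ}, (∫ x, ψ x ^ 2 ∂μ ≤ v) → 1 ≤ Fintype.card ι * v →
      ∫⁻ x : ι → E, ENNReal.ofReal (|∑ i, ψ (x i)| ^ p) ∂(Measure.pi fun _ => μ) ≤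
        ENNReal.ofReal (C * (Fintype.card ι * v) ^ (p / 2)) := by
  obtain ⟨C, hC, h⟩ := exists_rpow_le_mul_exp_of_nonneg hp
  refine ⟨C * (Real.exp 1 + Real.exp 1), by positivity, ?_⟩
  intro E ι _ _ μ _ ψ hψ h1 h0 v hv hlam
  set l : ℝ := Fintype.card ι * v with hl
  have hl0 : 0 < l := by linarith
  set s : ℝ := (√l)⁻¹ with hs
  have hsq : 1 ≤ √l := by rwa [Real.one_le_sqrt]
  have hs0 : 0 < s := by positivity
  have hs1 : s ≤ 1 := inv_le_one_of_one_le₀ hsq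
  have hs2 : s ^ 2 * l = 1 := by
    rw [hs, inv_pow, Real.sq_sqrt hl0.le, inv_mul_cancel₀ hl0.ne']
  have hexp : ∀ t : ℝ, |t| = s →
      ∫⁻ x : ι → E, ENNReal.ofReal (Real.exp (t * ∑ i, ψ (x i))) ∂(Measure.pi fun _ => μ) ≤
        ENNReal.ofReal (Real.exp 1) := by
    intro t ht
    have hmeas : Measurable fun x : ι → E => Real.exp (t * ∑ i, ψ (x i)) := by fun_prop
    have hi : Integrable (fun x : ι → E => Real.exp (t * ∑ i, ψ (x i)))
        (Measure.pi fun _ => μ) := by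
      refine Integrable.of_bound hmeas.aestronglyMeasurable (Real.exp (Fintype.card ι))
        (Eventually.of_forall fun x => ?_)
      rw [Real.norm_eq_abs, Real.abs_exp, Real.exp_le_exp]
      calc _ ≤ |t * ∑ i, ψ (x i)| := le_abs_self _
        _ ≤ 1 * ∑ i : ι, (1 : ℝ) := by
          rw [abs_mul]
          exact mul_le_mul (ht ▸ hs1) ((Finset.abs_sum_le_sum_abs _ _).trans
            (Finset.sum_le_sum fun i _ => h1 _)) (abs_nonneg _) zero_le_one
        _ = _ := by simp
    rw [← ofReal_integral_eq_lintegral_ofReal hi (Eventually.of_forall fun x => (Real.exp_pos _).le)]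
    refine ENNReal.ofReal_le_ofReal ((integral_exp_sum_le hψ h1 h0 hv (ht ▸ hs1)).trans_eq ?_)
    rw [← sq_abs t, ht]
    congr 1
    rw [← hs2, hl]; ring
  calc _ ≤ ∫⁻ x : ι → E, ENNReal.ofReal (C * l ^ (p / 2)) *
        (ENNReal.ofReal (Real.exp (s * ∑ i, ψ (x i))) +
          ENNReal.ofReal (Real.exp (-s * ∑ i, ψ (x i)))) ∂(Measure.pi fun _ => μ) := by
        refine lintegral_mono fun x => ?_
        rw [← ENNReal.ofReal_add (by positivity) (by positivity),
          ← ENNReal.ofReal_mul (by positivity)]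
        refine ENNReal.ofReal_le_ofReal ?_
        set y := ∑ i, ψ (x i)
        have e1 : |y| = √l * (s * |y|) := by rw [hs]; field_simp
        have e2 : √l ^ p = l ^ (p / 2) := by
          rw [Real.sqrt_eq_rpow, ← Real.rpow_mul hl0.le]; congr 1; ring
        calc |y| ^ p = l ^ (p / 2) * (s * |y|) ^ p := by
              conv_lhs => rw [e1]
              rw [Real.mul_rpow (by positivity) (by positivity), e2]
          _ ≤ l ^ (p / 2) * (C * Real.exp (s * |y|)) := by
              gcongr; exact h _ (by positivity)
          _ ≤ l ^ (p / 2) * (C * (Real.exp (s * y) + Real.exp (-s * y))) := by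
              gcongr
              rcases abs_cases y with ⟨h, _⟩ | ⟨h, _⟩
              · rw [h]; linarith [Real.exp_pos (-s * y)]
              · rw [h, mul_neg, ← neg_mul]; linarith [Real.exp_pos (s * y)]
          _ = _ := by ring
    _ ≤ ENNReal.ofReal (C * l ^ (p / 2)) *
          (ENNReal.ofReal (Real.exp 1) + ENNReal.ofReal (Real.exp 1)) := by
        rw [lintegral_const_mul _ (by fun_prop), lintegral_add_left (by fun_prop)]
        gcongr
        · exact hexp s (abs_of_pos hs0)
        · exact hexp (-s) (by rw [abs_neg, abs_of_pos hs0])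
    _ = _ := by
        rw [← ENNReal.ofReal_add (by positivity) (by positivity),
          ← ENNReal.ofReal_mul (by positivity)]
        congr 1; ring

/-- The exponent in the lower tail bounds for binomial variables. -/
noncomputable def tailRate (ε : ℝ) : ℝ := ε - Real.log (1 + ε)

theorem tailRate_pos {ε : ℝ} (hε : 0 < ε) : 0 < tailRate ε := by
  have := Real.log_lt_sub_one_of_pos (by linarith : 0 < 1 + ε) (by linarith)
  unfold tailRate; linarith

/-- Chernoff's bound with parameter b = log (1 + ε), for which each point in B contributes the
factor e^(-b) = 1/(1 + ε). -/
theorem measure_card_indicesIn_le {B : Set E} (hB : MeasurableSet B) {ε : ℝ} (hε : 0 < ε) {K : ℝ}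
    (hK : (1 + ε) * K ≤ Fintype.card ι * μ.real B) :
    (Measure.pi fun _ : ι => μ) {x | ((indicesIn B x).card : ℝ) ≤ K} ≤
      ENNReal.ofReal (Real.exp (-(tailRate ε * (Fintype.card ι * μ.real B / (1 + ε))))) := by
  set b := Real.log (1 + ε) with hb
  have hb0 : 0 < b := Real.log_pos (by linarith)
  have heb : Real.exp (-b) = (1 + ε)⁻¹ := by rw [Real.exp_neg, hb, Real.exp_log (by linarith)]
  set q := μ.real B with hq
  set f : E → ℝ := fun y => Real.exp (-b * B.indicator (fun _ => (1 : ℝ)) y) with hf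
  have hfm : Measurable f := by
    have : Measurable (B.indicator fun _ => (1 : ℝ)) := measurable_const.indicator hB
    fun_prop
  have hfe : f = fun y => 1 + B.indicator (fun _ => (1 + ε)⁻¹ - 1) y := by
    ext y
    by_cases hy : y ∈ B
    · simp [hf, hy, heb]
    · simp [hf, hy]
  have hfi : ∫ y, f y ∂μ = 1 + q * ((1 + ε)⁻¹ - 1) := by
    rw [hfe, integral_add (integrable_const _)
      ((integrable_const _).indicator hB), integral_indicator_const _ hB]
    simp [hq]
  have hexpi : ∫ x : ι → E, ∏ i, f (x i) ∂(Measure.pi fun _ => μ) ≤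
      Real.exp (Fintype.card ι * (q * ((1 + ε)⁻¹ - 1))) := by
    rw [integral_fintype_prod_eq_pow f, Real.exp_nat_mul]
    refine pow_le_pow_left₀ (integral_nonneg fun x => (Real.exp_pos _).le) ?_ _
    rw [hfi, add_comm]
    exact Real.add_one_le_exp _
  have hprod : ∀ x : ι → E, ∏ i, f (x i) = Real.exp (-b * (indicesIn B x).card) := by
    intro x
    rw [card_indicesIn, Finset.mul_sum, Real.exp_sum]
  have hint : Integrable (fun x : ι → E => ∏ i, f (x i)) (Measure.pi fun _ => μ) := by
    refine Integrable.of_bound (Measurable.aestronglyMeasurable (by fun_prop)) 1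
      (Eventually.of_forall fun x => ?_)
    rw [hprod, Real.norm_eq_abs, Real.abs_exp, Real.exp_le_one_iff]
    have : (0 : ℝ) ≤ (indicesIn B x).card := by positivity
    nlinarith
  calc _ = ∫⁻ x : ι → E, {x | ((indicesIn B x).card : ℝ) ≤ K}.indicator 1 x
        ∂(Measure.pi fun _ => μ) := by
        rw [lintegral_indicator_one]
        exact measurableSet_le (measurable_card_indicesIn hB) measurable_const
    _ ≤ ∫⁻ x : ι → E, ENNReal.ofReal (Real.exp (b * K)) * ENNReal.ofReal (∏ i, f (x i))
        ∂(Measure.pi fun _ => μ) := by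
        refine lintegral_mono fun x => ?_
        by_cases hx : ((indicesIn B x).card : ℝ) ≤ K
        · rw [Set.indicator_of_mem (by exact hx), ← ENNReal.ofReal_mul (by positivity), hprod,
            ← Real.exp_add, Pi.one_apply]
          rw [← ENNReal.ofReal_one]
          refine ENNReal.ofReal_le_ofReal (Real.one_le_exp ?_)
          nlinarith
        · rw [Set.indicator_of_notMem (by exact hx)]; exact zero_le
    _ = ENNReal.ofReal (Real.exp (b * K) * ∫ x : ι → E, ∏ i, f (x i) ∂(Measure.pi fun _ => μ)) := by
        rw [lintegral_const_mul _ (by fun_prop), ENNReal.ofReal_mul (by positivity),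
          ofReal_integral_eq_lintegral_ofReal hint
            (Eventually.of_forall fun x => Finset.prod_nonneg fun i _ => (Real.exp_pos _).le)]
    _ ≤ _ := by
        refine ENNReal.ofReal_le_ofReal ?_
        calc _ ≤ Real.exp (b * K) * Real.exp (Fintype.card ι * (q * ((1 + ε)⁻¹ - 1))) := by gcongr
          _ ≤ _ := by
            rw [← Real.exp_add, Real.exp_le_exp, tailRate, ← hb]
            have hK' : K ≤ Fintype.card ι * q / (1 + ε) := by
              rw [le_div_iff₀ (by linarith)]; linarith
            have h1 : b * K ≤ b * (Fintype.card ι * q / (1 + ε)) := by gcongr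
            have h2 : Fintype.card ι * (q * ((1 + ε)⁻¹ - 1)) =
              - (ε * (Fintype.card ι * q / (1 + ε))) := by
              have : 1 + ε ≠ 0 := by linarith
              field_simp; ring
            rw [h2]; nlinarith

/-- With N and N₁ the counts in B and B₁, the integrand is N^(1-p) |N₁ - θN|^p. If N exceeds half
its mean l, the first factor is at most (l/2)^(1-p) and the second has mean of order l^(p/2).
Otherwise the integrand is at most l, on an event of exponentially small probability. -/
theorem exists_lintegral_proportion_le {p : ℝ} (hp : 1 ≤ p) : ∃ C : ℝ, 0 < C ∧
    ∀ {E ι : Type} [MeasurableSpace E] [Fintype ι] {μ : Measure E} [IsProbabilityMeasure μ]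
      {B B₁ : Set E}, MeasurableSet B → MeasurableSet B₁ → B₁ ⊆ B → ∀ {θ : ℝ}, 0 ≤ θ → θ ≤ 1 →
      μ.real B₁ = θ * μ.real B → 1 ≤ Fintype.card ι * μ.real B →
      ∫⁻ x : ι → E, ((indicesIn B x).card : ℝ≥0∞) *
          ENNReal.ofReal |((indicesIn B₁ x).card : ℝ) / (indicesIn B x).card - θ| ^ p
          ∂(Measure.pi fun _ => μ) ≤
        ENNReal.ofReal (C * (Fintype.card ι * μ.real B) ^ (1 - p / 2)) := by
  obtain ⟨C, hC, h⟩ := exists_lintegral_abs_sum_rpow_le (by linarith : 0 ≤ p)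
  obtain ⟨C', hC', h'⟩ := exists_rpow_le_mul_exp_of_nonneg (by linarith : 0 ≤ p / 2)
  set c := tailRate 1 / 2 with hc
  have hc0 : 0 < c := by have := tailRate_pos one_pos; positivity
  refine ⟨C' * c ^ (-(p / 2)) + 2 ^ (p - 1) * C, by positivity, ?_⟩
  intro E ι _ _ μ _ B B₁ hB hB₁ hsub θ hθ0 hθ1 hμ hlam
  set l : ℝ := Fintype.card ι * μ.real B with hl
  have hl0 : 0 < l := by linarith
  -- The sum of ψ over the points is N₁ - θN. It is centred because B₁ has the proportion θ of the
  -- measure of B, and |ψ| ≤ 1_B bounds its second moment by that measure.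
  set ψ : E → ℝ := fun y => B₁.indicator (fun _ => (1 : ℝ)) y - θ * B.indicator (fun _ => (1 : ℝ)) y
    with hψ
  have hψm : Measurable ψ :=
    (measurable_const.indicator hB₁).sub ((measurable_const.indicator hB).const_mul θ)
  have hψB : ∀ y, |ψ y| ≤ B.indicator (fun _ => (1 : ℝ)) y := by
    intro y
    by_cases h1 : y ∈ B₁
    · simp only [hψ, h1, hsub h1, Set.indicator_of_mem]; rw [abs_le]; constructor <;> linarith
    · by_cases h2 : y ∈ B
      · simp only [hψ, h1, h2, Set.indicator_of_mem, Set.indicator_of_notMem, not_false_eq_true]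
        rw [abs_le]; constructor <;> linarith
      · simp [hψ, h1, h2]
  have hψ1 : ∀ y, |ψ y| ≤ 1 := fun y =>
    (hψB y).trans (Set.indicator_le_self' (fun _ _ => zero_le_one) y)
  have hψ0 : ∫ y, ψ y ∂μ = 0 := by
    rw [hψ, integral_sub ((integrable_const _).indicator hB₁)
      (((integrable_const _).indicator hB).const_mul θ), integral_const_mul,
      integral_indicator_const _ hB, integral_indicator_const _ hB₁]
    simp [hμ]
  have hψ2 : ∫ y, ψ y ^ 2 ∂μ ≤ μ.real B := by
    calc _ ≤ ∫ y, B.indicator (fun _ => (1 : ℝ)) y ∂μ := by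
          refine integral_mono_of_nonneg (Eventually.of_forall fun y => sq_nonneg _)
            ((integrable_const _).indicator hB) (Eventually.of_forall fun y => ?_)
          simp only
          rw [← sq_abs, sq]
          exact (mul_le_of_le_one_right (abs_nonneg _) (hψ1 y)).trans (hψB y)
      _ = _ := by rw [integral_indicator_const _ hB]; simp
  have hsum : ∀ x : ι → E, ∑ i, ψ (x i) = (indicesIn B₁ x).card - θ * (indicesIn B x).card := by
    intro x
    rw [card_indicesIn, card_indicesIn, Finset.mul_sum, ← Finset.sum_sub_distrib]
  have hmom := h (ι := ι) hψm hψ1 hψ0 hψ2 hlam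
  have htail := measure_card_indicesIn_le (ι := ι) (μ := μ) hB one_pos (K := l / 2) (by
    rw [← hl]; linarith)
  rw [← hl] at htail hmom
  set A : Set (ι → E) := {x | ((indicesIn B x).card : ℝ) ≤ l / 2} with hA
  have hAm : MeasurableSet A := measurableSet_le (measurable_card_indicesIn hB) measurable_const
  calc _ ≤ ∫⁻ x : ι → E, (A.indicator (fun _ => ENNReal.ofReal l) x +
        ENNReal.ofReal (2 ^ (p - 1) * l ^ (1 - p)) * ENNReal.ofReal (|∑ i, ψ (x i)| ^ p))
        ∂(Measure.pi fun _ => μ) := by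
        refine lintegral_mono fun x => ?_
        simp only
        rw [hsum, ENNReal.ofReal_rpow_of_nonneg (abs_nonneg _) (by linarith),
          ← ENNReal.ofReal_natCast, ← ENNReal.ofReal_mul (by positivity)]
        have hN1 : ((indicesIn B₁ x).card : ℝ) ≤ (indicesIn B x).card := by
          exact_mod_cast Finset.card_le_card fun i hi => mem_indicesIn.2 (hsub (mem_indicesIn.1 hi))
        set N : ℝ := ((indicesIn B x).card : ℝ)
        set N₁ : ℝ := ((indicesIn B₁ x).card : ℝ)
        have hN₁0 : 0 ≤ N₁ := by positivity
        by_cases hx : x ∈ A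
        · rw [Set.indicator_of_mem hx]
          refine le_add_right (ENNReal.ofReal_le_ofReal ?_)
          have hb : |N₁ / N - θ| ≤ 1 := by
            have h1 : 0 ≤ N₁ / N := by positivity
            have h2 : N₁ / N ≤ 1 := div_le_one_of_le₀ hN1 (by positivity)
            rw [abs_le]; constructor <;> linarith
          calc N * |N₁ / N - θ| ^ p ≤ N * 1 := by
                gcongr; exact Real.rpow_le_one (abs_nonneg _) hb (by linarith)
            _ ≤ l := by have : N ≤ l / 2 := hx; linarith
        · rw [Set.indicator_of_notMem hx, zero_add, ← ENNReal.ofReal_mul (by positivity)]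
          refine ENNReal.ofReal_le_ofReal ?_
          have hN : l / 2 < N := not_le.1 hx
          have hN0 : 0 < N := by linarith
          have e1 : |N₁ / N - θ| = |N₁ - θ * N| / N := by
            rw [← abs_of_pos hN0, ← abs_div, abs_of_pos hN0]; congr 1; field_simp
          have e2 : N * (|N₁ - θ * N| / N) ^ p = N ^ (1 - p) * |N₁ - θ * N| ^ p := by
            rw [Real.div_rpow (abs_nonneg _) hN0.le, Real.rpow_sub hN0, Real.rpow_one]; ring
          rw [e1, e2]
          gcongr
          have e3 : (2 : ℝ) ^ (p - 1) * l ^ (1 - p) = (l / 2) ^ (1 - p) := by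
            rw [Real.div_rpow hl0.le zero_le_two, ← neg_sub p 1, Real.rpow_neg zero_le_two,
              div_inv_eq_mul, mul_comm]
          rw [e3]
          exact Real.rpow_le_rpow_of_nonpos (by positivity) hN.le (by linarith)
    _ = ENNReal.ofReal l * (Measure.pi fun _ => μ) A + ENNReal.ofReal (2 ^ (p - 1) * l ^ (1 - p)) *
          ∫⁻ x : ι → E, ENNReal.ofReal (|∑ i, ψ (x i)| ^ p) ∂(Measure.pi fun _ => μ) := by
        rw [lintegral_add_left (measurable_const.indicator hAm), lintegral_indicator_const hAm,
          lintegral_const_mul _ (by fun_prop)]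
    _ ≤ ENNReal.ofReal l * ENNReal.ofReal (Real.exp (-(tailRate 1 * (l / (1 + 1))))) +
          ENNReal.ofReal (2 ^ (p - 1) * l ^ (1 - p)) * ENNReal.ofReal (C * l ^ (p / 2)) := by
        gcongr
    _ ≤ _ := by
        rw [← ENNReal.ofReal_mul hl0.le, ← ENNReal.ofReal_mul (by positivity),
          ← ENNReal.ofReal_add (by positivity) (by positivity)]
        refine ENNReal.ofReal_le_ofReal ?_
        have e1 : tailRate 1 * (l / (1 + 1)) = c * l := by rw [hc]; ring
        have e2 : l ^ (1 - p / 2) = l * l ^ (-(p / 2)) := by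
          rw [sub_eq_add_neg, Real.rpow_add hl0, Real.rpow_one]
        have e3 : l ^ (1 - p) * l ^ (p / 2) = l ^ (1 - p / 2) := by
          rw [← Real.rpow_add hl0]; congr 1; ring
        have e4 : Real.exp (-(c * l)) ≤ C' * c ^ (-(p / 2)) * l ^ (-(p / 2)) := by
          have := h' (c * l) (by positivity)
          rw [Real.exp_neg, mul_assoc, ← Real.mul_rpow hc0.le hl0.le, Real.rpow_neg (by positivity),
            inv_le_comm₀ (Real.exp_pos _) (by positivity), mul_inv, inv_inv,
            inv_mul_le_iff₀ hC']
          exact this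
        calc l * Real.exp (-(tailRate 1 * (l / (1 + 1)))) +
              2 ^ (p - 1) * l ^ (1 - p) * (C * l ^ (p / 2)) =
              l * Real.exp (-(c * l)) + 2 ^ (p - 1) * C * (l ^ (1 - p) * l ^ (p / 2)) := by
              rw [e1]; ring
          _ ≤ l * (C' * c ^ (-(p / 2)) * l ^ (-(p / 2))) + 2 ^ (p - 1) * C * l ^ (1 - p / 2) := by
              rw [e3]; gcongr
          _ = _ := by rw [e2]; ring

end Counting

/-! ### Costs of finite configurations, their measurability, and one bisection step in mean. -/

section ConfigCost

variable {d : ℕ} {ι : Type*} {p : ℝ}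

/-- The cost of transporting the points `x i`, `i ∈ S`, to `#S` times the measure `ρ`. -/
noncomputable def configCost (p : ℝ) (x : ι → EuclideanSpace ℝ (Fin d)) (S : Finset ι)
    (ρ : Measure (EuclideanSpace ℝ (Fin d))) : ℝ≥0∞ :=
  transportCost p (∑ i ∈ S, Measure.dirac (x i)) ((S.card : ℝ≥0∞) • ρ)

theorem natCast_smul_isFiniteMeasure {E : Type*} [MeasurableSpace E] (n : ℕ) (ρ : Measure E)
    [IsFiniteMeasure ρ] : IsFiniteMeasure ((n : ℝ≥0∞) • ρ) := by
  rw [Nat.cast_smul_eq_nsmul]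
  infer_instance

/-- By the triangle inequality the p-th root of the cost changes by at most |S|^(1/p) times the
largest displacement of a point. Continuity is the source of all measurability of costs. -/
theorem continuous_configCost [Fintype ι] (hp : 1 ≤ p) (S : Finset ι)
    (ρ : Measure (EuclideanSpace ℝ (Fin d))) :
    Continuous fun x : ι → EuclideanSpace ℝ (Fin d) => configCost p x S ρ := by
  have hp0 : 0 < p := by linarith
  have h : Continuous fun x : ι → EuclideanSpace ℝ (Fin d) => configCost p x S ρ ^ (1 / p) := by
    refine continuous_of_le_add_edist ((S.card : ℝ≥0∞) ^ (1 / p))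
      (ENNReal.rpow_ne_top_of_nonneg (by positivity) (ENNReal.natCast_ne_top _)) fun x y => ?_
    rw [add_comm]
    refine (transportCost_triangle (ν := ∑ i ∈ S, Measure.dirac (y i)) hp).trans ?_
    gcongr
    · calc _ ≤ ((S.card : ℝ≥0∞) * edist x y ^ p) ^ (1 / p) := by
            refine ENNReal.rpow_le_rpow ?_ (by positivity)
            refine (transportCost_sum_le _ _ _).trans ?_
            rw [← nsmul_eq_mul]
            refine Finset.sum_le_card_nsmul _ _ _ fun i _ => (transportCost_dirac_le _ _).trans ?_
            exact ENNReal.rpow_le_rpow (edist_le_pi_edist x y i) hp0.le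
        _ = _ := by
          rw [ENNReal.mul_rpow_of_nonneg _ _ (by positivity), ← ENNReal.rpow_mul,
            mul_one_div_cancel hp0.ne', ENNReal.rpow_one]
    · exact le_rfl
  have e : (fun x : ι → EuclideanSpace ℝ (Fin d) => configCost p x S ρ) =
      fun x => (configCost p x S ρ ^ (1 / p)) ^ p := by
    ext x
    rw [← ENNReal.rpow_mul, one_div_mul_cancel hp0.ne', ENNReal.rpow_one]
  rw [e]
  exact (ENNReal.continuous_rpow_const (y := p)).comp h

theorem measurable_configCost [Fintype ι] (hp : 1 ≤ p) (S : Finset ι)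
    (ρ : Measure (EuclideanSpace ℝ (Fin d))) :
    Measurable fun x : ι → EuclideanSpace ℝ (Fin d) => configCost p x S ρ :=
  (continuous_configCost hp S ρ).measurable

/-- The cost of transporting the points of the configuration `x` in a box to the uniform
density in this box. -/
noncomputable def boxCost [Fintype ι] (p : ℝ) (a w : Fin d → ℝ)
    (x : ι → EuclideanSpace ℝ (Fin d)) : ℝ≥0∞ :=
  configCost p x (indicesIn (box a w) x) (unifBox a w)

/-- Decomposition over the finitely many possible sets of points in B. On each piece the set of
indices is frozen, so measurability and integrals can be treated piece by piece. -/
theorem eq_sum_indicator_indicesIn {E M : Type*} [Fintype ι] [AddCommMonoid M] (B : Set E)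
    (G : Finset ι → (ι → E) → M) (x : ι → E) :
    G (indicesIn B x) x = ∑ S, {x : ι → E | indicesIn B x = S}.indicator (G S) x := by
  classical
  simp [Set.indicator_apply]

theorem measurable_boxCost [Fintype ι] (hp : 1 ≤ p) (a w : Fin d → ℝ) :
    Measurable fun x : ι → EuclideanSpace ℝ (Fin d) => boxCost p a w x := by
  unfold boxCost
  simp_rw [eq_sum_indicator_indicesIn (box a w) (fun S x => configCost p x S (unifBox a w))]
  exact Finset.measurable_sum _ fun S _ => (measurable_configCost hp S _).indicator
    (measurableSet_indicesIn_eq (measurableSet_box a w) S)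

section Split

variable {a w : Fin d → ℝ} {i : Fin d} {θ : ℝ}

theorem box_left_subset (hw : 0 ≤ w i) (h1 : θ ≤ 1) :
    box a (Function.update w i (θ * w i)) ⊆ box a w := by
  intro x hx j
  have := hx j
  rcases eq_or_ne j i with rfl | hj
  · simp only [Function.update_self, Set.mem_Ico] at this ⊢
    exact ⟨this.1, by nlinarith⟩
  · simpa [hj] using this

theorem box_eq_union (hw : 0 ≤ w i) (h0 : 0 ≤ θ) (h1 : θ ≤ 1) :
    box a w = box a (Function.update w i (θ * w i)) ∪
      box (Function.update a i (a i + θ * w i)) (Function.update w i ((1 - θ) * w i)) := by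
  refine Set.Subset.antisymm (fun x hx => ?_)
    (Set.union_subset (box_left_subset hw h1) fun x hx j => ?_)
  · rcases lt_or_ge (x i) (a i + θ * w i) with h | h
    · refine Or.inl fun j => ?_
      have := hx j
      rcases eq_or_ne j i with rfl | hj
      · simp only [Function.update_self, Set.mem_Ico] at this ⊢
        exact ⟨this.1, h⟩
      · simpa [hj] using this
    · refine Or.inr fun j => ?_
      have := hx j
      rcases eq_or_ne j i with rfl | hj
      · simp only [Function.update_self, Set.mem_Ico] at this ⊢
        exact ⟨h, by linarith [this.2]⟩
      · simpa [hj] using this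
  · have := hx j
    rcases eq_or_ne j i with rfl | hj
    · simp only [Function.update_self, Set.mem_Ico] at this ⊢
      exact ⟨by nlinarith, by linarith⟩
    · simpa [hj] using this

theorem box_disjoint : Disjoint (box a (Function.update w i (θ * w i)))
    (box (Function.update a i (a i + θ * w i)) (Function.update w i ((1 - θ) * w i))) := by
  rw [Set.disjoint_left]
  intro x h1 h2
  have h1 := h1 i
  have h2 := h2 i
  simp only [Function.update_self, Set.mem_Ico] at h1 h2
  linarith

/-- Two stages joined by the triangle inequality: spread the points uniformly inside each half, with
the mass that this half actually holds, then equalise the densities of the halves. -/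
theorem boxCost_split_le [Fintype ι] (hp : 1 ≤ p) (hw : 0 ≤ w i) (h0 : 0 ≤ θ) (h1 : θ ≤ 1)
    (x : ι → EuclideanSpace ℝ (Fin d)) :
    boxCost p a w x ^ (1 / p) ≤
      (boxCost p a (Function.update w i (θ * w i)) x +
        boxCost p (Function.update a i (a i + θ * w i)) (Function.update w i ((1 - θ) * w i)) x) ^
          (1 / p) +
      (ENNReal.ofReal (w i) ^ p * (((indicesIn (box a w) x).card : ℝ≥0∞) *
        ENNReal.ofReal |((indicesIn (box a (Function.update w i (θ * w i))) x).card : ℝ) /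
          (indicesIn (box a w) x).card - θ| ^ p)) ^ (1 / p) := by
  classical
  set w₁ := Function.update w i (θ * w i)
  set a₂ := Function.update a i (a i + θ * w i)
  set w₂ := Function.update w i ((1 - θ) * w i)
  have hS : indicesIn (box a w) x = indicesIn (box a w₁) x ∪ indicesIn (box a₂ w₂) x := by
    ext j
    rw [Finset.mem_union, mem_indicesIn, mem_indicesIn, mem_indicesIn, box_eq_union hw h0 h1]
    rfl
  have hd : Disjoint (indicesIn (box a w₁) x) (indicesIn (box a₂ w₂) x) := by
    rw [Finset.disjoint_left]
    intro j hj hj'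
    exact Set.disjoint_left.1 box_disjoint (mem_indicesIn.1 hj) (mem_indicesIn.1 hj')
  have hc : (indicesIn (box a w) x).card =
      (indicesIn (box a w₁) x).card + (indicesIn (box a₂ w₂) x).card := by
    rw [hS, Finset.card_union_of_disjoint hd]
  have := natCast_smul_isFiniteMeasure (indicesIn (box a w₁) x).card (unifBox a w₁)
  have := natCast_smul_isFiniteMeasure (indicesIn (box a₂ w₂) x).card (unifBox a₂ w₂)
  refine (transportCost_triangle (ν := ((indicesIn (box a w₁) x).card : ℝ≥0∞) • unifBox a w₁ +
    ((indicesIn (box a₂ w₂) x).card : ℝ≥0∞) • unifBox a₂ w₂) hp).trans ?_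
  gcongr
  · rw [hS, Finset.sum_union hd]
    exact transportCost_add_le _ _ _ _
  · rw [hc]
    refine (transportCost_merge_le (by linarith) a w i hw _ _).trans_eq ?_
    rw [ENNReal.ofReal_mul hw, ENNReal.mul_rpow_of_nonneg _ _ (by linarith)]
    ring

end Split

theorem measureReal_box {a w : Fin d → ℝ} (hw : ∀ i, 0 < w i) (ha : ∀ i, 0 ≤ a i)
    (haw : ∀ i, a i + w i ≤ 1) : (unitCubeMeasure d).real (box a w) = ∏ i, w i := by
  have h := congrArg (fun m => m Set.univ) (unitCubeMeasure_restrict_box hw ha haw)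
  simp only [Measure.restrict_apply_univ, Measure.smul_apply, measure_univ, smul_eq_mul,
    mul_one] at h
  rw [measureReal_def, h, ENNReal.toReal_ofReal (Finset.prod_nonneg fun i _ => (hw i).le)]

/-- The mean cost in a box for `n` independent uniform points in the unit cube. -/
noncomputable def meanBoxCost (p : ℝ) (n : ℕ) (a w : Fin d → ℝ) : ℝ≥0∞ :=
  ∫⁻ x : Fin n → EuclideanSpace ℝ (Fin d), boxCost p a w x ∂(Measure.pi fun _ => unitCubeMeasure d)

/-- The pointwise inequality integrated by Minkowski in L^p of the configuration space. The two
halves stay under a common root, so their mean costs add without any loss. -/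
theorem exists_meanBoxCost_split_le (hp : 1 ≤ p) : ∃ C : ℝ, 0 < C ∧
    ∀ {d : ℕ} {a w : Fin d → ℝ} (_ : ∀ i, 0 < w i) (_ : ∀ i, 0 ≤ a i) (_ : ∀ i, a i + w i ≤ 1)
      (i : Fin d) {θ : ℝ} (_ : 0 < θ) (_ : θ < 1) {n : ℕ} (_ : 1 ≤ n * ∏ i, w i),
      meanBoxCost p n a w ^ (1 / p) ≤
        (meanBoxCost p n a (Function.update w i (θ * w i)) +
          meanBoxCost p n (Function.update a i (a i + θ * w i))
            (Function.update w i ((1 - θ) * w i))) ^ (1 / p) +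
        ENNReal.ofReal (w i * (C * (n * ∏ i, w i) ^ (1 - p / 2)) ^ (1 / p)) := by
  have hp0 : 0 < p := by linarith
  obtain ⟨C, hC, h⟩ := exists_lintegral_proportion_le hp
  refine ⟨C, hC, ?_⟩
  intro d a w hw ha haw i θ h0 h1 n hn
  have hw₁ : ∀ j, 0 < Function.update w i (θ * w i) j := by
    intro j
    rcases eq_or_ne j i with rfl | hj
    · simpa using mul_pos h0 (hw j)
    · simpa [hj] using hw j
  have hμ : (unitCubeMeasure d).real (box a (Function.update w i (θ * w i))) =
      θ * (unitCubeMeasure d).real (box a w) := by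
    rw [measureReal_box hw ha haw, measureReal_box hw₁ ha]
    · rw [Finset.prod_update_of_mem (Finset.mem_univ i), mul_assoc,
        ← Finset.mul_prod_erase _ _ (Finset.mem_univ i), Finset.sdiff_singleton_eq_erase]
    · intro j
      rcases eq_or_ne j i with rfl | hj
      · simp only [Function.update_self]
        nlinarith [hw j, haw j]
      · simpa [hj] using haw j
  have herr := h (ι := Fin n) (measurableSet_box a w) (measurableSet_box a _)
    (box_left_subset (hw i).le h1.le) h0.le h1.le hμ
    (by rwa [Fintype.card_fin, measureReal_box hw ha haw])
  rw [Fintype.card_fin, measureReal_box hw ha haw] at herr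
  set P : Measure (Fin n → EuclideanSpace ℝ (Fin d)) := Measure.pi fun _ => unitCubeMeasure d
  set w₁ := Function.update w i (θ * w i)
  set a₂ := Function.update a i (a i + θ * w i)
  set w₂ := Function.update w i ((1 - θ) * w i)
  set err : (Fin n → EuclideanSpace ℝ (Fin d)) → ℝ≥0∞ := fun x =>
    ((indicesIn (box a w) x).card : ℝ≥0∞) *
        ENNReal.ofReal |((indicesIn (box a w₁) x).card : ℝ) /
          (indicesIn (box a w) x).card - θ| ^ p with herrdef
  have hmerr : Measurable err := by
    have m1 := measurable_card_indicesIn (ι := Fin n) (measurableSet_box a w)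
    have m2 := measurable_card_indicesIn (ι := Fin n) (measurableSet_box a w₁)
    have : err = fun x => ENNReal.ofReal ((indicesIn (box a w) x).card : ℝ) *
        ENNReal.ofReal |((indicesIn (box a w₁) x).card : ℝ) /
          (indicesIn (box a w) x).card - θ| ^ p := by
      ext x; rw [ENNReal.ofReal_natCast]
    rw [this]
    refine m1.ennreal_ofReal.mul (Measurable.pow_const ?_ p)
    have m3 := (m2.div m1).sub_const θ
    exact (continuous_abs.measurable.comp m3).ennreal_ofReal
  have m1 := measurable_boxCost (ι := Fin n) hp a w₁
  have m2 := measurable_boxCost (ι := Fin n) hp a₂ w₂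
  set f : (Fin n → EuclideanSpace ℝ (Fin d)) → ℝ≥0∞ :=
    fun x => (boxCost p a w₁ x + boxCost p a₂ w₂ x) ^ (1 / p)
  set g : (Fin n → EuclideanSpace ℝ (Fin d)) → ℝ≥0∞ :=
    fun x => (ENNReal.ofReal (w i) ^ p * err x) ^ (1 / p)
  have hcancel : ∀ y : ℝ≥0∞, (y ^ (1 / p)) ^ p = y := fun y => by
    rw [← ENNReal.rpow_mul, one_div_mul_cancel hp0.ne', ENNReal.rpow_one]
  have hcancel' : ∀ y : ℝ≥0∞, (y ^ p) ^ (1 / p) = y := fun y => by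
    rw [← ENNReal.rpow_mul, mul_one_div_cancel hp0.ne', ENNReal.rpow_one]
  calc meanBoxCost p n a w ^ (1 / p) ≤ (∫⁻ x, (f + g) x ^ p ∂P) ^ (1 / p) := by
        refine ENNReal.rpow_le_rpow (lintegral_mono fun x => ?_) (by positivity)
        rw [← hcancel (boxCost p a w x)]
        exact ENNReal.rpow_le_rpow (boxCost_split_le hp (hw i).le h0.le h1.le x) hp0.le
    _ ≤ (∫⁻ x, f x ^ p ∂P) ^ (1 / p) + (∫⁻ x, g x ^ p ∂P) ^ (1 / p) :=
        ENNReal.lintegral_Lp_add_le ((m1.add m2).pow_const _).aemeasurable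
          ((hmerr.const_mul _).pow_const _).aemeasurable hp
    _ ≤ _ := by
        gcongr
        · refine le_of_eq ?_
          simp only [f, hcancel]
          rw [lintegral_add_left m1]
          rfl
        · simp only [g, hcancel]
          rw [lintegral_const_mul _ hmerr, ENNReal.mul_rpow_of_nonneg _ _ (by positivity), hcancel',
            ENNReal.ofReal_mul (hw i).le]
          gcongr
          rw [← ENNReal.ofReal_rpow_of_nonneg (by positivity) (by positivity)]
          gcongr

end ConfigCost

/-! ### Summation of the bisection errors over all scales. -/

section Recursion

variable {d : ℕ} {p : ℝ}

/-- The constant in the sum over scales. -/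
noncomputable def scaleConst (d : ℕ) : ℝ := ((3 / 2 : ℝ) ^ (1 / 2 - 1 / d : ℝ) - 1)⁻¹

/-- The point where dimension at least three is essential: the errors s^(-(1/2 - 1/d)) decay with
the scale s. -/
theorem scaleExponent_pos (hd : 3 ≤ d) : (0 : ℝ) < 1 / 2 - 1 / d := by
  have : (3 : ℝ) ≤ d := by exact_mod_cast hd
  rw [sub_pos]
  exact one_div_lt_one_div_of_lt (by norm_num) (by linarith)

theorem scaleConst_pos (hd : 3 ≤ d) : 0 < scaleConst d := by
  have := Real.one_lt_rpow (by norm_num : (1 : ℝ) < 3 / 2) (scaleExponent_pos hd)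
  exact inv_pos.2 (by linarith)

/-- A telescoping form of the geometric series: the potential c(1 - s^(-β)), with β = 1/2 - 1/d,
absorbs the error s^(-β) when the number of cells drops by the factor 2/3. The choice c = ((3/2)^β -
1)⁻¹ makes this exact at t = 2s/3, and the potential never exceeds c. -/
theorem scale_step (hd : 3 ≤ d) {s t : ℝ} (ht : 0 < t) (hts : t ≤ 2 / 3 * s) :
    scaleConst d * (1 - t ^ (-(1 / 2 - 1 / d) : ℝ)) + s ^ (-(1 / 2 - 1 / d) : ℝ) ≤
      scaleConst d * (1 - s ^ (-(1 / 2 - 1 / d) : ℝ)) := by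
  set β : ℝ := 1 / 2 - 1 / d with hβ
  have hβ0 : 0 < β := scaleExponent_pos hd
  have hs : 0 < s := by linarith
  have h1 := Real.one_lt_rpow (by norm_num : (1 : ℝ) < 3 / 2) hβ0
  have h2 : (3 / 2 : ℝ) ^ β * s ^ (-β) ≤ t ^ (-β) := by
    have : (3 / 2 : ℝ) ^ β = (2 / 3 : ℝ) ^ (-β) := by
      rw [Real.rpow_neg (by norm_num), ← Real.inv_rpow (by norm_num)]; norm_num
    rw [this, ← Real.mul_rpow (by norm_num) hs.le]
    exact Real.rpow_le_rpow_of_nonpos ht hts (by linarith)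
  have h3 : scaleConst d * ((3 / 2 : ℝ) ^ β - 1) = 1 := inv_mul_cancel₀ (by linarith)
  have h4 := scaleConst_pos hd
  have h5 := mul_le_mul_of_nonneg_left h2 h4.le
  have h6 : s ^ (-β) = scaleConst d * ((3 / 2 : ℝ) ^ β - 1) * s ^ (-β) := by rw [h3, one_mul]
  linarith

/-- The point of the grid of mesh `1 / m` with integer coordinates `A`. -/
noncomputable def gridPoint (m : ℕ) (A : Fin d → ℕ) : Fin d → ℝ := fun i => (A i : ℝ) / m

theorem gridPoint_update (m : ℕ) (A : Fin d → ℕ) (i : Fin d) (k : ℕ) :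
    gridPoint m (Function.update A i k) = Function.update (gridPoint m A) i ((k : ℝ) / m) := by
  ext j
  rcases eq_or_ne j i with rfl | hj
  · simp [gridPoint]
  · simp [gridPoint, hj]

theorem le_three_mul_rpow {W : Fin d → ℕ} (hd : 0 < d) (hW : ∀ i j, W i ≤ 3 * W j) (i : Fin d) :
    (W i : ℝ) ≤ 3 * ((∏ j, W j : ℕ) : ℝ) ^ (1 / d : ℝ) := by
  have h : ((W i : ℝ) / 3) ^ d ≤ ((∏ j, W j : ℕ) : ℝ) := by
    push_cast
    calc ((W i : ℝ) / 3) ^ d = ∏ _j : Fin d, (W i : ℝ) / 3 := by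
          rw [Finset.prod_const, Finset.card_univ, Fintype.card_fin]
      _ ≤ _ := Finset.prod_le_prod (fun j _ => by positivity) fun j _ => by
          rw [div_le_iff₀ (by norm_num)]
          exact_mod_cast (hW i j).trans_eq (mul_comm _ _)
  have h2 := Real.rpow_le_rpow (by positivity) h (by positivity : (0 : ℝ) ≤ 1 / d)
  rw [← Real.rpow_natCast, ← Real.rpow_mul (by positivity),
    mul_one_div_cancel (by positivity), Real.rpow_one] at h2
  linarith

/-- Strong induction on the number s of cells, bisecting the longest side. The invariant that sides
differ at most by a factor 3 keeps every side of order s^(1/d) cells, and the error accumulated up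
to s is the potential of `scale_step`. -/
theorem exists_meanBoxCost_grid_le (hd : 3 ≤ d) (hp : 1 ≤ p) : ∃ C : ℝ, 0 < C ∧
    ∀ {n m : ℕ} (_ : 0 < m) (_ : m ^ d ≤ n) {η : ℝ≥0∞}
      (_ : ∀ A : Fin d → ℕ, (∀ i, A i + 1 ≤ m) →
        meanBoxCost p n (gridPoint m A) (gridPoint m fun _ => 1) ≤ η)
      (s : ℕ) (A W : Fin d → ℕ), (∀ i, 1 ≤ W i) → (∀ i, A i + W i ≤ m) → (∀ i j, W i ≤ 3 * W j) →
      ∏ i, W i = s →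
      meanBoxCost p n (gridPoint m A) (gridPoint m W) ≤ s * (η ^ (1 / p) +
        ENNReal.ofReal (C * (m : ℝ)⁻¹ * ((n : ℝ) / m ^ d) ^ (1 / p - 1 / 2 : ℝ) *
          (scaleConst d * (1 - (s : ℝ) ^ (-(1 / 2 - 1 / d) : ℝ))))) ^ p := by
  have hp0 : 0 < p := by linarith
  obtain ⟨C, hC, hsplit⟩ := exists_meanBoxCost_split_le hp
  refine ⟨3 * C ^ (1 / p), by positivity, ?_⟩
  intro n m hm hmn η hη s
  have hmR : (0 : ℝ) < m := by exact_mod_cast hm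
  have hd0 : (d : ℝ) ≠ 0 := by positivity
  set l : ℝ := (n : ℝ) / m ^ d with hl
  have hl1 : 1 ≤ l := by
    rw [hl, one_le_div (by positivity)]; exact_mod_cast hmn
  set D₀ : ℝ := 3 * C ^ (1 / p) * (m : ℝ)⁻¹ * l ^ (1 / p - 1 / 2 : ℝ) with hD₀
  have hD₀0 : 0 < D₀ := by positivity
  set e : ℝ → ℝ := fun t => D₀ * (scaleConst d * (1 - t ^ (-(1 / 2 - 1 / d) : ℝ))) with he
  have hemono : ∀ {t t' : ℝ}, 0 < t → t ≤ t' → e t ≤ e t' := by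
    intro t t' ht htt
    have := Real.rpow_le_rpow_of_nonpos ht htt (by linarith [scaleExponent_pos hd] :
      (-(1 / 2 - 1 / d) : ℝ) ≤ 0)
    have h1 := scaleConst_pos hd
    simp only [he]
    gcongr
  have he0 : ∀ {t : ℝ}, 1 ≤ t → 0 ≤ e t := fun {t} ht => by
    have := hemono one_pos ht
    rwa [show e 1 = 0 by simp [he]] at this
  induction s using Nat.strong_induction_on with
  | _ s ih =>
  intro A W hW1 hAW hbal hs
  have hs1 : 1 ≤ s := hs ▸ Nat.succ_le_of_lt (Finset.prod_pos fun i _ => hW1 i)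
  have hsR : (1 : ℝ) ≤ s := by exact_mod_cast hs1
  have : Nonempty (Fin d) := ⟨⟨0, by omega⟩⟩
  obtain ⟨i, hi⟩ := Finite.exists_max W
  rcases Nat.lt_or_ge (W i) 2 with hWi | hWi
  · have hW : W = fun _ => 1 := by
      ext j; have := hi j; have := hW1 j; omega
    subst hW
    refine (hη A hAW).trans ?_
    have : s = 1 := by rw [← hs]; simp
    subst this
    simp only [Nat.cast_one, one_mul]
    calc η = (η ^ (1 / p)) ^ p := by
          rw [← ENNReal.rpow_mul, one_div_mul_cancel hp0.ne', ENNReal.rpow_one]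
      _ ≤ _ := ENNReal.rpow_le_rpow le_self_add hp0.le
  -- split the longest side
  set W₁ := W i / 2 with hW₁
  set W₂ := W i - W₁ with hW₂
  have hWiR : (0 : ℝ) < W i := by exact_mod_cast hW1 i
  set θ : ℝ := (W₁ : ℝ) / W i with hθ
  have hW₁0 : 0 < W₁ := by omega
  have hθ0 : 0 < θ := by positivity
  have hθ1 : θ < 1 := by
    rw [hθ, div_lt_one hWiR]; exact_mod_cast (by omega : W₁ < W i)
  set R := ∏ j ∈ Finset.univ.erase i, W j with hR
  have hR0 : 0 < R := Finset.prod_pos fun j _ => hW1 j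
  have hsR' : s = W i * R := by rw [← hs, hR, Finset.mul_prod_erase _ _ (Finset.mem_univ i)]
  have hup : ∀ k, ∏ j, Function.update W i k j = k * R := by
    intro k
    rw [Finset.prod_update_of_mem (Finset.mem_univ i), Finset.sdiff_singleton_eq_erase]
  have hprod : ∏ j, gridPoint m W j = s / (m : ℝ) ^ d := by
    simp only [gridPoint]
    rw [Finset.prod_div_distrib, ← hs]; simp
  have hlam : (n : ℝ) * ∏ j, gridPoint m W j = s * l := by rw [hprod, hl]; ring
  have H := hsplit (a := gridPoint m A) (w := gridPoint m W)
    (fun j => div_pos (by exact_mod_cast hW1 j) hmR) (fun j => by unfold gridPoint; positivity)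
    (fun j => by
      unfold gridPoint
      rw [← add_div, div_le_one hmR]; exact_mod_cast hAW j) i hθ0 hθ1 (n := n)
    (by rw [hlam]; nlinarith)
  rw [hlam] at H
  have u1 : Function.update (gridPoint m W) i (θ * gridPoint m W i) =
      gridPoint m (Function.update W i W₁) := by
    rw [gridPoint_update]; congr 1
    rw [hθ, gridPoint]; field_simp
  have u2 : Function.update (gridPoint m W) i ((1 - θ) * gridPoint m W i) =
      gridPoint m (Function.update W i W₂) := by
    rw [gridPoint_update]; congr 1
    rw [hθ, gridPoint, hW₂, Nat.cast_sub (by omega)]; field_simp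
  have u3 : Function.update (gridPoint m A) i (gridPoint m A i + θ * gridPoint m W i) =
      gridPoint m (Function.update A i (A i + W₁)) := by
    rw [gridPoint_update]; congr 1
    rw [hθ, gridPoint, gridPoint]; push_cast; field_simp
  rw [u1, u2, u3] at H
  -- Halving the maximal side keeps the ratio bound: for a side W ≥ 2 one has 3⌊W/2⌋ ≥ W, so the
  -- shorter piece still dominates a third of every other side.
  have hbal' : ∀ k, W₁ ≤ k → k ≤ W i → ∀ j j', Function.update W i k j ≤
      3 * Function.update W i k j' := by
    intro k hk hk' j j'
    have b1 := hbal j j'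
    have b2 := hi j
    have b3 := hbal i j'
    by_cases hj : j = i <;> by_cases hj' : j' = i <;>
      simp only [hj, hj', Function.update_self, Function.update_of_ne, ne_eq, not_false_eq_true] <;>
      omega
  -- The longer piece is ⌈W/2⌉ ≤ 2W/3 for W ≥ 2, with equality at W = 3; this is where the ratio 2/3
  -- comes from.
  have ineq : ∀ k, W₁ ≤ k → k ≤ W₂ → ((k * R : ℕ) : ℝ) ≤ 2 / 3 * s := by
    intro k hk hk'
    have : 3 * k ≤ 2 * W i := by omega
    have h3 : ((3 * k * R : ℕ) : ℝ) ≤ ((2 * W i * R : ℕ) : ℝ) := by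
      exact_mod_cast Nat.mul_le_mul_right R this
    rw [hsR']; push_cast at h3 ⊢; linarith
  have child : ∀ (B : Fin d → ℕ) (k : ℕ), W₁ ≤ k → k ≤ W₂ → (∀ j, B j + Function.update W i k j ≤ m) →
      meanBoxCost p n (gridPoint m B) (gridPoint m (Function.update W i k)) ≤
        ((k * R : ℕ) : ℝ≥0∞) * (η ^ (1 / p) + ENNReal.ofReal (e (2 / 3 * s))) ^ p := by
    intro B k hk hk' hB
    have hk0 : 0 < k * R := Nat.mul_pos (by omega) hR0
    refine (ih (k * R) ?_ B _ ?_ hB (hbal' k hk (by omega)) (hup k)).trans ?_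
    · rw [hsR']; exact Nat.mul_lt_mul_of_pos_right (by omega) hR0
    · intro j
      rcases eq_or_ne j i with rfl | hj
      · simp; omega
      · simpa [hj] using hW1 j
    · gcongr
      exact hemono (by exact_mod_cast hk0) (ineq k hk hk')
  have c1 := child A W₁ le_rfl (by omega) (fun j => by
    have := hAW j
    rcases eq_or_ne j i with rfl | hj
    · simp; omega
    · simpa [hj] using this)
  have c2 := child (Function.update A i (A i + W₁)) W₂ (by omega) le_rfl (fun j => by
    have := hAW j
    rcases eq_or_ne j i with rfl | hj
    · simp; omega
    · simpa [hj] using this)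
  have hcancel : ∀ y : ℝ≥0∞, (y ^ (1 / p)) ^ p = y := fun y => by
    rw [← ENNReal.rpow_mul, one_div_mul_cancel hp0.ne', ENNReal.rpow_one]
  have hcancel' : ∀ y : ℝ≥0∞, (y ^ p) ^ (1 / p) = y := fun y => by
    rw [← ENNReal.rpow_mul, mul_one_div_cancel hp0.ne', ENNReal.rpow_one]
  have hsum : meanBoxCost p n (gridPoint m A) (gridPoint m (Function.update W i W₁)) +
      meanBoxCost p n (gridPoint m (Function.update A i (A i + W₁)))
        (gridPoint m (Function.update W i W₂)) ≤
      (s : ℝ≥0∞) * (η ^ (1 / p) + ENNReal.ofReal (e (2 / 3 * s))) ^ p := by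
    refine (add_le_add c1 c2).trans_eq ?_
    rw [← add_mul, ← Nat.cast_add, ← add_mul, hsR']
    congr 3
    omega
  have s1 : (s : ℝ≥0∞) ^ (1 / p) = ENNReal.ofReal ((s : ℝ) ^ (1 / p)) := by
    rw [← ENNReal.ofReal_natCast, ENNReal.ofReal_rpow_of_nonneg (by positivity) (by positivity)]
  -- The error of this bisection, in the normalised form s^(1/p) D₀ s^(1/d - 1/2): the side
  -- contributes s^(1/d)/m and the fluctuation (sl)^(1/p - 1/2).
  have herr : gridPoint m W i * (C * (s * l) ^ (1 - p / 2)) ^ (1 / p) ≤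
      (s : ℝ) ^ (1 / p) * (D₀ * (s : ℝ) ^ (-(1 / 2 - 1 / d) : ℝ)) := by
    have hl0 : 0 < l := by linarith
    have hs0 : (0 : ℝ) < s := by linarith
    have h1 := le_three_mul_rpow (by omega) hbal i
    rw [hs] at h1
    rw [Real.mul_rpow hC.le (by positivity), ← Real.rpow_mul (by positivity),
      Real.mul_rpow (by positivity) (by positivity)]
    have e1 : (1 - p / 2) * (1 / p) = 1 / p - 1 / 2 := by field_simp
    rw [e1]
    have e2 : (s : ℝ) ^ (1 / p) * (s : ℝ) ^ (-(1 / 2 - 1 / d) : ℝ) =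
        (s : ℝ) ^ (1 / d : ℝ) * (s : ℝ) ^ (1 / p - 1 / 2 : ℝ) := by
      rw [← Real.rpow_add hs0, ← Real.rpow_add hs0]; congr 1; ring
    calc _ ≤ (3 * (s : ℝ) ^ (1 / d : ℝ) / m) *
          (C ^ (1 / p) * ((s : ℝ) ^ (1 / p - 1 / 2 : ℝ) * l ^ (1 / p - 1 / 2 : ℝ))) := by
          unfold gridPoint; gcongr
      _ = 3 * C ^ (1 / p) * (m : ℝ)⁻¹ * l ^ (1 / p - 1 / 2 : ℝ) *
          ((s : ℝ) ^ (1 / d : ℝ) * (s : ℝ) ^ (1 / p - 1 / 2 : ℝ)) := by ring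
      _ = _ := by rw [← e2, hD₀]; ring
  have hs2 : (2 : ℝ) ≤ s := by
    rw [hsR']; exact_mod_cast hWi.trans (Nat.le_mul_of_pos_right _ hR0)
  have hs23 : (1 : ℝ) ≤ 2 / 3 * s := by linarith
  have hstep : e (2 / 3 * s) + D₀ * (s : ℝ) ^ (-(1 / 2 - 1 / d) : ℝ) ≤ e s := by
    have := mul_le_mul_of_nonneg_left
      (scale_step hd (by linarith : (0 : ℝ) < 2 / 3 * s) le_rfl) hD₀0.le
    simp only [he]
    linarith
  have main : meanBoxCost p n (gridPoint m A) (gridPoint m W) ^ (1 / p) ≤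
      (s : ℝ≥0∞) ^ (1 / p) * (η ^ (1 / p) + ENNReal.ofReal (e s)) := by
    refine H.trans ?_
    calc _ ≤ ((s : ℝ≥0∞) * (η ^ (1 / p) + ENNReal.ofReal (e (2 / 3 * s))) ^ p) ^ (1 / p) +
          ENNReal.ofReal ((s : ℝ) ^ (1 / p) * (D₀ * (s : ℝ) ^ (-(1 / 2 - 1 / d) : ℝ))) := by
          gcongr
      _ = (s : ℝ≥0∞) ^ (1 / p) * (η ^ (1 / p) + (ENNReal.ofReal (e (2 / 3 * s)) +
          ENNReal.ofReal (D₀ * (s : ℝ) ^ (-(1 / 2 - 1 / d) : ℝ)))) := by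
          rw [ENNReal.mul_rpow_of_nonneg _ _ (by positivity), hcancel',
            ENNReal.ofReal_mul (p := (s : ℝ) ^ (1 / p)) (by positivity), ← s1]
          ring
      _ ≤ _ := by
          gcongr
          rw [← ENNReal.ofReal_add (he0 hs23) (by positivity)]
          exact ENNReal.ofReal_le_ofReal hstep
  have := ENNReal.rpow_le_rpow main hp0.le
  rwa [hcancel, ENNReal.mul_rpow_of_nonneg _ _ hp0.le, hcancel] at this

end Recursion

/-! ### The mean cost of n uniform points, its scaling, and monotonicity of the cost per point. -/

section MeanCost

variable {d : ℕ} {p : ℝ} {ι : Type*} [Fintype ι]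

theorem map_finsetSum_dirac {κ : Type*} (S : Finset κ) {E F : Type*} [MeasurableSpace E]
    [MeasurableSpace F] {f : E → F} (hf : Measurable f) (x : κ → E) :
    (∑ i ∈ S, Measure.dirac (x i)).map f = ∑ i ∈ S, Measure.dirac (f (x i)) := by
  classical
  induction S using Finset.induction_on with
  | empty => simp
  | insert a s ha ih =>
    rw [Finset.sum_insert ha, Finset.sum_insert ha, Measure.map_add _ _ hf, ih,
      Measure.map_dirac' hf]

theorem edist_affineBox (a : Fin d → ℝ) {t : ℝ} (ht : 0 ≤ t) (x y : EuclideanSpace ℝ (Fin d)) :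
    edist (affineBox a (fun _ => t) x) (affineBox a (fun _ => t) y) =
      ENNReal.ofReal t * edist x y := by
  rw [edist_dist, edist_dist, ← ENNReal.ofReal_mul ht, dist_eq_norm, dist_eq_norm]
  have : affineBox a (fun _ => t) x - affineBox a (fun _ => t) y = t • (x - y) := by
    ext i
    simp [affineBox]
    ring
  rw [this, norm_smul, Real.norm_of_nonneg ht]

theorem transportCost_map_affineBox (hp : 0 ≤ p) (a : Fin d → ℝ) {t : ℝ} (ht : 0 < t)
    (μ ν : Measure (EuclideanSpace ℝ (Fin d))) :
    transportCost p (μ.map (affineBox a fun _ => t)) (ν.map (affineBox a fun _ => t)) =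
      ENNReal.ofReal t ^ p * transportCost p μ ν := by
  have hle : ∀ (a : Fin d → ℝ) {t : ℝ}, 0 < t → ∀ μ ν : Measure (EuclideanSpace ℝ (Fin d)),
      transportCost p (μ.map (affineBox a fun _ => t)) (ν.map (affineBox a fun _ => t)) ≤
        ENNReal.ofReal t ^ p * transportCost p μ ν := fun a t ht μ ν =>
    transportCost_map_le hp (by fun_prop) (by simpa using ht) ENNReal.ofReal_ne_top
      (fun x y => (edist_affineBox a ht.le x y).le) μ ν
  refine le_antisymm (hle a ht μ ν) ?_
  have hinv : (affineBox (fun i => -(t⁻¹ * a i)) fun _ => t⁻¹) ∘ (affineBox a fun _ => t) = id := by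
    funext x
    ext i
    simp [affineBox]
    field_simp
    ring
  have h := hle (fun i => -(t⁻¹ * a i)) (inv_pos.2 ht) (μ.map (affineBox a fun _ => t))
    (ν.map (affineBox a fun _ => t))
  rw [Measure.map_map (by fun_prop) (by fun_prop), Measure.map_map (by fun_prop) (by fun_prop),
    hinv, Measure.map_id, Measure.map_id] at h
  calc _ ≤ ENNReal.ofReal t ^ p * (ENNReal.ofReal t⁻¹ ^ p *
          transportCost p (μ.map (affineBox a fun _ => t)) (ν.map (affineBox a fun _ => t))) := by
        gcongr
    _ = _ := by
      rw [← mul_assoc, ← ENNReal.mul_rpow_of_nonneg _ _ hp, ← ENNReal.ofReal_mul ht.le,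
        mul_inv_cancel₀ ht.ne']
      simp

/-- The mean cost of transporting `n` independent uniform points to `n` times the uniform measure
on the unit cube. -/
noncomputable def meanCost (d : ℕ) (p : ℝ) (n : ℕ) : ℝ≥0∞ :=
  ∫⁻ x : Fin n → EuclideanSpace ℝ (Fin d), configCost p x Finset.univ (unitCubeMeasure d)
    ∂(Measure.pi fun _ => unitCubeMeasure d)

theorem lintegral_configCost_univ (hp : 1 ≤ p) (ρ μ : Measure (EuclideanSpace ℝ (Fin d)))
    [SigmaFinite μ] {κ : Type*} [Fintype κ] (e : κ ≃ ι) :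
    ∫⁻ x : ι → EuclideanSpace ℝ (Fin d), configCost p x Finset.univ ρ ∂(Measure.pi fun _ => μ) =
      ∫⁻ x : κ → EuclideanSpace ℝ (Fin d), configCost p x Finset.univ ρ
        ∂(Measure.pi fun _ => μ) := by
  rw [← (measurePreserving_piCongrLeft (fun _ => μ) e).map_eq,
    lintegral_map (measurable_configCost hp _ _) (MeasurableEquiv.measurable _)]
  refine lintegral_congr fun x => ?_
  unfold configCost
  rw [Finset.card_univ, Finset.card_univ, Fintype.card_congr e]
  congr 1
  refine (Fintype.sum_equiv e _ _ fun i => ?_).symm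
  congr 1
  exact (MeasurableEquiv.piCongrLeft_apply_apply (β := fun _ => EuclideanSpace ℝ (Fin d)) e x i).symm

/-- Only the coordinates in S enter the cost; the others integrate out to their total mass. The
factors may differ and need not be probability measures, since the result is applied to restrictions
to a cell and to its complement. -/
theorem lintegral_configCost [DecidableEq ι] (hp : 1 ≤ p) (S : Finset ι)
    (ρ : Measure (EuclideanSpace ℝ (Fin d))) (μ : ι → Measure (EuclideanSpace ℝ (Fin d)))
    [∀ i, IsFiniteMeasure (μ i)] :
    ∫⁻ x : ι → EuclideanSpace ℝ (Fin d), configCost p x S ρ ∂(Measure.pi μ) =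
      (∏ i : {i // i ∉ S}, μ i Set.univ) *
        ∫⁻ x : {i // i ∈ S} → EuclideanSpace ℝ (Fin d), configCost p x Finset.univ ρ
          ∂(Measure.pi fun i : {i // i ∈ S} => μ i) := by
  have h := (measurePreserving_piEquivPiSubtypeProd μ fun i => i ∈ S)
  have e : ∀ x : ι → EuclideanSpace ℝ (Fin d), configCost p x S ρ =
      configCost p ((MeasurableEquiv.piEquivPiSubtypeProd
        (fun _ => EuclideanSpace ℝ (Fin d)) fun i => i ∈ S) x).1 Finset.univ ρ := by
    intro x
    unfold configCost
    rw [Finset.card_univ, Fintype.card_coe]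
    congr 1
    exact (Finset.sum_coe_sort S fun i => Measure.dirac (x i)).symm
  simp_rw [e]
  have hm := (measurable_configCost (ι := {i // i ∈ S}) hp Finset.univ ρ)
  rw [h.lintegral_comp (f := fun z => configCost p z.1 Finset.univ ρ) (hm.comp measurable_fst),
    lintegral_prod (fun z => configCost p z.1 Finset.univ ρ)
      (hm.comp measurable_fst).aemeasurable]
  simp only [lintegral_const]
  rw [lintegral_mul_const _ hm, Measure.pi_univ, mul_comm]
  congr!

theorem lintegral_configCost_eq_meanCost (hp : 1 ≤ p) (S : Finset ι) :
    ∫⁻ x : ι → EuclideanSpace ℝ (Fin d), configCost p x S (unitCubeMeasure d)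
      ∂(Measure.pi fun _ => unitCubeMeasure d) = meanCost d p S.card := by
  classical
  rw [lintegral_configCost hp, meanCost, lintegral_configCost_univ hp _ _ S.equivFin.symm]
  simp

theorem lintegral_configCost_unifBox (hp : 1 ≤ p) (a : Fin d → ℝ) {t : ℝ} (ht : 0 < t) :
    ∫⁻ x : ι → EuclideanSpace ℝ (Fin d), configCost p x Finset.univ (unifBox a fun _ => t)
      ∂(Measure.pi fun _ => unifBox a fun _ => t) =
        ENNReal.ofReal t ^ p * meanCost d p (Fintype.card ι) := by
  have e : (Measure.pi fun _ : ι => unifBox a fun _ => t) =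
      (Measure.pi fun _ => unitCubeMeasure d).map fun x i => affineBox a (fun _ => t) (x i) := by
    rw [Measure.pi_map_pi fun i => by fun_prop]
    rfl
  rw [e, lintegral_map (measurable_configCost hp _ _) (by fun_prop), ← Finset.card_univ,
    ← lintegral_configCost_eq_meanCost hp, ← lintegral_const_mul _ (measurable_configCost hp _ _)]
  refine lintegral_congr fun x => ?_
  unfold configCost
  rw [← transportCost_map_affineBox (by linarith) a ht, map_finsetSum_dirac _ (by fun_prop),
    Measure.map_smul]
  rfl

/-- Given which points fall into the cell, they are independent and uniform there, so the
conditional mean cost depends only on their number, up to the scaling factor t^p. -/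
theorem meanBoxCost_cell (hp : 1 ≤ p) {n : ℕ} {a : Fin d → ℝ} {t : ℝ} (ht : 0 < t)
    (ha : ∀ i, 0 ≤ a i) (hat : ∀ i, a i + t ≤ 1) :
    meanBoxCost p n a (fun _ => t) =
      ENNReal.ofReal t ^ p * ∫⁻ x : Fin n → EuclideanSpace ℝ (Fin d),
        meanCost d p (indicesIn (box a fun _ => t) x).card
          ∂(Measure.pi fun _ => unitCubeMeasure d) := by
  classical
  set B := box a fun _ => t
  have hB : MeasurableSet B := measurableSet_box _ _
  set P : Measure (Fin n → EuclideanSpace ℝ (Fin d)) := Measure.pi fun _ => unitCubeMeasure d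
  set c := ENNReal.ofReal (∏ _i : Fin d, t) with hc
  have hres : (unitCubeMeasure d).restrict B = c • unifBox a fun _ => t :=
    unitCubeMeasure_restrict_box (fun _ => ht) ha hat
  have key : ∀ S : Finset (Fin n), ∫⁻ x, {x | indicesIn B x = S}.indicator
      (fun x => configCost p x S (unifBox a fun _ => t)) x ∂P =
      ENNReal.ofReal t ^ p * ∫⁻ x, {x : Fin n → EuclideanSpace ℝ (Fin d) |
        indicesIn B x = S}.indicator (fun _ => meanCost d p S.card) x ∂P := by
    intro S
    -- The event that exactly the points of S lie in B is a product set, so restricting the product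
    -- measure to it restricts each factor.
    have hset : {x : Fin n → EuclideanSpace ℝ (Fin d) | indicesIn B x = S} =
        Set.univ.pi fun i => if i ∈ S then B else Bᶜ := by
      ext x
      simp only [Set.mem_ofPred_eq, Finset.ext_iff, mem_indicesIn, Set.mem_pi, Set.mem_univ,
        forall_true_left]
      refine forall_congr' fun i => ?_
      by_cases hi : i ∈ S <;> simp [hi]
    rw [lintegral_indicator (measurableSet_indicesIn_eq hB S),
      lintegral_indicator (measurableSet_indicesIn_eq hB S), hset, Measure.restrict_pi_pi,
      lintegral_configCost hp, lintegral_const, Measure.pi_univ]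
    have hpi : (Measure.pi fun i : {i // i ∈ S} =>
        (unitCubeMeasure d).restrict (if (i : Fin n) ∈ S then B else Bᶜ)) =
        c ^ S.card • Measure.pi fun _ : {i // i ∈ S} => unifBox a fun _ => t := by
      refine Measure.pi_eq fun s hs => ?_
      rw [Measure.smul_apply, Measure.pi_pi, smul_eq_mul]
      have : c ^ S.card = ∏ _i : {i // i ∈ S}, c := by simp
      rw [this, ← Finset.prod_mul_distrib]
      refine Finset.prod_congr rfl fun i _ => ?_
      rw [if_pos i.2, hres, Measure.smul_apply, smul_eq_mul]
    rw [hpi, lintegral_smul_measure, lintegral_configCost_unifBox hp a ht, Fintype.card_coe,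
      smul_eq_mul]
    have hprod : ∏ i : Fin n, ((unitCubeMeasure d).restrict (if i ∈ S then B else Bᶜ)) Set.univ =
        c ^ S.card * ∏ i : {i // i ∉ S},
          ((unitCubeMeasure d).restrict (if (i : Fin n) ∈ S then B else Bᶜ)) Set.univ := by
      rw [← Fintype.prod_subtype_mul_prod_subtype (fun i => i ∈ S)]
      congr 1
      refine (Finset.prod_eq_pow_card (b := c) fun i _ => ?_).trans (by simp)
      rw [if_pos i.2, hres, Measure.smul_apply, smul_eq_mul, measure_univ, mul_one]
    rw [hprod]
    ring
  have e1 : ∀ x : Fin n → EuclideanSpace ℝ (Fin d), boxCost p a (fun _ => t) x =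
      ∑ S, {x | indicesIn B x = S}.indicator
        (fun x => configCost p x S (unifBox a fun _ => t)) x := fun x =>
    eq_sum_indicator_indicesIn B (fun S x => configCost p x S (unifBox a fun _ => t)) x
  have e2 : ∀ x : Fin n → EuclideanSpace ℝ (Fin d), meanCost d p (indicesIn B x).card =
      ∑ S, {x | indicesIn B x = S}.indicator (fun _ => meanCost d p S.card) x := fun x =>
    eq_sum_indicator_indicesIn B (fun S _ => meanCost d p S.card) x
  unfold meanBoxCost
  simp_rw [e1, e2]
  rw [lintegral_finsetSum _ fun S _ => (measurable_configCost hp S _).indicator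
      (measurableSet_indicesIn_eq hB S),
    lintegral_finsetSum _ fun S _ => measurable_const.indicator
      (measurableSet_indicesIn_eq hB S), Finset.mul_sum]
  exact Finset.sum_congr rfl fun S _ => key S

/-- Leaving out each of the n + 1 points in turn covers every point n times, so n copies of the
problem with n + 1 points split into n + 1 problems with n points; subadditivity concludes. -/
theorem mul_meanCost_succ_le (hp : 1 ≤ p) (n : ℕ) :
    (n : ℝ≥0∞) * meanCost d p (n + 1) ≤ ((n + 1 : ℕ) : ℝ≥0∞) * meanCost d p n := by
  rcases Nat.eq_zero_or_pos n with rfl | hn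
  · simp
  have hpt : ∀ x : Fin (n + 1) → EuclideanSpace ℝ (Fin d),
      (n : ℝ≥0∞) * configCost p x Finset.univ (unitCubeMeasure d) ≤
        ∑ j, configCost p x (Finset.univ.erase j) (unitCubeMeasure d) := by
    intro x
    unfold configCost
    rw [← transportCost_smul (by exact_mod_cast hn.ne') (ENNReal.natCast_ne_top n)]
    have e1 : (n : ℝ≥0∞) • ∑ i, Measure.dirac (x i) =
        ∑ j, ∑ i ∈ Finset.univ.erase j, Measure.dirac (x i) := by
      have h : ∀ j, ∑ i ∈ Finset.univ.erase j, Measure.dirac (x i) + Measure.dirac (x j) =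
          ∑ i, Measure.dirac (x i) := fun j => Finset.sum_erase_add _ _ (Finset.mem_univ j)
      have h2 : ∑ j, ∑ i ∈ Finset.univ.erase j, Measure.dirac (x i) + ∑ j, Measure.dirac (x j) =
          (n : ℝ≥0∞) • ∑ i, Measure.dirac (x i) + ∑ j, Measure.dirac (x j) := by
        rw [← Finset.sum_add_distrib, Finset.sum_congr rfl fun j _ => h j, Finset.sum_const,
          Finset.card_univ, Fintype.card_fin, Nat.cast_smul_eq_nsmul, add_smul, one_smul]
      ext s hs
      have h3 := congrArg (fun m => m s) h2
      simp only [Measure.add_apply] at h3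
      refine (ENNReal.add_left_inj ?_).1 h3.symm
      exact measure_ne_top _ _
    have e2 : (n : ℝ≥0∞) • ((Finset.univ : Finset (Fin (n + 1))).card : ℝ≥0∞) • unitCubeMeasure d =
        ∑ j : Fin (n + 1), ((Finset.univ.erase j).card : ℝ≥0∞) • unitCubeMeasure d := by
      simp only [Finset.card_erase_of_mem (Finset.mem_univ _), Finset.card_univ, Fintype.card_fin,
        Nat.add_sub_cancel, Finset.sum_const]
      rw [smul_smul, ← Nat.cast_smul_eq_nsmul ℝ≥0∞, smul_smul, mul_comm]
    rw [e1, e2]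
    exact transportCost_sum_le _ _ _
  have h := lintegral_mono (μ := Measure.pi fun _ => unitCubeMeasure d) hpt
  rw [lintegral_const_mul _ (measurable_configCost hp _ _),
    lintegral_finsetSum _ fun j _ => measurable_configCost hp _ _] at h
  simp_rw [lintegral_configCost_eq_meanCost hp] at h
  simpa using h

theorem configCost_le_of_mem_cube {κ : Type*} (hp : 0 ≤ p) {x : κ → EuclideanSpace ℝ (Fin d)}
    (S : Finset κ) (hx : ∀ i ∈ S, x i ∈ cube d 1) :
    configCost p x S (unitCubeMeasure d) ≤ S.card * (d : ℝ≥0∞) ^ p := by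
  have := natCast_smul_isFiniteMeasure S.card (unitCubeMeasure d)
  refine (transportCost_le_of_bounded hp (S := cube d 1) (S' := cube d 1) ?_ ?_ ?_
    fun x hx y hy => edist_le_of_mem_cube hx hy).trans ?_
  · simp
  · rw [ae_iff, Measure.finsetSum_apply]
    refine Finset.sum_eq_zero fun i hi => ?_
    change Measure.dirac (x i) (cube d 1)ᶜ = 0
    rw [Measure.dirac_apply' _ (measurableSet_cube d 1).compl]
    simp [hx i hi]
  · exact Measure.ae_smul_measure ae_mem_cube _
  · simp

theorem meanCost_le (hp : 0 ≤ p) (n : ℕ) : meanCost d p n ≤ n * (d : ℝ≥0∞) ^ p := by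
  calc _ ≤ ∫⁻ _ : Fin n → EuclideanSpace ℝ (Fin d), n * (d : ℝ≥0∞) ^ p
        ∂(Measure.pi fun _ => unitCubeMeasure d) := by
        refine lintegral_mono_ae ?_
        have : ∀ᵐ x : Fin n → EuclideanSpace ℝ (Fin d) ∂(Measure.pi fun _ => unitCubeMeasure d),
            ∀ i, x i ∈ cube d 1 :=
          ae_all_iff.2 fun i => (measurePreserving_eval _ i).quasiMeasurePreserving.ae ae_mem_cube
        filter_upwards [this] with x hx
        simpa using configCost_le_of_mem_cube hp Finset.univ fun i _ => hx i
    _ = _ := by simp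

theorem meanCost_ne_top (hp : 0 ≤ p) (n : ℕ) : meanCost d p n ≠ ∞ :=
  ne_top_of_le_ne_top (ENNReal.mul_ne_top (ENNReal.natCast_ne_top n)
    (ENNReal.rpow_ne_top_of_nonneg hp (ENNReal.natCast_ne_top d))) (meanCost_le hp n)

theorem meanCost_zero : meanCost d p 0 = 0 := by
  simp [meanCost, configCost, transportCost_zero]

/-- The mean cost per point. -/
noncomputable def costPerPoint (d : ℕ) (p : ℝ) (n : ℕ) : ℝ := (meanCost d p n).toReal / n

theorem costPerPoint_nonneg (n : ℕ) : 0 ≤ costPerPoint d p n := by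
  unfold costPerPoint; positivity

theorem meanCost_eq (hp : 0 ≤ p) (n : ℕ) :
    meanCost d p n = ENNReal.ofReal (n * costPerPoint d p n) := by
  rcases Nat.eq_zero_or_pos n with rfl | hn
  · simp [meanCost_zero]
  · rw [costPerPoint, mul_div_cancel₀ _ (by positivity), ENNReal.ofReal_toReal (meanCost_ne_top hp n)]

theorem costPerPoint_succ_le (hp : 1 ≤ p) {n : ℕ} (hn : 1 ≤ n) :
    costPerPoint d p (n + 1) ≤ costPerPoint d p n := by
  have h := ENNReal.toReal_mono (ENNReal.mul_ne_top (ENNReal.natCast_ne_top _)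
    (meanCost_ne_top (by linarith) n)) (mul_meanCost_succ_le (d := d) hp n)
  rw [ENNReal.toReal_mul, ENNReal.toReal_mul, ENNReal.toReal_natCast, ENNReal.toReal_natCast] at h
  have : (0 : ℝ) < n := by exact_mod_cast hn
  unfold costPerPoint
  rw [div_le_div_iff₀ (by positivity) this]
  linarith

theorem costPerPoint_anti (hp : 1 ≤ p) {k n : ℕ} (hk : 1 ≤ k) (hkn : k ≤ n) :
    costPerPoint d p n ≤ costPerPoint d p k := by
  induction n, hkn using Nat.le_induction with
  | base => exact le_rfl
  | succ n hn ih => exact (costPerPoint_succ_le hp (hk.trans hn)).trans ih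

/-- Monotonicity of the cost per point from K on, and the crude bound by its value at 1 below K. The
additive form prepares for averaging over a random n. -/
theorem meanCost_le_add (hp : 1 ≤ p) {K : ℕ} (hK : 1 ≤ K) (n : ℕ) :
    meanCost d p n ≤ n * ENNReal.ofReal (costPerPoint d p K) +
      if n < K then ENNReal.ofReal (K * costPerPoint d p 1) else 0 := by
  rw [meanCost_eq (by linarith), ENNReal.ofReal_mul (by positivity), ENNReal.ofReal_natCast]
  rcases Nat.eq_zero_or_pos n with rfl | hn
  · simp
  split_ifs with h
  · refine le_add_left ?_
    rw [ENNReal.ofReal_mul (by positivity), ENNReal.ofReal_natCast]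
    gcongr
    exact costPerPoint_anti hp le_rfl hn
  · rw [add_zero]
    gcongr
    exact costPerPoint_anti hp hK (not_lt.1 h)

end MeanCost

/-! ### Subadditivity of the cost per point, and a lower bound of the same order. -/

section Bounds

variable {d : ℕ} {p : ℝ}

theorem lintegral_card_indicesIn {E ι : Type*} [MeasurableSpace E] [Fintype ι] {μ : Measure E}
    [IsProbabilityMeasure μ] {B : Set E} (hB : MeasurableSet B) :
    ∫⁻ x : ι → E, ((indicesIn B x).card : ℝ≥0∞) ∂(Measure.pi fun _ => μ) =
      Fintype.card ι * μ B := by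
  classical
  have e : ∀ x : ι → E, ((indicesIn B x).card : ℝ≥0∞) =
      ∑ i, B.indicator (fun _ => (1 : ℝ≥0∞)) (x i) := fun x => by
    simp [indicesIn, Set.indicator_apply]
  simp_rw [e]
  have hm : ∀ i : ι, Measurable fun x : ι → E => B.indicator (fun _ => (1 : ℝ≥0∞)) (x i) :=
    fun i => (measurable_const.indicator hB).comp (measurable_pi_apply i)
  rw [lintegral_finsetSum _ fun i _ => hm i]
  have h : ∀ i : ι, ∫⁻ x : ι → E, B.indicator (fun _ => (1 : ℝ≥0∞)) (x i)
      ∂(Measure.pi fun _ => μ) = μ B := fun i => by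
    rw [(measurePreserving_eval (fun _ : ι => μ) i).lintegral_comp
      (measurable_const.indicator hB), lintegral_indicator_const hB, one_mul]
  simp [h]

/-- The number of points in B has mean at least (1 + ε)K, so it falls to K or below only with
exponentially small probability; otherwise the cost per point is at most its value at K. -/
theorem lintegral_meanCost_card_le (hp : 1 ≤ p) {B : Set (EuclideanSpace ℝ (Fin d))}
    (hB : MeasurableSet B) {n K : ℕ} (hK : 1 ≤ K) {ε : ℝ} (hε : 0 < ε)
    (hKn : (1 + ε) * K ≤ n * (unitCubeMeasure d).real B) :
    ∫⁻ x : Fin n → EuclideanSpace ℝ (Fin d), meanCost d p (indicesIn B x).card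
        ∂(Measure.pi fun _ => unitCubeMeasure d) ≤
      ENNReal.ofReal (n * (unitCubeMeasure d).real B *
        (costPerPoint d p K + costPerPoint d p 1 * Real.exp (-(tailRate ε * K)))) := by
  set l := n * (unitCubeMeasure d).real B with hl
  have hl0 : 0 ≤ l := by positivity
  have hKl : (K : ℝ) ≤ l / (1 + ε) := by rw [le_div_iff₀ (by linarith)]; linarith
  have hKl' : (K : ℝ) ≤ l := by
    have : (0 : ℝ) ≤ K := by positivity
    nlinarith
  have uK := costPerPoint_nonneg (d := d) (p := p) K
  have u1 := costPerPoint_nonneg (d := d) (p := p) 1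
  set A : Set (Fin n → EuclideanSpace ℝ (Fin d)) := {x | ((indicesIn B x).card : ℝ) ≤ K}
  have hA : MeasurableSet A := measurableSet_le (measurable_card_indicesIn hB) measurable_const
  have htail := measure_card_indicesIn_le (ι := Fin n) (μ := unitCubeMeasure d) hB hε (K := K)
    (by rwa [Fintype.card_fin])
  rw [Fintype.card_fin] at htail
  calc _ ≤ ∫⁻ x : Fin n → EuclideanSpace ℝ (Fin d),
        (A.indicator (fun _ => ENNReal.ofReal (K * costPerPoint d p 1)) x +
          (indicesIn B x).card * ENNReal.ofReal (costPerPoint d p K))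
        ∂(Measure.pi fun _ => unitCubeMeasure d) := by
        refine lintegral_mono fun x => (meanCost_le_add hp hK _).trans ?_
        rw [add_comm]
        gcongr
        split_ifs with h
        · rw [Set.indicator_of_mem]
          exact (Nat.cast_le (α := ℝ)).2 h.le
        · exact zero_le
    _ ≤ ENNReal.ofReal (K * costPerPoint d p 1) * ENNReal.ofReal (Real.exp (-(tailRate ε * K))) +
        ENNReal.ofReal l * ENNReal.ofReal (costPerPoint d p K) := by
        rw [lintegral_add_left (measurable_const.indicator hA), lintegral_indicator_const hA,
          lintegral_mul_const' _ _ ENNReal.ofReal_ne_top, lintegral_card_indicesIn hB,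
          Fintype.card_fin]
        gcongr
        · refine htail.trans (ENNReal.ofReal_le_ofReal (Real.exp_le_exp.2 (neg_le_neg ?_)))
          exact mul_le_mul_of_nonneg_left hKl (tailRate_pos hε).le
        · rw [hl, ENNReal.ofReal_mul (by positivity), ENNReal.ofReal_natCast, measureReal_def,
            ENNReal.ofReal_toReal (measure_ne_top _ _)]
    _ ≤ _ := by
        rw [← ENNReal.ofReal_mul (by positivity), ← ENNReal.ofReal_mul (by positivity),
          ← ENNReal.ofReal_add (by positivity) (by positivity)]
        refine ENNReal.ofReal_le_ofReal ?_
        have : K * costPerPoint d p 1 * Real.exp (-(tailRate ε * K)) ≤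
          l * costPerPoint d p 1 * Real.exp (-(tailRate ε * K)) := by gcongr
        linarith

/-- The closed unit cube and the half-open box differ by a null set, hence almost surely all points
lie in the box. -/
theorem meanCost_eq_meanBoxCost (n : ℕ) :
    meanCost d p n = meanBoxCost p n (fun _ : Fin d => 0) fun _ => 1 := by
  refine lintegral_congr_ae ?_
  have hU : unifBox (fun _ : Fin d => 0) (fun _ => 1) = unitCubeMeasure d := by
    have : affineBox (fun _ : Fin d => 0) (fun _ => 1) = id := by
      funext x; ext i; simp [affineBox]
    rw [unifBox, this, Measure.map_id]
  have h1 : ∀ᵐ y ∂(unitCubeMeasure d), y ∈ box (fun _ : Fin d => 0) fun _ => 1 := by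
    have h := unitCubeMeasure_restrict_box (a := fun _ : Fin d => 0) (w := fun _ => 1)
      (fun _ => one_pos) (fun _ => le_rfl) (fun _ => by norm_num)
    rw [hU] at h
    simp only [Finset.prod_const_one, ENNReal.ofReal_one, one_smul] at h
    rw [← h]
    exact ae_restrict_mem (measurableSet_box _ _)
  have h2 : ∀ᵐ x : Fin n → EuclideanSpace ℝ (Fin d) ∂(Measure.pi fun _ => unitCubeMeasure d),
      ∀ i, x i ∈ box (fun _ : Fin d => 0) fun _ => 1 :=
    ae_all_iff.2 fun i => (measurePreserving_eval _ i).quasiMeasurePreserving.ae h1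
  filter_upwards [h2] with x hx
  have : indicesIn (box (fun _ : Fin d => 0) fun _ => 1) x = Finset.univ := by
    ext i; simpa [mem_indicesIn] using hx i
  rw [boxCost, this, hU]

/-- The subadditivity inequality for the mean cost per point. -/
theorem exists_costPerPoint_le (hd : 3 ≤ d) (hp : 1 ≤ p) : ∃ C : ℝ, 0 < C ∧
    ∀ {ε : ℝ} (_ : 0 < ε) {n m K : ℕ} (_ : 0 < m) (_ : 1 ≤ K) (_ : (1 + ε) * K * m ^ d ≤ n),
      costPerPoint d p n ^ (1 / p) ≤ (m : ℝ)⁻¹ *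
        ((costPerPoint d p K + costPerPoint d p 1 * Real.exp (-(tailRate ε * K))) ^ (1 / p) +
          C * (K : ℝ) ^ (-(1 / 2) : ℝ)) := by
  have hp0 : 0 < p := by linarith
  obtain ⟨C, hC, h⟩ := exists_meanBoxCost_grid_le hd hp
  have hsc := scaleConst_pos hd
  refine ⟨C * scaleConst d, by positivity, ?_⟩
  intro ε hε n m K hm hK hKn
  have hmR : (0 : ℝ) < m := by exact_mod_cast hm
  have hKR : (1 : ℝ) ≤ K := by exact_mod_cast hK
  set l : ℝ := (n : ℝ) / m ^ d with hl
  have hKl : (1 + ε) * K ≤ l := by rwa [hl, le_div_iff₀ (by positivity)]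
  have hKl' : (K : ℝ) ≤ l := by nlinarith
  have hl0 : 0 < l := by linarith
  have hn0 : (0 : ℝ) < n := by
    have : (n : ℝ) = l * m ^ d := by rw [hl]; field_simp
    rw [this]; positivity
  have hmn : m ^ d ≤ n := by
    have : (m : ℝ) ^ d ≤ n := by
      have : (m : ℝ) ^ d * 1 ≤ m ^ d * ((1 + ε) * K) := by
        gcongr; nlinarith
      linarith
    exact_mod_cast this
  set U := costPerPoint d p K + costPerPoint d p 1 * Real.exp (-(tailRate ε * K)) with hU
  have hU0 : 0 ≤ U := by
    have := costPerPoint_nonneg (d := d) (p := p) K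
    have := costPerPoint_nonneg (d := d) (p := p) 1
    positivity
  have hcell : ∀ A : Fin d → ℕ, (∀ i, A i + 1 ≤ m) →
      meanBoxCost p n (gridPoint m A) (gridPoint m fun _ => 1) ≤
        ENNReal.ofReal ((m : ℝ)⁻¹ ^ p * (l * U)) := by
    intro A hA
    have hA1 : ∀ i, gridPoint m A i + (m : ℝ)⁻¹ ≤ 1 := fun i => by
      rw [gridPoint, inv_eq_one_div, ← add_div, div_le_one hmR]; exact_mod_cast hA i
    have hA0 : ∀ i, 0 ≤ gridPoint m A i := fun i => by unfold gridPoint; positivity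
    have e : (gridPoint m fun _ : Fin d => 1) = fun _ => (m : ℝ)⁻¹ := by
      ext i; simp [gridPoint]
    have hq : (n : ℝ) * (unitCubeMeasure d).real (box (gridPoint m A) fun _ => (m : ℝ)⁻¹) = l := by
      rw [measureReal_box (fun _ => by positivity) hA0 hA1, hl]
      simp [div_eq_mul_inv]
    rw [e, meanBoxCost_cell hp (by positivity) hA0 hA1, ENNReal.ofReal_mul (by positivity),
      ENNReal.ofReal_rpow_of_nonneg (by positivity) hp0.le]
    gcongr
    refine (lintegral_meanCost_card_le hp (measurableSet_box _ _) hK hε (by rwa [hq])).trans_eq ?_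
    rw [hq]
  -- The hierarchy is started from the whole cube, a box of m^d cells with all sides equal to m.
  have H := h hm hmn hcell (m ^ d) (fun _ => 0) (fun _ => m) (fun _ => hm) (fun _ => by simp)
    (fun _ _ => by omega) (by simp)
  have e0 : gridPoint m (fun _ : Fin d => 0) = fun _ => 0 := by ext; simp [gridPoint]
  have e1 : gridPoint m (fun _ : Fin d => m) = fun _ => 1 := by
    ext; simp [gridPoint, hmR.ne']
  rw [e0, e1, ← meanCost_eq_meanBoxCost, meanCost_eq hp0.le] at H
  set X : ℝ := (m : ℝ)⁻¹ * l ^ (1 / p) * (U ^ (1 / p) + C * scaleConst d * (K : ℝ) ^ (-(1 / 2) : ℝ))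
    with hX
  have hX0 : 0 ≤ X := by positivity
  have hη : ENNReal.ofReal ((m : ℝ)⁻¹ ^ p * (l * U)) ^ (1 / p) =
      ENNReal.ofReal ((m : ℝ)⁻¹ * l ^ (1 / p) * U ^ (1 / p)) := by
    rw [ENNReal.ofReal_rpow_of_nonneg (by positivity) (by positivity),
      Real.mul_rpow (by positivity) (by positivity), ← Real.rpow_mul (by positivity),
      mul_one_div_cancel hp0.ne', Real.rpow_one, Real.mul_rpow hl0.le hU0, mul_assoc]
  have hle : C * (m : ℝ)⁻¹ * l ^ (1 / p - 1 / 2 : ℝ) *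
      (scaleConst d * (1 - ((m ^ d : ℕ) : ℝ) ^ (-(1 / 2 - 1 / d) : ℝ))) ≤
      (m : ℝ)⁻¹ * l ^ (1 / p) * (C * scaleConst d * (K : ℝ) ^ (-(1 / 2) : ℝ)) := by
    -- The factor l^(1/p) is kept, to be cancelled at the end by n = m^d l; only l^(-1/2) is
    -- weakened to K^(-1/2).
    have h1 : l ^ (1 / p - 1 / 2 : ℝ) ≤ l ^ (1 / p) * (K : ℝ) ^ (-(1 / 2) : ℝ) := by
      rw [sub_eq_add_neg, Real.rpow_add hl0]
      gcongr ?_ * ?_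
      exact Real.rpow_le_rpow_of_nonpos (by linarith) hKl' (by norm_num)
    have h2 : scaleConst d * (1 - ((m ^ d : ℕ) : ℝ) ^ (-(1 / 2 - 1 / d) : ℝ)) ≤ scaleConst d := by
      refine mul_le_of_le_one_right hsc.le ?_
      have : (0 : ℝ) ≤ ((m ^ d : ℕ) : ℝ) ^ (-(1 / 2 - 1 / d) : ℝ) := by positivity
      linarith
    calc _ ≤ C * (m : ℝ)⁻¹ * l ^ (1 / p - 1 / 2 : ℝ) * scaleConst d := by gcongr
      _ ≤ C * (m : ℝ)⁻¹ * (l ^ (1 / p) * (K : ℝ) ^ (-(1 / 2) : ℝ)) * scaleConst d := by gcongr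
      _ = _ := by ring
  have H2 : ENNReal.ofReal (n * costPerPoint d p n) ≤
      ENNReal.ofReal (((m ^ d : ℕ) : ℝ) * X ^ p) := by
    refine H.trans ?_
    rw [hη, ENNReal.ofReal_mul (q := X ^ p) (by positivity),
      ← ENNReal.ofReal_rpow_of_nonneg hX0 hp0.le, ← ENNReal.ofReal_natCast (m ^ d)]
    gcongr
    calc _ ≤ ENNReal.ofReal ((m : ℝ)⁻¹ * l ^ (1 / p) * U ^ (1 / p)) +
          ENNReal.ofReal ((m : ℝ)⁻¹ * l ^ (1 / p) * (C * scaleConst d * (K : ℝ) ^ (-(1 / 2) : ℝ))) :=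
          add_le_add le_rfl (ENNReal.ofReal_le_ofReal hle)
      _ = ENNReal.ofReal X := by
          rw [← ENNReal.ofReal_add (by positivity) (by positivity), hX]
          congr 1; ring
  rw [ENNReal.ofReal_le_ofReal_iff (by positivity), Nat.cast_pow] at H2
  have H3 : costPerPoint d p n ≤ ((m : ℝ)⁻¹ *
      (U ^ (1 / p) + C * scaleConst d * (K : ℝ) ^ (-(1 / 2) : ℝ))) ^ p := by
    have e2 : (m : ℝ) ^ d * X ^ p = n * ((m : ℝ)⁻¹ *
        (U ^ (1 / p) + C * scaleConst d * (K : ℝ) ^ (-(1 / 2) : ℝ))) ^ p := by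
      have : X = l ^ (1 / p) * ((m : ℝ)⁻¹ *
          (U ^ (1 / p) + C * scaleConst d * (K : ℝ) ^ (-(1 / 2) : ℝ))) := by rw [hX]; ring
      rw [this, Real.mul_rpow (by positivity) (by positivity), ← Real.rpow_mul hl0.le,
        one_div_mul_cancel hp0.ne', Real.rpow_one, ← mul_assoc, hl]
      field_simp
    rw [e2] at H2
    exact le_of_mul_le_mul_left H2 hn0
  calc _ ≤ (((m : ℝ)⁻¹ *
      (U ^ (1 / p) + C * scaleConst d * (K : ℝ) ^ (-(1 / 2) : ℝ))) ^ p) ^ (1 / p) :=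
        Real.rpow_le_rpow (costPerPoint_nonneg n) H3 (by positivity)
    _ = _ := by
      rw [← Real.rpow_mul (by positivity), mul_one_div_cancel hp0.ne', Real.rpow_one]

theorem unitCubeMeasure_ball_le (x : EuclideanSpace ℝ (Fin d)) {r : ℝ} (hr : 0 < r) :
    unitCubeMeasure d (Metric.ball x r) ≤ ENNReal.ofReal ((2 * r) ^ d) := by
  have h : Metric.ball x r ⊆ box (fun i => x i - r) fun _ => 2 * r := by
    intro y hy i
    rw [Metric.mem_ball, dist_eq_norm] at hy
    have h1 := (PiLp.norm_apply_le (y - x) i).trans_lt hy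
    rw [PiLp.sub_apply, Real.norm_eq_abs, abs_lt] at h1
    exact ⟨by linarith [h1.1], by linarith [h1.2]⟩
  calc _ ≤ volume (box (fun i => x i - r) fun _ => 2 * r) :=
        (measure_mono h).trans (Measure.restrict_apply_le _ _)
    _ = _ := by
      have := congrArg (fun m => m Set.univ) (volume_restrict_box (fun i => x i - r)
        (w := fun _ => 2 * r) fun _ => by positivity)
      simpa using this

/-- The balls of radius r about the points cover at most half of the cube, whatever the
configuration. In any coupling the mass n/2 on the remaining half comes from a distance at least r.
-/
theorem configCost_univ_ge (hp : 0 ≤ p) {n : ℕ} (x : Fin n → EuclideanSpace ℝ (Fin d)) {r : ℝ}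
    (hr : 0 < r) (hrn : n * (2 * r) ^ d ≤ 1 / 2) :
    ENNReal.ofReal (r ^ p * (n / 2)) ≤ configCost p x Finset.univ (unitCubeMeasure d) := by
  refine le_iInf₂ fun π hπ => ?_
  set G : Set (EuclideanSpace ℝ (Fin d)) := ⋃ i, Metric.ball (x i) r with hG
  have hGm : MeasurableSet G := MeasurableSet.iUnion fun i => measurableSet_ball
  have hG2 : unitCubeMeasure d G ≤ ENNReal.ofReal (1 / 2) := by
    calc _ ≤ ∑ i, unitCubeMeasure d (Metric.ball (x i) r) := by
          rw [hG]; exact measure_iUnion_fintype_le _ _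
      _ ≤ ∑ _i : Fin n, ENNReal.ofReal ((2 * r) ^ d) :=
          Finset.sum_le_sum fun i _ => unitCubeMeasure_ball_le _ hr
      _ = ENNReal.ofReal (n * (2 * r) ^ d) := by
          rw [ENNReal.ofReal_mul (by positivity), ENNReal.ofReal_natCast]; simp
      _ ≤ _ := ENNReal.ofReal_le_ofReal hrn
  have hGc : ENNReal.ofReal (1 / 2) ≤ unitCubeMeasure d Gᶜ := by
    rw [prob_compl_eq_one_sub hGm]
    refine le_trans ?_ (tsub_le_tsub_left hG2 1)
    rw [← ENNReal.ofReal_one, ← ENNReal.ofReal_sub _ (by norm_num)]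
    norm_num
  have hrange : MeasurableSet (Set.range x) := (Set.finite_range x).measurableSet
  have hae : ∀ᵐ z ∂π, z.1 ∈ Set.range x := by
    refine ae_of_ae_map measurable_fst.aemeasurable (p := fun y => y ∈ Set.range x) ?_
    rw [hπ.1, ae_iff, Measure.finsetSum_apply]
    refine Finset.sum_eq_zero fun i _ => ?_
    change Measure.dirac (x i) (Set.range x)ᶜ = 0
    rw [Measure.dirac_apply' _ hrange.compl]
    simp
  calc _ = ENNReal.ofReal (r ^ p) * (n * ENNReal.ofReal (1 / 2)) := by
        rw [← ENNReal.ofReal_natCast, ← ENNReal.ofReal_mul (by positivity),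
          ← ENNReal.ofReal_mul (by positivity)]
        congr 1; ring
    _ ≤ ENNReal.ofReal (r ^ p) * (n * unitCubeMeasure d Gᶜ) := by gcongr
    _ = ∫⁻ y, Gᶜ.indicator (fun _ => ENNReal.ofReal (r ^ p)) y ∂(π.map Prod.snd) := by
        rw [hπ.2, lintegral_indicator_const hGm.compl, Measure.smul_apply]
        simp
    _ = ∫⁻ z, Gᶜ.indicator (fun _ => ENNReal.ofReal (r ^ p)) z.2 ∂π :=
        lintegral_map (measurable_const.indicator hGm.compl) measurable_snd
    _ ≤ _ := by
        refine lintegral_mono_ae ?_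
        filter_upwards [hae] with z hz
        by_cases hz2 : z.2 ∈ G
        · rw [Set.indicator_of_notMem (by simpa using hz2)]; exact zero_le
        · rw [Set.indicator_of_mem hz2, ← ENNReal.ofReal_rpow_of_nonneg hr.le hp]
          refine ENNReal.rpow_le_rpow ?_ hp
          obtain ⟨i, hi⟩ := hz
          have : z.2 ∉ Metric.ball (x i) r := fun h => hz2 (Set.mem_iUnion.2 ⟨i, h⟩)
          rw [Metric.mem_ball, not_lt, dist_comm] at this
          rw [← hi, edist_dist]
          exact ENNReal.ofReal_le_ofReal this

theorem exists_le_costPerPoint (hd : 3 ≤ d) (hp : 1 ≤ p) : ∃ c : ℝ, 0 < c ∧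
    ∀ {n : ℕ}, 1 ≤ n → c ≤ (n : ℝ) ^ (1 / d : ℝ) * costPerPoint d p n ^ (1 / p) := by
  have hp0 : 0 < p := by linarith
  have hd0 : (0 : ℝ) < d := by exact_mod_cast (by omega : 0 < d)
  refine ⟨(2 : ℝ)⁻¹ * (2 : ℝ) ^ (-(1 / d) : ℝ) * (1 / 2) ^ (1 / p), by positivity, fun {n} hn => ?_⟩
  have hnR : (0 : ℝ) < n := by exact_mod_cast hn
  -- Chosen so that n(2r)^d = 1/2, the largest radius allowed by the covering bound.
  set r : ℝ := (2 : ℝ)⁻¹ * (2 * n : ℝ) ^ (-(1 / d) : ℝ) with hr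
  have hr0 : 0 < r := by positivity
  have h1 : (n : ℝ) * (2 * r) ^ d ≤ 1 / 2 := by
    have : (2 * r) ^ d = (2 * n : ℝ)⁻¹ := by
      rw [hr, ← mul_assoc, mul_inv_cancel₀ two_ne_zero, one_mul, ← Real.rpow_natCast,
        ← Real.rpow_mul (by positivity), neg_mul, one_div_mul_cancel hd0.ne',
        Real.rpow_neg_one]
    rw [this]; field_simp; exact le_rfl
  have h2 : ENNReal.ofReal (r ^ p * (n / 2)) ≤ meanCost d p n := by
    calc _ = ∫⁻ _ : Fin n → EuclideanSpace ℝ (Fin d), ENNReal.ofReal (r ^ p * (n / 2))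
          ∂(Measure.pi fun _ => unitCubeMeasure d) := by simp
      _ ≤ _ := lintegral_mono fun x => configCost_univ_ge hp0.le x hr0 h1
  rw [meanCost_eq hp0.le, ENNReal.ofReal_le_ofReal_iff
    (mul_nonneg hnR.le (costPerPoint_nonneg n))] at h2
  have h3 : r ^ p * (1 / 2) ≤ costPerPoint d p n := by
    refine le_of_mul_le_mul_left ?_ hnR
    linarith
  have h4 := Real.rpow_le_rpow (by positivity) h3 (by positivity : 0 ≤ 1 / p)
  rw [Real.mul_rpow (by positivity) (by positivity), ← Real.rpow_mul hr0.le,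
    mul_one_div_cancel hp0.ne', Real.rpow_one] at h4
  calc _ = (n : ℝ) ^ (1 / d : ℝ) * (r * (1 / 2) ^ (1 / p)) := by
        rw [hr, Real.mul_rpow zero_le_two hnR.le, Real.rpow_neg hnR.le]
        field_simp
    _ ≤ _ := by gcongr

end Bounds

/-! ### Existence and positivity of the limit for independent points. -/

section Limit

/-- A Fekete-type argument: take K with v K close to the lower limit and δ K small; the inequality
then bounds all later values by nearly the lower limit. The instance ε = 1, K = 1 supplies
boundedness from above. -/
theorem exists_tendsto_of_eventually_le {v : ℕ → ℝ} {c : ℝ} (hv : ∀ n, 1 ≤ n → c ≤ v n)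
    (h : ∀ ε : ℝ, 0 < ε → ∃ δ : ℕ → ℝ, Tendsto δ atTop (𝓝 0) ∧
      ∀ K : ℕ, 1 ≤ K → ∀ᶠ n in atTop, v n ≤ (1 + ε) ^ 2 * (v K + δ K)) :
    ∃ V, c ≤ V ∧ Tendsto v atTop (𝓝 V) := by
  have hbelow : IsBoundedUnder (· ≥ ·) atTop v :=
    isBoundedUnder_of_eventually_ge ((eventually_ge_atTop 1).mono fun n hn => hv n hn)
  have habove : IsBoundedUnder (· ≤ ·) atTop v := by
    obtain ⟨δ, -, h1⟩ := h 1 one_pos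
    exact isBoundedUnder_of_eventually_le (h1 1 le_rfl)
  refine ⟨liminf v atTop, le_liminf_of_le habove.isCoboundedUnder_ge
    ((eventually_ge_atTop 1).mono fun n hn => hv n hn), ?_⟩
  set V := liminf v atTop
  refine tendsto_order.2 ⟨fun a ha => eventually_lt_of_lt_liminf ha hbelow, fun b hb => ?_⟩
  have hcont : Tendsto (fun ε : ℝ => (1 + ε) ^ 2 * (V + ε + ε)) (𝓝[>] 0) (𝓝 V) := by
    have : Tendsto (fun ε : ℝ => (1 + ε) ^ 2 * (V + ε + ε)) (𝓝 0) (𝓝 ((1 + 0) ^ 2 * (V + 0 + 0))) :=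
      Continuous.tendsto (by fun_prop) 0
    simp only [add_zero, one_pow, one_mul] at this
    exact this.mono_left nhdsWithin_le_nhds
  obtain ⟨ε, hεb, hε⟩ := ((hcont.eventually_lt_const hb).and self_mem_nhdsWithin).exists
  have hε : 0 < ε := hε
  obtain ⟨δ, hδ, h1⟩ := h ε hε
  have hfreq := frequently_lt_of_liminf_lt habove.isCoboundedUnder_ge
    (show liminf v atTop < V + ε from lt_add_of_pos_right V hε)
  obtain ⟨K, hK, hKδ, hK1⟩ := (hfreq.and_eventually
    ((hδ.eventually_lt_const hε).and (eventually_ge_atTop 1))).exists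
  filter_upwards [h1 K hK1] with n hn
  refine (hn.trans ?_).trans_lt hεb
  gcongr

/-- The witness is m = ⌊(n/b)^(1/d)⌋. Rounding down costs a factor at most 1 + ε once the floor
exceeds 1/ε. -/
theorem eventually_rpow_div_floor_le {d : ℕ} (hd : 0 < d) {b ε : ℝ} (hb : 0 < b) (hε : 0 < ε) :
    ∀ᶠ n : ℕ in atTop, ∃ m : ℕ, 0 < m ∧ b * (m : ℝ) ^ d ≤ n ∧
      (n : ℝ) ^ (1 / d : ℝ) * (m : ℝ)⁻¹ ≤ (1 + ε) * b ^ (1 / d : ℝ) := by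
  have hd0 : (0 : ℝ) < 1 / d := by positivity
  have hy : Tendsto (fun n : ℕ => ((n : ℝ) / b) ^ (1 / d : ℝ)) atTop atTop :=
    (tendsto_rpow_atTop hd0).comp (tendsto_natCast_atTop_atTop.atTop_div_const hb)
  filter_upwards [hy.eventually_ge_atTop (1 + 1 / ε)] with n hn
  set y := ((n : ℝ) / b) ^ (1 / d : ℝ) with hy
  have h1 : 1 ≤ y := by have : 0 < 1 / ε := by positivity
                        linarith
  have hfl : y < ⌊y⌋₊ + 1 := Nat.lt_floor_add_one y
  have hfle : (⌊y⌋₊ : ℝ) ≤ y := Nat.floor_le (by linarith)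
  have hm : 0 < ⌊y⌋₊ := Nat.floor_pos.2 h1
  have hmR : (0 : ℝ) < ⌊y⌋₊ := by exact_mod_cast hm
  refine ⟨⌊y⌋₊, hm, ?_, ?_⟩
  · have h2 : (⌊y⌋₊ : ℝ) ^ d ≤ y ^ d := by gcongr
    have h3 : y ^ d = n / b := by
      rw [hy, ← Real.rpow_natCast, ← Real.rpow_mul (by positivity), one_div_mul_cancel
        (by positivity), Real.rpow_one]
    rw [h3, le_div_iff₀ hb] at h2
    linarith
  · have h4 : (n : ℝ) ^ (1 / d : ℝ) = y * b ^ (1 / d : ℝ) := by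
      rw [hy, ← Real.mul_rpow (by positivity) hb.le, div_mul_cancel₀ _ hb.ne']
    have h5 : y * (⌊y⌋₊ : ℝ)⁻¹ ≤ 1 + ε := by
      rw [← div_eq_mul_inv, div_le_iff₀ hmR]
      have h6 : 1 ≤ ε * ⌊y⌋₊ := by
        have : 1 / ε ≤ ⌊y⌋₊ := by linarith
        rw [div_le_iff₀ hε] at this; linarith
      linarith
    rw [h4]
    calc _ = y * (⌊y⌋₊ : ℝ)⁻¹ * b ^ (1 / d : ℝ) := by ring
      _ ≤ _ := by gcongr

variable {d : ℕ} {p : ℝ}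

/-- Subadditivity is applied with b = (1 + ε)K. The factor (1 + ε)² collects the rounding loss and
the loss (1 + ε)^(1/d) ≤ 1 + ε. The error tends to zero because K^(1/d) loses against both the
exponential tail and K^(-1/2). -/
theorem exists_tendsto_costPerPoint_rpow (hd : 3 ≤ d) (hp : 1 ≤ p) : ∃ V : ℝ, 0 < V ∧
    Tendsto (fun n : ℕ => (n : ℝ) ^ (1 / d : ℝ) * costPerPoint d p n ^ (1 / p)) atTop (𝓝 V) := by
  have hp0 : 0 < p := by linarith
  obtain ⟨c, hc, hlow⟩ := exists_le_costPerPoint hd hp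
  obtain ⟨C, hC, hup⟩ := exists_costPerPoint_le hd hp
  suffices h : ∃ V, c ≤ V ∧ Tendsto (fun n : ℕ => (n : ℝ) ^ (1 / d : ℝ) *
      costPerPoint d p n ^ (1 / p)) atTop (𝓝 V) by
    obtain ⟨V, hV, h⟩ := h
    exact ⟨V, hc.trans_le hV, h⟩
  refine exists_tendsto_of_eventually_le (fun n hn => hlow hn) fun ε hε => ?_
  have hu1 := costPerPoint_nonneg (d := d) (p := p) 1
  have hd1 : (1 / d : ℝ) ≤ 1 := by
    rw [div_le_one (by positivity)]; exact_mod_cast (by omega : 1 ≤ d)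
  refine ⟨fun K => costPerPoint d p 1 ^ (1 / p) * ((K : ℝ) ^ (1 / d : ℝ) *
    Real.exp (-(tailRate ε / p) * K)) + C * (K : ℝ) ^ (-(1 / 2 - 1 / d) : ℝ), ?_, ?_⟩
  · have h1 : Tendsto (fun K : ℕ => (K : ℝ) ^ (1 / d : ℝ) *
        Real.exp (-(tailRate ε / p) * K)) atTop (𝓝 0) :=
      (tendsto_rpow_mul_exp_neg_mul_atTop_nhds_zero _ _ (div_pos (tailRate_pos hε) hp0)).comp
        tendsto_natCast_atTop_atTop
    have h2 : Tendsto (fun K : ℕ => (K : ℝ) ^ (-(1 / 2 - 1 / d) : ℝ)) atTop (𝓝 0) :=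
      (tendsto_rpow_neg_atTop (scaleExponent_pos hd)).comp tendsto_natCast_atTop_atTop
    simpa using (h1.const_mul (costPerPoint d p 1 ^ (1 / p))).add (h2.const_mul C)
  · intro K hK
    have hKR : (0 : ℝ) < K := by exact_mod_cast hK
    filter_upwards [eventually_rpow_div_floor_le (by omega : 0 < d)
      (by positivity : 0 < (1 + ε) * K) hε] with n hn
    obtain ⟨m, hm, hmn, hnm⟩ := hn
    have huK := costPerPoint_nonneg (d := d) (p := p) K
    have hexp : (Real.exp (-(tailRate ε * K))) ^ (1 / p) = Real.exp (-(tailRate ε / p) * K) := by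
      rw [← Real.exp_mul]; congr 1; ring
    have hG : (costPerPoint d p K + costPerPoint d p 1 * Real.exp (-(tailRate ε * K))) ^ (1 / p) ≤
        costPerPoint d p K ^ (1 / p) + costPerPoint d p 1 ^ (1 / p) *
          Real.exp (-(tailRate ε / p) * K) := by
      rw [← hexp, ← Real.mul_rpow hu1 (Real.exp_pos _).le]
      exact Real.rpow_add_le_add_rpow huK (by positivity) (by positivity)
        ((div_le_one hp0).2 hp)
    have hK2 : (K : ℝ) ^ (1 / d : ℝ) * (K : ℝ) ^ (-(1 / 2) : ℝ) =
        (K : ℝ) ^ (-(1 / 2 - 1 / d) : ℝ) := by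
      rw [← Real.rpow_add hKR]; congr 1; ring
    have hε1 : (1 + ε) ^ (1 / d : ℝ) ≤ 1 + ε :=
      Real.rpow_le_self_of_one_le (by linarith) hd1
    calc _ ≤ (n : ℝ) ^ (1 / d : ℝ) * ((m : ℝ)⁻¹ *
          ((costPerPoint d p K + costPerPoint d p 1 * Real.exp (-(tailRate ε * K))) ^ (1 / p) +
          C * (K : ℝ) ^ (-(1 / 2) : ℝ))) := by
          gcongr
          exact hup hε hm hK hmn
      _ = (n : ℝ) ^ (1 / d : ℝ) * (m : ℝ)⁻¹ *
          ((costPerPoint d p K + costPerPoint d p 1 * Real.exp (-(tailRate ε * K))) ^ (1 / p) +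
          C * (K : ℝ) ^ (-(1 / 2) : ℝ)) := by ring
      _ ≤ (1 + ε) * ((1 + ε) * (K : ℝ) ^ (1 / d : ℝ)) *
          (costPerPoint d p K ^ (1 / p) + costPerPoint d p 1 ^ (1 / p) *
          Real.exp (-(tailRate ε / p) * K) + C * (K : ℝ) ^ (-(1 / 2) : ℝ)) := by
          refine mul_le_mul (hnm.trans ?_) (by gcongr) (by positivity) (by positivity)
          rw [Real.mul_rpow (by positivity) hKR.le]
          gcongr
      _ = _ := by rw [← hK2]; ring

/-- The limit of the rescaled mean cost per point. -/
theorem exists_tendsto_costPerPoint (hd : 3 ≤ d) (hp : 1 ≤ p) : ∃ f : ℝ, 0 < f ∧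
    Tendsto (fun n : ℕ => (n : ℝ) ^ (p / d : ℝ) * costPerPoint d p n) atTop (𝓝 f) := by
  have hp0 : 0 < p := by linarith
  obtain ⟨V, hV, h⟩ := exists_tendsto_costPerPoint_rpow hd hp
  refine ⟨V ^ p, by positivity, ?_⟩
  refine (h.rpow_const (p := p) (Or.inl hV.ne')).congr fun n => ?_
  have := costPerPoint_nonneg (d := d) (p := p) n
  rw [Real.mul_rpow (by positivity) (by positivity), ← Real.rpow_mul (by positivity),
    ← Real.rpow_mul this, one_div_mul_cancel hp0.ne', Real.rpow_one]
  congr 2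
  ring

/-- The mean cost for i.i.d. uniform points. -/
theorem lintegral_transportCostOn_empiricalMeasure (hp : 1 ≤ p) {Ω : Type*} [MeasurableSpace Ω]
    (P : Measure Ω) [IsProbabilityMeasure P] (X : ℕ → Ω → EuclideanSpace ℝ (Fin d))
    (hX : ∀ i, pdf.IsUniform (X i) (cube d 1) P volume) (hi : iIndepFun X P) {n : ℕ} (hn : 1 ≤ n) :
    ∫⁻ ω, transportCostOn p (cube d 1) (empiricalMeasure (fun i => X i ω) n) volume ∂P =
      ENNReal.ofReal (costPerPoint d p n) := by
  have hvol : volume (cube d 1) = 1 := by simpa using volume_cube (d := d) one_pos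
  have hm : ∀ i, AEMeasurable (X i) P := fun i =>
    (hX i).aemeasurable (by rw [hvol]; simp) (by rw [hvol]; simp)
  have hmap : ∀ i, P.map (X i) = unitCubeMeasure d := fun i => by
    rw [hX i, ProbabilityTheory.cond, hvol, inv_one, one_smul]; rfl
  have hmem : ∀ᵐ ω ∂P, ∀ i, X i ω ∈ cube d 1 := ae_all_iff.2 fun i => by
    refine ae_of_ae_map (hm i) (p := fun y => y ∈ cube d 1) ?_
    rw [hmap i]; exact ae_mem_cube
  have hjoint : P.map (fun ω (i : Fin n) => X i ω) = Measure.pi fun _ => unitCubeMeasure d := by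
    have := (iIndepFun_iff_map_fun_eq_pi_map (f := fun (i : Fin n) => X i)
      (fun i => hm i)).1 (hi.precomp Fin.val_injective)
    rw [this]
    congr 1
    ext1 i
    exact hmap i
  have hn0 : (n : ℝ≥0∞) ≠ 0 := by exact_mod_cast (by omega : n ≠ 0)
  have hpt : ∀ᵐ ω ∂P, transportCostOn p (cube d 1) (empiricalMeasure (fun i => X i ω) n) volume =
      (n : ℝ≥0∞)⁻¹ * configCost p (fun i : Fin n => X i ω) Finset.univ (unitCubeMeasure d) := by
    filter_upwards [hmem] with ω hω
    rw [configCost, ← transportCost_smul (ENNReal.inv_ne_zero.2 (ENNReal.natCast_ne_top n))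
      (ENNReal.inv_ne_top.2 hn0), smul_smul, Finset.card_univ, Fintype.card_fin,
      ENNReal.inv_mul_cancel hn0 (ENNReal.natCast_ne_top n), one_smul, transportCostOn,
      empiricalMeasure]
    congr 1
    rw [Measure.restrict_smul, Finset.sum_range]
    congr 1
    rw [Measure.restrict_eq_self_of_ae_mem]
    rw [ae_iff, Measure.finsetSum_apply]
    refine Finset.sum_eq_zero fun i _ => ?_
    change Measure.dirac (X i ω) (cube d 1)ᶜ = 0
    rw [Measure.dirac_apply' _ (measurableSet_cube d 1).compl]
    simp [hω i]
  rw [lintegral_congr_ae hpt, lintegral_const_mul' _ _ (ENNReal.inv_ne_top.2 hn0)]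
  have hcost : ∫⁻ ω, configCost p (fun i : Fin n => X i ω) Finset.univ (unitCubeMeasure d) ∂P =
      meanCost d p n := by
    rw [meanCost, ← hjoint, lintegral_map' (measurable_configCost hp _ _).aemeasurable
      (aemeasurable_pi_lambda (fun ω (i : Fin n) => X i ω) fun i => hm i)]
  rw [hcost, meanCost_eq (by linarith), ENNReal.ofReal_mul (by positivity), ENNReal.ofReal_natCast,
    ← mul_assoc, ENNReal.inv_mul_cancel hn0 (ENNReal.natCast_ne_top n), one_mul]

end Limit

/-! ### The multinomial law and its Poisson mixture. -/

section Multinomial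

open scoped Nat

variable {V : Type*} [DecidableEq V]

/-- The number of indices at which `y` takes each value. -/
def valueCounts {n : ℕ} (y : Fin n → V) (v : V) : ℕ := (Finset.univ.filter fun i => y i = v).card

theorem valueCounts_cons {n : ℕ} (v : V) (y : Fin n → V) :
    valueCounts (Fin.cons v y : Fin (n + 1) → V) = valueCounts y + Pi.single v 1 := by
  ext u
  simp only [valueCounts, Finset.card_filter, Fin.sum_univ_succ, Fin.cons_zero, Fin.cons_succ,
    Pi.add_apply, Pi.single_apply]
  rw [add_comm]
  congr 1
  simp [eq_comm]

variable [Fintype V]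

/-- The weight of a vector of counts in a Poisson family with intensities `q`. -/
noncomputable def countWeight (q : V → ℝ) (N : V → ℕ) : ℝ := ∏ v, q v ^ N v / (N v)!

theorem mul_countWeight_sub_single (q : V → ℝ) (N : V → ℕ) (v : V) (h : 1 ≤ N v) :
    q v * countWeight q (N - Pi.single v 1) = N v * countWeight q N := by
  obtain ⟨k, hk⟩ : ∃ k, N v = k + 1 := ⟨N v - 1, by omega⟩
  unfold countWeight
  rw [← Finset.mul_prod_erase _ _ (Finset.mem_univ v),
    ← Finset.mul_prod_erase (Finset.univ) (fun u => q u ^ N u / (N u)!) (Finset.mem_univ v)]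
  have : ∀ u ∈ Finset.univ.erase v, q u ^ (N - Pi.single v 1 : V → ℕ) u / ((N - Pi.single v 1 : V → ℕ) u)! =
      q u ^ N u / (N u)! := fun u hu => by
    simp [Finset.ne_of_mem_erase hu]
  rw [Finset.prod_congr rfl this]
  simp only [Pi.sub_apply, Pi.single_eq_same, hk, Nat.add_sub_cancel, Nat.factorial_succ]
  push_cast
  have : ((k ! : ℕ) : ℝ) ≠ 0 := by exact_mod_cast Nat.factorial_ne_zero k
  have : (k + 1 : ℝ) ≠ 0 := by positivity
  field_simp
  ring

/-- The multinomial distribution. -/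
theorem sum_prod_filter_valueCounts (q : V → ℝ) (n : ℕ) (N : V → ℕ) :
    ∑ y : Fin n → V, (if valueCounts y = N then ∏ i, q (y i) else 0) =
      if ∑ v, N v = n then n ! * countWeight q N else 0 := by
  induction n generalizing N with
  | zero =>
    have h0 : ∀ y : Fin 0 → V, valueCounts y = 0 := fun y => by ext v; simp [valueCounts]
    by_cases hN : N = 0
    · subst hN; simp [h0, countWeight]
    · have : ¬ ∑ v, N v = 0 := by
        intro h
        exact hN (funext fun v => (Finset.sum_eq_zero_iff.1 h) v (Finset.mem_univ v))
      rw [if_neg this]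
      exact Finset.sum_eq_zero fun y _ => by rw [h0, if_neg (Ne.symm hN)]
  | succ n ih =>
    rw [← (Fin.consEquiv fun _ : Fin (n + 1) => V).sum_comp, Fintype.sum_prod_type]
    have hstep : ∀ v, ∑ y : Fin n → V,
        (if valueCounts (Fin.consEquiv (fun _ : Fin (n + 1) => V) (v, y)) = N then
          ∏ i, q (Fin.consEquiv (fun _ : Fin (n + 1) => V) (v, y) i) else 0) =
        if ∑ v, N v = n + 1 then n ! * (N v * countWeight q N) else 0 := by
      intro v
      have e : ∀ y : Fin n → V, Fin.consEquiv (fun _ : Fin (n + 1) => V) (v, y) = Fin.cons v y :=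
        fun y => rfl
      simp only [e, valueCounts_cons, Fin.prod_univ_succ, Fin.cons_zero, Fin.cons_succ]
      -- If N v = 0 no sequence can start with v, and both sides vanish. Otherwise the truncated
      -- subtraction of one from N v is a genuine one.
      rcases Nat.eq_zero_or_pos (N v) with h0 | h1
      · rw [h0]
        simp only [Nat.cast_zero, zero_mul, mul_zero, ite_self]
        refine Finset.sum_eq_zero fun y _ => if_neg fun h => ?_
        have := congrFun h v
        simp [h0] at this
      · have hiff : ∀ y : Fin n → V, valueCounts y + Pi.single v 1 = N ↔
            valueCounts y = N - Pi.single v 1 := by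
          intro y
          simp only [funext_iff, Pi.add_apply, Pi.sub_apply, Pi.single_apply]
          refine forall_congr' fun u => ?_
          by_cases hu : u = v
          · subst hu; simp; omega
          · simp [hu]
        have hsum : ∑ u, (N - Pi.single v 1 : V → ℕ) u = n ↔ ∑ u, N u = n + 1 := by
          rw [← Finset.add_sum_erase _ _ (Finset.mem_univ v),
            ← Finset.add_sum_erase _ (fun u => N u) (Finset.mem_univ v)]
          have : ∀ u ∈ Finset.univ.erase v, (N - Pi.single v 1 : V → ℕ) u = N u := fun u hu => by
            simp [Finset.ne_of_mem_erase hu]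
          rw [Finset.sum_congr rfl this]
          simp only [Pi.sub_apply, Pi.single_eq_same]
          change N v - 1 + (Finset.univ.erase v).sum N = n ↔
            N v + (Finset.univ.erase v).sum N = n + 1
          omega
        have := ih (N - Pi.single v 1)
        simp only [hiff]
        rw [← mul_countWeight_sub_single q N v h1]
        calc _ = q v * ∑ y : Fin n → V, (if valueCounts y = N - Pi.single v 1 then
              ∏ i, q (y i) else 0) := by
              rw [Finset.mul_sum]; exact Finset.sum_congr rfl fun y _ => by rw [mul_ite, mul_zero]
          _ = _ := by
              rw [this]
              simp only [hsum]
              split_ifs <;> ring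
    rw [Finset.sum_congr rfl fun v _ => hstep v]
    split_ifs with h
    · rw [← Finset.mul_sum, ← Finset.sum_mul, ← Nat.cast_sum, h, Nat.factorial_succ]
      push_cast; ring
    · simp

variable [MeasurableSpace V] [MeasurableSingletonClass V]

theorem pi_valueCounts_eq (ρ : Measure V) [IsProbabilityMeasure ρ] (n : ℕ) (N : V → ℕ) :
    (Measure.pi fun _ : Fin n => ρ) {y | valueCounts y = N} =
      if ∑ v, N v = n then ENNReal.ofReal (n ! * countWeight (fun v => ρ.real {v}) N) else 0 := by
  have h1 : (Measure.pi fun _ : Fin n => ρ) {y | valueCounts y = N} =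
      ∑ y : Fin n → V, ENNReal.ofReal (if valueCounts y = N then ∏ i, ρ.real {y i} else 0) := by
    have : {y : Fin n → V | valueCounts y = N} =
        ((Finset.univ.filter fun y : Fin n → V => valueCounts y = N : Finset _) :
          Set (Fin n → V)) := by ext; simp
    rw [this, ← sum_measure_singleton, Finset.sum_filter]
    refine Finset.sum_congr rfl fun y _ => ?_
    split_ifs
    · rw [Measure.pi_singleton, ENNReal.ofReal_prod_of_nonneg fun i _ => measureReal_nonneg]
      exact Finset.prod_congr rfl fun i _ => (ofReal_measureReal (measure_ne_top _ _)).symm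
    · simp
  rw [h1, ← ENNReal.ofReal_sum_of_nonneg, sum_prod_filter_valueCounts (fun v => ρ.real {v}) n N]
  · split_ifs <;> simp
  · intro y _
    split_ifs
    · exact Finset.prod_nonneg fun i _ => measureReal_nonneg
    · exact le_rfl

/-- A Poisson number of independent points has independent Poisson counts. -/
theorem lintegral_poisson_valueCounts (ρ : Measure V) [IsProbabilityMeasure ρ] (r : NNReal)
    (g : (V → ℕ) → ℝ≥0∞) :
    ∫⁻ n, ∫⁻ y : Fin n → V, g (valueCounts y) ∂(Measure.pi fun _ => ρ) ∂(poissonMeasure r) =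
      ∫⁻ N, g N ∂(Measure.pi fun v => poissonMeasure (r * (ρ {v}).toNNReal)) := by
  have hin : ∀ n : ℕ, ∫⁻ y : Fin n → V, g (valueCounts y) ∂(Measure.pi fun _ => ρ) =
      ∑' N : V → ℕ, g N * (if ∑ v, N v = n then
        ENNReal.ofReal (n ! * countWeight (fun v => ρ.real {v}) N) else 0) := by
    intro n
    have hm : Measurable (valueCounts : (Fin n → V) → V → ℕ) := measurable_of_finite _
    rw [← lintegral_map (f := g) (measurable_of_countable g) hm, lintegral_countable']
    refine tsum_congr fun N => ?_
    rw [Measure.map_apply hm (measurableSet_singleton N), ← pi_valueCounts_eq]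
    rfl
  rw [lintegral_countable', lintegral_countable']
  simp_rw [hin, ← ENNReal.tsum_mul_right]
  rw [ENNReal.tsum_comm]
  refine tsum_congr fun N => ?_
  -- The counts determine the number of points, so a single n contributes. Its n! cancels the one in
  -- the Poisson weight, and the exponential factorises because the masses of ρ sum to 1.
  rw [tsum_eq_single (∑ v, N v)]
  · rw [if_pos rfl, mul_assoc]
    congr 1
    rw [Measure.pi_singleton, poissonMeasure_singleton]
    simp_rw [poissonMeasure_singleton]
    have hw : 0 ≤ countWeight (fun v => ρ.real {v}) N :=
      Finset.prod_nonneg fun v _ => by positivity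
    rw [← ENNReal.ofReal_mul (by positivity), ← ENNReal.ofReal_prod_of_nonneg fun v _ => by
      positivity]
    congr 1
    have hq : ∑ v, ρ.real {v} = 1 := by
      have := sum_measureReal_singleton (μ := ρ) Finset.univ
      rw [this]; simp
    have e1 : ∀ v, ((r * (ρ {v}).toNNReal : NNReal) : ℝ) = r * ρ.real {v} := fun v => by
      push_cast; rfl
    simp_rw [e1]
    have e2 : ∏ v, Real.exp (-((r : ℝ) * ρ.real {v})) = Real.exp (-r) := by
      rw [← Real.exp_sum, Finset.sum_neg_distrib, ← Finset.mul_sum, hq, mul_one]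
    have e3 : ∀ v, Real.exp (-((r : ℝ) * ρ.real {v})) * (r * ρ.real {v}) ^ N v / (N v)! =
        Real.exp (-((r : ℝ) * ρ.real {v})) * ((r : ℝ) ^ N v * (ρ.real {v} ^ N v / (N v)!)) :=
      fun v => by rw [mul_pow]; ring
    simp_rw [e3]
    rw [Finset.prod_mul_distrib, Finset.prod_mul_distrib, e2, Finset.prod_pow_eq_pow_sum,
      countWeight]
    have : (((∑ v, N v)! : ℕ) : ℝ) ≠ 0 := by exact_mod_cast Nat.factorial_ne_zero _
    field_simp
  · intro n hn
    rw [if_neg (Ne.symm hn)]; simp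

end Multinomial

/-! ### Approximation of the cost by functions of the counts in the cells of a grid. -/

section Discretization

variable {d : ℕ} {p L : ℝ}

/-- Size-biasing: n r^n / n! = r · r^(n-1) / (n-1)!, and the term n = 0 vanishes. -/
theorem lintegral_natCast_mul_poisson (r : NNReal) (g : ℕ → ℝ≥0∞) :
    ∫⁻ n, n * g n ∂(poissonMeasure r) = r * ∫⁻ n, g (n + 1) ∂(poissonMeasure r) := by
  rw [lintegral_countable', lintegral_countable', tsum_eq_zero_add' ENNReal.summable,
    ← ENNReal.tsum_mul_left]
  simp only [Nat.cast_zero, zero_mul, zero_add]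
  refine tsum_congr fun n => ?_
  rw [poissonMeasure_singleton, poissonMeasure_singleton, ← ENNReal.ofReal_natCast,
    ← ENNReal.ofReal_coe_nnreal]
  have e : ((n + 1 : ℕ) : ℝ) * (Real.exp (-r) * r ^ (n + 1) / (Nat.factorial (n + 1) : ℕ)) =
      r * (Real.exp (-r) * r ^ n / (Nat.factorial n : ℕ)) := by
    rw [Nat.factorial_succ]
    have : ((Nat.factorial n : ℕ) : ℝ) ≠ 0 := by exact_mod_cast Nat.factorial_ne_zero n
    push_cast
    have : (n + 1 : ℝ) ≠ 0 := by positivity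
    field_simp
    ring
  calc _ = g (n + 1) * ENNReal.ofReal (((n + 1 : ℕ) : ℝ) *
        (Real.exp (-r) * r ^ (n + 1) / (Nat.factorial (n + 1) : ℕ))) := by
        rw [ENNReal.ofReal_mul (by positivity)]; ring
    _ = _ := by rw [e, ENNReal.ofReal_mul (by positivity)]; ring

theorem lintegral_natCast_poisson (r : NNReal) :
    ∫⁻ n, (n : ℝ≥0∞) ∂(poissonMeasure r) = r := by
  have := lintegral_natCast_mul_poisson r fun _ => 1
  simpa using this

/-- The index of the cell of a grid of the cube `[0, L]^d` containing a point. -/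
noncomputable def cellIndex (L : ℝ) (k : ℕ) (x : EuclideanSpace ℝ (Fin d)) :
    Fin d → Fin (k + 2) :=
  fun i => ⟨min ⌊(k + 1) * x i / L⌋₊ (k + 1), by omega⟩

/-- The corner of a cell of a grid of the cube `[0, L]^d`. -/
noncomputable def cellPoint (L : ℝ) (k : ℕ) (v : Fin d → Fin (k + 2)) :
    EuclideanSpace ℝ (Fin d) :=
  WithLp.toLp 2 fun i => (v i : ℕ) * (L / (k + 1))

theorem measurable_cellIndex (L : ℝ) (k : ℕ) :
    Measurable (cellIndex L k : EuclideanSpace ℝ (Fin d) → _) := by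
  refine measurable_pi_lambda _ fun i => ?_
  have h1 : Measurable fun x : EuclideanSpace ℝ (Fin d) => ⌊(k + 1) * x i / L⌋₊ :=
    Nat.measurable_floor.comp (by fun_prop)
  have h2 : Measurable fun j : ℕ => (⟨min j (k + 1), by omega⟩ : Fin (k + 2)) :=
    measurable_of_countable _
  exact h2.comp h1

theorem cellPoint_mem_cube (hL : 0 < L) (k : ℕ) (v : Fin d → Fin (k + 2)) :
    cellPoint L k v ∈ cube d L := by
  intro i
  have h : ((v i : ℕ) : ℝ) ≤ k + 1 := by exact_mod_cast Nat.le_of_lt_succ (v i).2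
  simp only [cellPoint, Set.mem_Icc]
  refine ⟨by positivity, ?_⟩
  calc _ ≤ (k + 1 : ℝ) * (L / (k + 1)) := by gcongr
    _ = L := by field_simp

/-- Each coordinate is rounded down by at most L/(k+1). The extra index value k + 1 serves the face
where a coordinate equals L, and the truncation in `cellIndex` is inactive on the cube. -/
theorem edist_cellPoint_le (hL : 0 < L) (k : ℕ) {x : EuclideanSpace ℝ (Fin d)}
    (hx : x ∈ cube d L) :
    edist x (cellPoint L k (cellIndex L k x)) ≤ ENNReal.ofReal (d * (L / (k + 1))) := by
  refine (edist_le_sum _ _).trans ?_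
  rw [ENNReal.ofReal_mul (by positivity), ENNReal.ofReal_natCast]
  calc _ ≤ ∑ _i : Fin d, ENNReal.ofReal (L / (k + 1)) := by
        refine Finset.sum_le_sum fun i _ => ENNReal.ofReal_le_ofReal ?_
        obtain ⟨h0, h1⟩ := hx i
        simp only [cellPoint, cellIndex]
        have hy0 : 0 ≤ (k + 1) * x i / L := by positivity
        have hy1 : (k + 1) * x i / L ≤ (k + 1 : ℕ) := by
          rw [div_le_iff₀ hL]; push_cast; gcongr
        have hmin : min ⌊(k + 1) * x i / L⌋₊ (k + 1) = ⌊(k + 1) * x i / L⌋₊ :=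
          min_eq_left (Nat.floor_le_of_le hy1)
        rw [hmin]
        have hf1 := Nat.floor_le hy0
        have hf2 := Nat.lt_floor_add_one ((k + 1) * x i / L)
        have e : x i = (k + 1) * x i / L * (L / (k + 1)) := by field_simp
        have hq : 0 < L / (k + 1) := by positivity
        rw [abs_le]
        constructor <;> nlinarith
    _ = _ := by simp

theorem edist_le_mul_of_mem_cube {x y : EuclideanSpace ℝ (Fin d)}
    (hx : x ∈ cube d L) (hy : y ∈ cube d L) : edist x y ≤ ENNReal.ofReal (d * L) := by
  refine (edist_le_sum x y).trans ?_
  rw [ENNReal.ofReal_mul (by positivity), ENNReal.ofReal_natCast]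
  calc _ ≤ ∑ _ : Fin d, ENNReal.ofReal L := by
        refine Finset.sum_le_sum fun i _ => ENNReal.ofReal_le_ofReal ?_
        have := hx i; have := hy i
        simp only [Set.mem_Icc] at *
        rw [abs_le]; constructor <;> linarith
    _ = _ := by simp

theorem ae_unifBox_mem_cube (hL : 0 < L) :
    ∀ᵐ x ∂(unifBox (fun _ : Fin d => 0) fun _ => L), x ∈ cube d L := by
  have h := ae_restrict_mem (μ := volume) (measurableSet_cube d L)
  rw [volume_restrict_cube hL] at h
  have h2 := Measure.ae_smul_measure h (ENNReal.ofReal (L ^ d))⁻¹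
  rwa [smul_smul, ENNReal.inv_mul_cancel (by simpa using pow_pos hL d) ENNReal.ofReal_ne_top,
    one_smul] at h2

/-- The cost of transporting a finite measure to the uniform density on `[0, L]^d`. -/
noncomputable def uniformCost (p L : ℝ) (m : Measure (EuclideanSpace ℝ (Fin d))) : ℝ≥0∞ :=
  transportCost p m (m Set.univ • unifBox (fun _ => 0) fun _ => L)

/-- The cost of transporting masses at the corners of a grid to the uniform density. -/
noncomputable def gridCost (p L : ℝ) (k : ℕ) (N : (Fin d → Fin (k + 2)) → ℕ) : ℝ≥0∞ :=
  transportCost p (∑ v, (N v : ℝ≥0∞) • Measure.dirac (cellPoint L k v))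
    (((∑ v, N v : ℕ) : ℝ≥0∞) • unifBox (fun _ => 0) fun _ => L)

theorem sum_natCast_smul_dirac_univ {E V : Type*} [MeasurableSpace E] [Fintype V] (N : V → ℕ)
    (z : V → E) : (∑ v, (N v : ℝ≥0∞) • Measure.dirac (z v)) Set.univ = (∑ v, N v : ℕ) := by
  simp [Measure.finsetSum_apply]

theorem gridCost_le (hp : 0 ≤ p) (hL : 0 < L) (k : ℕ) (N : (Fin d → Fin (k + 2)) → ℕ) :
    gridCost p L k N ≤ (∑ v, N v : ℕ) * ENNReal.ofReal (d * L) ^ p := by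
  have := natCast_smul_isFiniteMeasure (∑ v, N v) (unifBox (fun _ : Fin d => 0) fun _ => L)
  have hu := sum_natCast_smul_dirac_univ N (cellPoint L k)
  have : IsFiniteMeasure (∑ v, (N v : ℝ≥0∞) • Measure.dirac (cellPoint L k v)) :=
    ⟨by rw [hu]; exact ENNReal.natCast_lt_top _⟩
  refine (transportCost_le_of_bounded hp (S := cube d L) (S' := cube d L) ?_ ?_ ?_
    fun x hx y hy => edist_le_mul_of_mem_cube hx hy).trans_eq ?_
  · rw [hu]; simp
  · rw [ae_iff, Measure.finsetSum_apply]
    refine Finset.sum_eq_zero fun v _ => ?_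
    rw [Measure.smul_apply]
    change _ • Measure.dirac (cellPoint L k v) (cube d L)ᶜ = 0
    rw [Measure.dirac_apply' _ (measurableSet_cube d L).compl]
    simp [cellPoint_mem_cube hL]
  · exact Measure.ae_smul_measure (ae_unifBox_mem_cube hL) _
  · rw [hu]

theorem map_eq_sum_smul_dirac {E V : Type*} [MeasurableSpace E] [Fintype V] [MeasurableSpace V]
    [MeasurableSingletonClass V] {m : Measure E} {c : E → V} (hc : Measurable c) {F : Type*}
    [MeasurableSpace F] (z : V → F) :
    m.map (fun x => z (c x)) = ∑ v, m (c ⁻¹' {v}) • Measure.dirac (z v) := by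
  have hz : Measurable z := measurable_of_countable z
  ext s hs
  rw [Measure.map_apply (f := fun x => z (c x)) (hz.comp hc) hs, Measure.finsetSum_apply]
  have h1 : (fun x => z (c x)) ⁻¹' s = c ⁻¹' (z ⁻¹' s) := rfl
  rw [h1, ← Measure.map_apply hc (hz hs)]
  conv_lhs => rw [← Measure.sum_smul_dirac (m.map c), Measure.sum_fintype,
    Measure.finsetSum_apply]
  refine Finset.sum_congr rfl fun v _ => ?_
  rw [Measure.smul_apply, Measure.smul_apply, Measure.map_apply hc (measurableSet_singleton v),
    Measure.dirac_apply' _ (hz hs), Measure.dirac_apply' _ hs]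
  rfl

theorem measure_univ_eq_of_cells {E V : Type*} [MeasurableSpace E] [Fintype V] [MeasurableSpace V]
    [MeasurableSingletonClass V] {m : Measure E} {c : E → V} (hc : Measurable c) {N : V → ℕ}
    (hN : ∀ v, m (c ⁻¹' {v}) = N v) : m Set.univ = (∑ v, N v : ℕ) := by
  have h := congrArg (fun μ => μ Set.univ) (map_eq_sum_smul_dirac (m := m) hc id)
  simp only [hN] at h
  rw [sum_natCast_smul_dirac_univ, 
    Measure.map_apply (f := fun x => id (c x)) (measurable_id.comp hc) MeasurableSet.univ] at h
  simpa using h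

theorem uniformCost_ne_top (hp : 0 ≤ p) (hL : 0 < L) {m : Measure (EuclideanSpace ℝ (Fin d))}
    [IsFiniteMeasure m] (hm : ∀ᵐ x ∂m, x ∈ cube d L) : uniformCost p L m ≠ ∞ := by
  have : IsFiniteMeasure (m Set.univ • unifBox (fun _ : Fin d => 0) fun _ => L) :=
    ⟨by simp [measure_lt_top]⟩
  refine ne_top_of_le_ne_top ?_ (transportCost_le_of_bounded hp (by simp) hm
    (Measure.ae_smul_measure (ae_unifBox_mem_cube hL) _)
    fun x hx y hy => edist_le_mul_of_mem_cube hx hy)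
  exact ENNReal.mul_ne_top (measure_ne_top _ _)
    (ENNReal.rpow_ne_top_of_nonneg hp ENNReal.ofReal_ne_top)

/-- Moving every point to the corner of its cell costs at most the total mass times (dL/(k+1))^p.
The triangle inequality, used in both directions, shows that the p-th roots of the two costs differ
by a vanishing amount. -/
theorem tendsto_gridCost (hp : 1 ≤ p) (hL : 0 < L) {m : Measure (EuclideanSpace ℝ (Fin d))}
    (hm : ∀ᵐ x ∂m, x ∈ cube d L) {N : ∀ k, (Fin d → Fin (k + 2)) → ℕ}
    (hN : ∀ k v, m (cellIndex L k ⁻¹' {v}) = N k v) :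
    Tendsto (fun k => gridCost p L k (N k)) atTop (𝓝 (uniformCost p L m)) := by
  have hp0 : 0 < p := by linarith
  have huniv : ∀ k, m Set.univ = (∑ v, N k v : ℕ) := fun k =>
    measure_univ_eq_of_cells (measurable_cellIndex L k) (hN k)
  have : IsFiniteMeasure m := ⟨by rw [huniv 0]; exact ENNReal.natCast_lt_top _⟩
  set f : ℕ → EuclideanSpace ℝ (Fin d) → EuclideanSpace ℝ (Fin d) :=
    fun k x => cellPoint L k (cellIndex L k x)
  have hf : ∀ k, Measurable (f k) := fun k =>
    (measurable_of_countable (cellPoint L k)).comp (measurable_cellIndex L k)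
  have hg : ∀ k, gridCost p L k (N k) =
      transportCost p (m.map (f k)) (m Set.univ • unifBox (fun _ => 0) fun _ => L) := fun k => by
    rw [gridCost, map_eq_sum_smul_dirac (measurable_cellIndex L k), huniv k]
    simp only [hN]
  set η : ℕ → ℝ≥0∞ := fun k => (m Set.univ * ENNReal.ofReal (d * (L / (k + 1))) ^ p) ^ (1 / p)
  have hη : Tendsto η atTop (𝓝 0) := by
    have h1 : Tendsto (fun k : ℕ => (d : ℝ) * (L / (k + 1))) atTop (𝓝 (d * 0)) :=
      (tendsto_const_div_atTop_nhds_zero_nat L |>.comp (tendsto_add_atTop_nat 1)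
        |>.congr fun k => by simp).const_mul _
    have h2 := ENNReal.tendsto_ofReal h1
    have h3 := (ENNReal.continuous_rpow_const (y := p)).tendsto _ |>.comp h2
    have h4 := ENNReal.Tendsto.const_mul h3 (a := m Set.univ) (Or.inr (measure_ne_top _ _))
    have h5 := (ENNReal.continuous_rpow_const (y := 1 / p)).tendsto _ |>.comp h4
    have h6 : Tendsto η atTop (𝓝 ((m Set.univ * ENNReal.ofReal ((d : ℝ) * 0) ^ p) ^ (1 / p))) := h5
    have e : (m Set.univ * ENNReal.ofReal ((d : ℝ) * 0) ^ p) ^ (1 / p) = 0 := by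
      rw [mul_zero, ENNReal.ofReal_zero, ENNReal.zero_rpow_of_pos hp0, mul_zero,
        ENNReal.zero_rpow_of_pos (by positivity)]
    rwa [e] at h6
  have hint : ∀ k, ∫⁻ x, edist x (f k x) ^ p ∂m ≤
      m Set.univ * ENNReal.ofReal (d * (L / (k + 1))) ^ p := fun k => by
    calc _ ≤ ∫⁻ _, ENNReal.ofReal (d * (L / (k + 1))) ^ p ∂m := by
          refine lintegral_mono_ae ?_
          filter_upwards [hm] with x hx
          exact ENNReal.rpow_le_rpow (edist_cellPoint_le hL k hx) hp0.le
      _ = _ := by rw [lintegral_const, mul_comm]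
  have hc1 : ∀ k, transportCost p m (m.map (f k)) ^ (1 / p) ≤ η k := fun k => by
    refine ENNReal.rpow_le_rpow ?_ (by positivity)
    have := transportCost_map_map_le (p := p) m measurable_id (hf k)
    rw [Measure.map_id] at this
    exact this.trans (hint k)
  have hc2 : ∀ k, transportCost p (m.map (f k)) m ^ (1 / p) ≤ η k := fun k => by
    refine ENNReal.rpow_le_rpow ?_ (by positivity)
    have := transportCost_map_map_le (p := p) m (hf k) measurable_id
    rw [Measure.map_id] at this
    refine this.trans (le_trans (le_of_eq ?_) (hint k))
    exact lintegral_congr fun x => by rw [edist_comm]; rfl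
  have hroot : Tendsto (fun k => gridCost p L k (N k) ^ (1 / p)) atTop
      (𝓝 (uniformCost p L m ^ (1 / p))) := by
    have hfin : uniformCost p L m ^ (1 / p) ≠ ∞ :=
      ENNReal.rpow_ne_top_of_nonneg (by positivity) (uniformCost_ne_top hp0.le hL hm)
    have t1 : Tendsto (fun k => uniformCost p L m ^ (1 / p) - η k) atTop
        (𝓝 (uniformCost p L m ^ (1 / p) - 0)) :=
      ENNReal.Tendsto.sub tendsto_const_nhds hη (Or.inl hfin)
    have t2 : Tendsto (fun k => η k + uniformCost p L m ^ (1 / p)) atTop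
        (𝓝 (0 + uniformCost p L m ^ (1 / p))) := hη.add tendsto_const_nhds
    rw [tsub_zero] at t1
    rw [zero_add] at t2
    refine tendsto_of_tendsto_of_tendsto_of_le_of_le t1 t2 (fun k => ?_) fun k => ?_
    · rw [tsub_le_iff_left, hg]
      exact (transportCost_triangle (ν := m.map (f k)) hp).trans
        (add_le_add (hc1 k) le_rfl)
    · simp only
      rw [hg]
      exact (transportCost_triangle (ν := m) hp).trans (add_le_add (hc2 k) le_rfl)
  have hpow := (ENNReal.continuous_rpow_const (y := p)).tendsto _ |>.comp hroot
  have hcancel : ∀ y : ℝ≥0∞, (y ^ (1 / p)) ^ p = y := fun y => by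
    rw [← ENNReal.rpow_mul, one_div_mul_cancel hp0.ne', ENNReal.rpow_one]
  rw [hcancel] at hpow
  exact hpow.congr fun k => hcancel _

/-- The mean transport cost of a random point measure is determined by its counts in the cells of
the grids. -/
theorem tendsto_lintegral_gridCost (hp : 1 ≤ p) (hL : 0 < L) {Ω : Type*} [MeasurableSpace Ω]
    {P : Measure Ω} {m : Ω → Measure (EuclideanSpace ℝ (Fin d))}
    (hm : ∀ᵐ ω ∂P, ∀ᵐ x ∂(m ω), x ∈ cube d L) {N : ∀ k, Ω → (Fin d → Fin (k + 2)) → ℕ}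
    (hN : ∀ᵐ ω ∂P, ∀ k v, m ω (cellIndex L k ⁻¹' {v}) = N k ω v)
    (hNm : ∀ k, AEMeasurable (N k) P) (hfin : ∫⁻ ω, m ω Set.univ ∂P ≠ ∞) :
    Tendsto (fun k => ∫⁻ ω, gridCost p L k (N k ω) ∂P) atTop
      (𝓝 (∫⁻ ω, uniformCost p L (m ω) ∂P)) := by
  -- Only the grid costs, functions on a countable type, need to be measurable; no measurability of
  -- the cost of the random measure itself is required.
  refine tendsto_lintegral_of_dominated_convergence'
    (fun ω => m ω Set.univ * ENNReal.ofReal (d * L) ^ p) (fun k => ?_) (fun k => ?_) ?_ ?_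
  · exact (measurable_of_countable (gridCost p L k)).comp_aemeasurable (hNm k)
  · filter_upwards [hN] with ω h
    rw [measure_univ_eq_of_cells (measurable_cellIndex L k) (h k)]
    exact gridCost_le (by linarith) hL k _
  · have h := ENNReal.rpow_ne_top_of_nonneg (by linarith : 0 ≤ p)
      (ENNReal.ofReal_ne_top (r := d * L))
    rw [lintegral_mul_const' _ _ h]
    exact ENNReal.mul_ne_top hfin h
  · filter_upwards [hm, hN] with ω h1 h2
    exact tendsto_gridCost hp hL h1 h2

end Discretization

/-! ### The Poisson process as a mixture of independent uniform points, as far as the cost is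
concerned. -/

section PoissonFormula

variable {d : ℕ} {p L : ℝ}

theorem sum_dirac_apply_preimage {E V : Type*} [MeasurableSpace E] [MeasurableSpace V]
    [MeasurableSingletonClass V] [DecidableEq V] {c : E → V} (hc : Measurable c) {n : ℕ}
    (x : Fin n → E) (v : V) :
    (∑ i, Measure.dirac (x i)) (c ⁻¹' {v}) = valueCounts (fun i => c (x i)) v := by
  rw [Measure.finsetSum_apply, valueCounts, Finset.card_filter, Nat.cast_sum]
  refine Finset.sum_congr rfl fun i _ => ?_
  rw [Measure.dirac_apply' _ (hc (measurableSet_singleton v))]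
  by_cases h : c (x i) = v <;> simp [h]

theorem tendsto_lintegral_gridCost_valueCounts (hp : 1 ≤ p) (hL : 0 < L) (n : ℕ) :
    Tendsto (fun k => ∫⁻ y : Fin n → Fin d → Fin (k + 2), gridCost p L k (valueCounts y)
      ∂(Measure.pi fun _ => (unifBox (fun _ => 0) fun _ => L).map (cellIndex L k))) atTop
      (𝓝 (ENNReal.ofReal L ^ p * meanCost d p n)) := by
  have hmem : ∀ᵐ x ∂(Measure.pi fun _ : Fin n => unifBox (fun _ : Fin d => 0) fun _ => L),
      ∀ᵐ y ∂(∑ i, Measure.dirac (x i)), y ∈ cube d L := by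
    have h1 : ∀ᵐ x ∂(Measure.pi fun _ : Fin n => unifBox (fun _ : Fin d => 0) fun _ => L),
        ∀ i, x i ∈ cube d L := ae_all_iff.2 fun i =>
      (measurePreserving_eval (fun _ : Fin n => unifBox (fun _ : Fin d => 0) fun _ => L)
        i).quasiMeasurePreserving.ae (ae_unifBox_mem_cube hL)
    filter_upwards [h1] with x hx
    rw [ae_iff, Measure.finsetSum_apply]
    refine Finset.sum_eq_zero fun i _ => ?_
    change Measure.dirac (x i) (cube d L)ᶜ = 0
    rw [Measure.dirac_apply' _ (measurableSet_cube d L).compl]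
    simp [hx i]
  have hmeas : ∀ k, Measurable fun (x : Fin n → EuclideanSpace ℝ (Fin d)) i =>
      cellIndex L k (x i) := fun k =>
    measurable_pi_lambda _ fun i => (measurable_cellIndex L k).comp (measurable_pi_apply i)
  have hvc : ∀ k, Measurable (valueCounts : (Fin n → Fin d → Fin (k + 2)) → _) := fun k =>
    measurable_of_finite _
  have h := tendsto_lintegral_gridCost hp hL hmem
    (N := fun k x => valueCounts fun i => cellIndex L k (x i))
    (ae_of_all _ fun x k v => sum_dirac_apply_preimage (measurable_cellIndex L k) x v)
    (fun k => ((hvc k).comp (hmeas k)).aemeasurable)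
    (by simp [Measure.finsetSum_apply])
  have hlim := lintegral_configCost_unifBox (ι := Fin n) hp (fun _ : Fin d => 0) hL
  rw [Fintype.card_fin] at hlim
  rw [← hlim]
  have e : ∀ x : Fin n → EuclideanSpace ℝ (Fin d), uniformCost p L (∑ i, Measure.dirac (x i)) =
      configCost p x Finset.univ (unifBox (fun _ => 0) fun _ => L) := fun x => by
    simp [uniformCost, configCost, Measure.finsetSum_apply]
  simp_rw [e] at h
  refine h.congr fun k => ?_
  have := fun _ : Fin n => Measure.isProbabilityMeasure_map
    (μ := unifBox (fun _ : Fin d => 0) fun _ => L) (measurable_cellIndex L k).aemeasurable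
  rw [← Measure.pi_map_pi fun i => (measurable_cellIndex L k).aemeasurable,
    lintegral_map (f := fun y => gridCost p L k (valueCounts y))
      ((measurable_of_countable (gridCost p L k)).comp (hvc k)) (hmeas k)]

/-- A product of Poisson laws on the cells is the law of the counts of a Poisson number of uniform
points. The limit for each fixed number n passes through the average by domination with n (dL)^p, as
the Poisson law has finite mean. -/
theorem tendsto_lintegral_gridCost_poisson (hp : 1 ≤ p) (hL : 0 < L) (r : NNReal) :
    Tendsto (fun k => ∫⁻ N, gridCost p L k N ∂(Measure.pi fun v => poissonMeasure
      (r * ((unifBox (fun _ : Fin d => 0) fun _ => L).map (cellIndex L k) {v}).toNNReal))) atTop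
      (𝓝 (ENNReal.ofReal L ^ p * ∫⁻ n, meanCost d p n ∂(poissonMeasure r))) := by
  have hprob : ∀ k, IsProbabilityMeasure
      ((unifBox (fun _ : Fin d => 0) fun _ => L).map (cellIndex L k)) := fun k =>
    Measure.isProbabilityMeasure_map (measurable_cellIndex L k).aemeasurable
  have hfin := ENNReal.rpow_ne_top_of_nonneg (by linarith : 0 ≤ p)
    (ENNReal.ofReal_ne_top (r := d * L))
  rw [← lintegral_const_mul _ (measurable_of_countable _)]
  simp_rw [← lintegral_poisson_valueCounts]
  refine tendsto_lintegral_of_dominated_convergence (fun n => n * ENNReal.ofReal (d * L) ^ p)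
    (fun k => measurable_of_countable _) (fun k => ae_of_all _ fun n => ?_) ?_
    (ae_of_all _ fun n => tendsto_lintegral_gridCost_valueCounts hp hL n)
  · calc _ ≤ ∫⁻ _ : Fin n → Fin d → Fin (k + 2), n * ENNReal.ofReal (d * L) ^ p
          ∂(Measure.pi fun _ => (unifBox (fun _ => 0) fun _ => L).map (cellIndex L k)) := by
          refine lintegral_mono fun y => (gridCost_le (by linarith) hL k _).trans_eq ?_
          congr 2
          have := Finset.card_eq_sum_card_fiberwise (f := y) (s := Finset.univ)
            (t := Finset.univ) (by simp)
          simp only [valueCounts]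
          rw [← this]; simp
      _ = _ := by simp
  · rw [lintegral_mul_const' _ _ hfin, lintegral_natCast_poisson]
    exact ENNReal.mul_ne_top ENNReal.coe_ne_top hfin

/-- The counts take values in [0, ∞], and the floor of the real part inverts the cast from ℕ on its
range. Passing to ℕ puts families of counts in a countable space, where every function is
measurable. -/
theorem floor_hasLaw_poisson {Ω : Type*} [MeasurableSpace Ω] {P : Measure Ω} {X : Ω → ℝ≥0∞}
    {r : NNReal} (h : HasLaw X ((poissonMeasure r).map (Nat.cast : ℕ → ℝ≥0∞)) P) :
    HasLaw (fun ω => ⌊(X ω).toReal⌋₊) (poissonMeasure r) P := by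
  have hY : Measurable fun t : ℝ≥0∞ => ⌊t.toReal⌋₊ :=
    Nat.measurable_floor.comp ENNReal.measurable_toReal
  have hY' : HasLaw (fun t : ℝ≥0∞ => ⌊t.toReal⌋₊) (poissonMeasure r)
      ((poissonMeasure r).map (Nat.cast : ℕ → ℝ≥0∞)) := by
    refine ⟨hY.aemeasurable, ?_⟩
    rw [Measure.map_map hY (measurable_of_countable _)]
    have : (fun t : ℝ≥0∞ => ⌊t.toReal⌋₊) ∘ (Nat.cast : ℕ → ℝ≥0∞) = id := by
      ext n; simp
    rw [this, Measure.map_id]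
  exact hY'.comp h

theorem ae_eq_floor_of_hasLaw_poisson {Ω : Type*} [MeasurableSpace Ω] {P : Measure Ω}
    {X : Ω → ℝ≥0∞} {r : NNReal}
    (h : HasLaw X ((poissonMeasure r).map (Nat.cast : ℕ → ℝ≥0∞)) P) :
    ∀ᵐ ω ∂P, X ω = ⌊(X ω).toReal⌋₊ := by
  have hr : MeasurableSet (Set.range (Nat.cast : ℕ → ℝ≥0∞)) := (Set.countable_range _).measurableSet
  have h1 : ∀ᵐ t ∂((poissonMeasure r).map (Nat.cast : ℕ → ℝ≥0∞)),
      t ∈ Set.range (Nat.cast : ℕ → ℝ≥0∞) := by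
    exact (ae_map_iff (measurable_of_countable _).aemeasurable hr).2 (ae_of_all _ fun n => ⟨n, rfl⟩)
  filter_upwards [(h.ae_iff (p := fun t => t ∈ Set.range (Nat.cast : ℕ → ℝ≥0∞))
    (measurable_mem.2 hr)).2 h1] with ω hω
  obtain ⟨n, hn⟩ := hω
  rw [← hn]; simp

/-- The cost for the Poisson process is a Poisson mixture of the costs for independent points. -/
theorem fRef_eq (hp : 1 ≤ p) (hL : 0 < L) {Ω : Type*} [MeasurableSpace Ω] (P : Measure Ω)
    [IsProbabilityMeasure P] (μ : Ω → Measure (EuclideanSpace ℝ (Fin d)))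
    (hμ : IsPoissonPointProcess μ P) :
    fRef p μ P L = (ENNReal.ofReal (L ^ d))⁻¹ *
      (ENNReal.ofReal L ^ p * ∫⁻ n, meanCost d p n ∂(poissonMeasure (L ^ d).toNNReal)) := by
  have hLd : 0 < L ^ d := pow_pos hL d
  have hv0 : ENNReal.ofReal (L ^ d) ≠ 0 := by simpa using hLd
  have hvt : ENNReal.ofReal (L ^ d) ≠ ∞ := ENNReal.ofReal_ne_top
  have hvol := volume_cube (d := d) hL
  -- The cells are cut to the cube because `cellIndex` also assigns indices to points outside. The
  -- volumes become finite and the counts are those of the restricted process.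
  set A : ∀ k, (Fin d → Fin (k + 2)) → Set (EuclideanSpace ℝ (Fin d)) :=
    fun k v => cellIndex L k ⁻¹' {v} ∩ cube d L
  have hA : ∀ k v, MeasurableSet (A k v) := fun k v =>
    (measurable_cellIndex L k (measurableSet_singleton v)).inter (measurableSet_cube d L)
  have hAv : ∀ k v, volume (A k v) = ENNReal.ofReal (L ^ d) *
      (unifBox (fun _ : Fin d => 0) fun _ => L).map (cellIndex L k) {v} := fun k v => by
    rw [Measure.map_apply (measurable_cellIndex L k) (measurableSet_singleton v),
      ← Measure.restrict_apply (measurable_cellIndex L k (measurableSet_singleton v)),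
      volume_restrict_cube hL]
    rfl
  have hprob : ∀ k, IsProbabilityMeasure
      ((unifBox (fun _ : Fin d => 0) fun _ => L).map (cellIndex L k)) := fun k =>
    Measure.isProbabilityMeasure_map (measurable_cellIndex L k).aemeasurable
  have hlaw : ∀ k v, HasLaw (fun ω => μ ω (A k v)) ((poissonMeasure ((L ^ d).toNNReal *
      ((unifBox (fun _ : Fin d => 0) fun _ => L).map (cellIndex L k) {v}).toNNReal)).map
        (Nat.cast : ℕ → ℝ≥0∞)) P := fun k v => by
    have h := hμ.law (A k v) (hA k v) (by
      rw [hAv]; exact ENNReal.mul_ne_top hvt (measure_ne_top _ _))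
    rwa [hAv, ENNReal.toNNReal_mul] at h
  set N : ∀ k, Ω → (Fin d → Fin (k + 2)) → ℕ := fun k ω v => ⌊(μ ω (A k v)).toReal⌋₊
  have hNlaw : ∀ k, HasLaw (N k) (Measure.pi fun v => poissonMeasure ((L ^ d).toNNReal *
      ((unifBox (fun _ : Fin d => 0) fun _ => L).map (cellIndex L k) {v}).toNNReal)) P := fun k => by
    refine iIndepFun.hasLaw_pi (fun v => floor_hasLaw_poisson (hlaw k v)) ?_
    have e := Fintype.equivFin (Fin d → Fin (k + 2))
    have h := (hμ.indep _ (fun i => A k (e.symm i)) (fun i => hA k _) fun i j hij => by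
      refine Set.disjoint_left.2 fun x hx hx' => hij (e.symm.injective ?_)
      exact hx.1.symm.trans hx'.1).precomp e.injective
    have h2 := h.comp (fun _ (t : ℝ≥0∞) => ⌊t.toReal⌋₊) fun _ =>
      Nat.measurable_floor.comp ENNReal.measurable_toReal
    convert h2 using 2 with v
    ext ω
    simp
  have huniv : ∀ ω, (μ ω).restrict (cube d L) Set.univ = μ ω (cube d L) := fun ω => by simp
  have hint : ∫⁻ ω, (μ ω).restrict (cube d L) Set.univ ∂P ≠ ∞ := by
    simp_rw [huniv]
    rw [(hμ.law (cube d L) (measurableSet_cube d L) (by rw [hvol]; exact hvt)).lintegral_comp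
      (f := fun t => t) aemeasurable_id, lintegral_map (f := fun t => t) measurable_id (measurable_of_countable _)]
    simp [lintegral_natCast_poisson]
  have h1 := tendsto_lintegral_gridCost hp hL (P := P) (m := fun ω => (μ ω).restrict (cube d L))
    (ae_of_all _ fun ω => ae_restrict_mem (measurableSet_cube d L)) (N := N)
    (by
      rw [ae_all_iff]; intro k
      rw [ae_all_iff]; intro v
      filter_upwards [ae_eq_floor_of_hasLaw_poisson (hlaw k v)] with ω hω
      rw [Measure.restrict_apply (measurable_cellIndex L k (measurableSet_singleton v))]
      exact hω)
    (fun k => (hNlaw k).aemeasurable) hint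
  have h2 := tendsto_lintegral_gridCost_poisson (d := d) hp hL (L ^ d).toNNReal
  have h3 : ∫⁻ ω, uniformCost p L ((μ ω).restrict (cube d L)) ∂P =
      ENNReal.ofReal L ^ p * ∫⁻ n, meanCost d p n ∂(poissonMeasure (L ^ d).toNNReal) := by
    -- For every k both grid costs integrate the same function against the same law of counts, so
    -- the limits agree.
    refine tendsto_nhds_unique (h1.congr fun k => ?_) h2
    exact (hNlaw k).lintegral_comp (measurable_of_countable (gridCost p L k)).aemeasurable
  rw [← h3, ← lintegral_const_mul' _ _ (ENNReal.inv_ne_top.2 hv0), fRef, hvol]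
  refine lintegral_congr fun ω => ?_
  rw [transportCostOn, uniformCost, Measure.restrict_smul, volume_restrict_cube hL, smul_smul,
    ENNReal.div_mul_cancel hv0 hvt, huniv]

end PoissonFormula

/-! ### Poisson tails and the passage from the sequence to its Poisson averages. -/

section PoissonAverage

theorem lintegral_pow_poisson (r t : NNReal) :
    ∫⁻ n, ENNReal.ofReal ((t : ℝ) ^ n) ∂(poissonMeasure r) =
      ENNReal.ofReal (Real.exp (r * (t - 1))) := by
  have h : ∑' n : ℕ, poissonMeasure (r * t) {n} = 1 := by
    have := lintegral_countable' (μ := poissonMeasure (r * t)) fun _ => 1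
    simpa using this.symm
  rw [lintegral_countable', ← mul_one (ENNReal.ofReal (Real.exp (r * (t - 1)))), ← h,
    ← ENNReal.tsum_mul_left]
  refine tsum_congr fun n => ?_
  rw [poissonMeasure_singleton, poissonMeasure_singleton, ← ENNReal.ofReal_mul (by positivity),
    ← ENNReal.ofReal_mul (by positivity)]
  congr 1
  have : Real.exp (-r) = Real.exp (r * (t - 1)) * Real.exp (-(r * t)) := by
    rw [← Real.exp_add]; congr 1; ring
  rw [this]
  push_cast
  ring

/-- The Chernoff bound for the Poisson distribution. -/
theorem poissonMeasure_le_exp (r : NNReal) {t K : ℝ} (ht : 0 < t) {S : Set ℕ}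
    (hS : ∀ n ∈ S, K * Real.log t ≤ n * Real.log t) :
    poissonMeasure r S ≤ ENNReal.ofReal (Real.exp (r * (t - 1) - K * Real.log t)) := by
  calc poissonMeasure r S = ∫⁻ n, S.indicator 1 n ∂(poissonMeasure r) :=
        (lintegral_indicator_one (MeasurableSet.of_discrete)).symm
    _ ≤ ∫⁻ n, ENNReal.ofReal (Real.exp (-(K * Real.log t))) *
          ENNReal.ofReal ((t.toNNReal : ℝ) ^ n) ∂(poissonMeasure r) := by
        refine lintegral_mono fun n => ?_
        by_cases hn : n ∈ S
        · rw [Set.indicator_of_mem hn, Pi.one_apply, ← ENNReal.ofReal_mul (by positivity),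
            Real.coe_toNNReal _ ht.le]
          refine ENNReal.one_le_ofReal.2 ?_
          rw [← Real.exp_log (pow_pos ht n), Real.log_pow, ← Real.exp_add]
          exact Real.one_le_exp (by linarith [hS n hn])
        · rw [Set.indicator_of_notMem hn]; exact zero_le
    _ = _ := by
        rw [lintegral_const_mul _ (measurable_of_countable _), lintegral_pow_poisson,
          ← ENNReal.ofReal_mul (by positivity), Real.coe_toNNReal _ ht.le, ← Real.exp_add]
        congr 2; ring

theorem poissonMeasure_le_floor (r : NNReal) {ε : ℝ} (hε : 0 < ε) :
    poissonMeasure r {n | (n : ℝ) ≤ r / (1 + ε)} ≤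
      ENNReal.ofReal (Real.exp (-(tailRate ε / (1 + ε) * r))) := by
  refine (poissonMeasure_le_exp r (t := (1 + ε)⁻¹) (K := r / (1 + ε)) (by positivity)
    fun n hn => ?_).trans_eq ?_
  · rw [Real.log_inv]
    have h1 := Real.log_nonneg (by linarith : 1 ≤ 1 + ε)
    have h2 : (n : ℝ) ≤ r / (1 + ε) := hn
    nlinarith
  · rw [Real.log_inv, tailRate]
    congr 2
    field_simp
    ring

theorem poissonMeasure_ge_ceil (r : NNReal) {ε : ℝ} (hε : 0 < ε) :
    poissonMeasure r {n | (1 + ε) * r ≤ n} ≤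
      ENNReal.ofReal (Real.exp (-(((1 + ε) * Real.log (1 + ε) - ε) * r))) := by
  refine (poissonMeasure_le_exp r (t := 1 + ε) (K := (1 + ε) * r) (by positivity)
    fun n hn => ?_).trans_eq ?_
  · exact mul_le_mul_of_nonneg_right hn (Real.log_nonneg (by linarith))
  · congr 2; ring

theorem upperTailRate_pos {ε : ℝ} (hε : 0 < ε) : 0 < (1 + ε) * Real.log (1 + ε) - ε := by
  have h := Real.log_lt_sub_one_of_pos (x := (1 + ε)⁻¹) (by positivity)
    (inv_ne_one.2 (by linarith))
  rw [Real.log_inv] at h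
  have : (1 + ε) * (1 + ε)⁻¹ = 1 := mul_inv_cancel₀ (by positivity)
  nlinarith

variable {u : ℕ → ℝ} {a f : ℝ}

/-- Since k(x) is asymptotic to bx, replacing x by k(x) in the power changes the limit by the factor
b^(-a). It serves for k(x) = ⌊x/(1+ε)⌋ and k(x) = ⌈(1+ε)x⌉. -/
theorem tendsto_rpow_mul_comp (hu : Tendsto (fun n : ℕ => (n : ℝ) ^ a * u n) atTop (𝓝 f))
    {k : ℝ → ℕ} {b : ℝ} (hb : 0 < b) (hk : Tendsto (fun x => (k x : ℝ) / x) atTop (𝓝 b)) :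
    Tendsto k atTop atTop ∧ Tendsto (fun x : ℝ => x ^ a * u (k x)) atTop (𝓝 (b⁻¹ ^ a * f)) := by
  have hkt : Tendsto k atTop atTop := by
    rw [← tendsto_natCast_atTop_iff (R := ℝ)]
    refine (hk.pos_mul_atTop hb tendsto_id).congr' ?_
    filter_upwards [eventually_gt_atTop 0] with x hx
    simp only [id]; field_simp
  refine ⟨hkt, ?_⟩
  have h1 : Tendsto (fun x => ((k x : ℝ) / x)⁻¹ ^ a) atTop (𝓝 (b⁻¹ ^ a)) :=
    (hk.inv₀ hb.ne').rpow_const (Or.inl (by positivity))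
  refine (h1.mul (hu.comp hkt)).congr' ?_
  filter_upwards [eventually_gt_atTop 0, hkt.eventually_gt_atTop 0] with x hx hkx
  have hk0 : (0 : ℝ) < k x := by exact_mod_cast hkx
  simp only [Function.comp_apply]
  rw [← mul_assoc, ← Real.mul_rpow (by positivity) (by positivity)]
  congr 2
  field_simp

/-- The Poisson average of a sequence. -/
noncomputable def poissonAverage (u : ℕ → ℝ) (x : ℝ) : ℝ≥0∞ :=
  ∫⁻ n, ENNReal.ofReal (u (n + 1)) ∂(poissonMeasure x.toNNReal)

/-- Outside the lower tail n > x/(1+ε), so u(n+1) is at most the value of u at the floor; on the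
tail it is at most u(1). Averaging u(n+1) avoids the index 0, at which monotonicity is not assumed.
-/
theorem poissonAverage_le (hu0 : ∀ n, 0 ≤ u n)
    (hanti : ∀ k n, 1 ≤ k → k ≤ n → u n ≤ u k) {ε x : ℝ} (hε : 0 < ε) (hx : 0 ≤ x)
    (hk : 1 ≤ ⌊(1 + ε)⁻¹ * x⌋₊) :
    poissonAverage u x ≤ ENNReal.ofReal
      (u ⌊(1 + ε)⁻¹ * x⌋₊ + u 1 * Real.exp (-(tailRate ε / (1 + ε) * x))) := by
  set S : Set ℕ := {n | (n : ℝ) ≤ (x.toNNReal : ℝ) / (1 + ε)}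
  have hS : MeasurableSet S := MeasurableSet.of_discrete
  calc poissonAverage u x ≤ ∫⁻ n, ENNReal.ofReal (u ⌊(1 + ε)⁻¹ * x⌋₊) +
          ENNReal.ofReal (u 1) * S.indicator 1 n ∂(poissonMeasure x.toNNReal) := by
        refine lintegral_mono fun n => ?_
        by_cases hn : n ∈ S
        · rw [Set.indicator_of_mem hn, Pi.one_apply, mul_one]
          exact (ENNReal.ofReal_le_ofReal (hanti 1 _ le_rfl (by omega))).trans le_add_self
        · refine (ENNReal.ofReal_le_ofReal (hanti _ _ hk ?_)).trans le_self_add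
          have h1 : x / (1 + ε) < n := by
            simpa [S, Real.coe_toNNReal _ hx] using hn
          have h2 : ⌊(1 + ε)⁻¹ * x⌋₊ ≤ n := Nat.floor_le_of_le (by
            rw [inv_mul_eq_div]; exact h1.le)
          omega
    _ = ENNReal.ofReal (u ⌊(1 + ε)⁻¹ * x⌋₊) +
          ENNReal.ofReal (u 1) * poissonMeasure x.toNNReal S := by
        rw [lintegral_add_left (measurable_of_countable _), lintegral_const, measure_univ, mul_one,
          lintegral_const_mul _ (measurable_of_countable _), lintegral_indicator_one hS]
    _ ≤ _ := by
        have := poissonMeasure_le_floor x.toNNReal hε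
        rw [ENNReal.ofReal_add (hu0 _) (mul_nonneg (hu0 _) (by positivity)),
          ENNReal.ofReal_mul (hu0 _)]
        gcongr
        simpa only [S, Real.coe_toNNReal _ hx] using this

/-- Below (1+ε)x one has n + 1 ≤ ⌈(1+ε)x⌉, the strict inequality absorbing the shift by one; the
upper tail is discarded. -/
theorem le_poissonAverage (hanti : ∀ k n, 1 ≤ k → k ≤ n → u n ≤ u k) (hu0 : ∀ n, 0 ≤ u n)
    {ε x : ℝ} (hε : 0 < ε) (hx : 0 ≤ x) :
    ENNReal.ofReal (u ⌈(1 + ε) * x⌉₊ *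
      (1 - Real.exp (-(((1 + ε) * Real.log (1 + ε) - ε) * x)))) ≤ poissonAverage u x := by
  set S : Set ℕ := {n | (1 + ε) * (x.toNNReal : ℝ) ≤ n}
  have hS : MeasurableSet S := MeasurableSet.of_discrete
  have hb := poissonMeasure_ge_ceil x.toNNReal hε
  calc _ ≤ ENNReal.ofReal (u ⌈(1 + ε) * x⌉₊) * poissonMeasure x.toNNReal Sᶜ := by
        rw [ENNReal.ofReal_mul (hu0 _), prob_compl_eq_one_sub hS]
        gcongr
        rw [ENNReal.ofReal_sub _ (Real.exp_pos _).le, ENNReal.ofReal_one]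
        refine tsub_le_tsub_left ?_ 1
        simpa only [S, Real.coe_toNNReal _ hx] using hb
    _ = ∫⁻ n, ENNReal.ofReal (u ⌈(1 + ε) * x⌉₊) * Sᶜ.indicator 1 n
          ∂(poissonMeasure x.toNNReal) := by
        rw [lintegral_const_mul _ (measurable_of_countable _), lintegral_indicator_one hS.compl]
    _ ≤ _ := by
        refine lintegral_mono fun n => ?_
        by_cases hn : n ∈ S
        · rw [Set.indicator_of_notMem (by simpa using hn), mul_zero]; exact zero_le
        · rw [Set.indicator_of_mem hn, Pi.one_apply, mul_one]
          refine ENNReal.ofReal_le_ofReal (hanti _ _ (by omega) ?_)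
          have h1 : (n : ℝ) < (1 + ε) * x := by
            simpa [S, Real.coe_toNNReal _ hx] using hn
          exact Nat.lt_ceil.2 h1

/-- Poisson averages of a decreasing sequence inherit its power law asymptotics. -/
theorem tendsto_rpow_mul_poissonAverage (hu0 : ∀ n, 0 ≤ u n)
    (hanti : ∀ k n, 1 ≤ k → k ≤ n → u n ≤ u k)
    (hu : Tendsto (fun n : ℕ => (n : ℝ) ^ a * u n) atTop (𝓝 f)) :
    Tendsto (fun x : ℝ => ENNReal.ofReal (x ^ a) * poissonAverage u x) atTop
      (𝓝 (ENNReal.ofReal f)) := by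
  have hfin : ∀ x, poissonAverage u x ≠ ∞ := fun x => by
    refine ne_top_of_le_ne_top (ENNReal.ofReal_ne_top (r := u 1)) ?_
    calc poissonAverage u x ≤ ∫⁻ _, ENNReal.ofReal (u 1) ∂(poissonMeasure x.toNNReal) :=
          lintegral_mono fun n => ENNReal.ofReal_le_ofReal (hanti 1 _ le_rfl (by omega))
      _ = _ := by simp
  -- The loss factors (1+ε)^(±a) tend to 1, so a single small ε can be fixed before x tends to
  -- infinity.
  have hcont : ∀ (s : ℝ → ℝ), ContinuousAt s 0 → s 0 = 1 →
      Tendsto (fun ε => s ε ^ a * f) (𝓝[>] 0) (𝓝 f) := fun s hs hs0 => by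
    have h1 : Tendsto s (𝓝[>] 0) (𝓝 1) := hs0 ▸ hs.tendsto.mono_left nhdsWithin_le_nhds
    simpa using (h1.rpow_const (p := a) (Or.inl one_ne_zero)).mul_const f
  have hexp : ∀ c : ℝ, 0 < c → Tendsto (fun x : ℝ => x ^ a * Real.exp (-(c * x))) atTop (𝓝 0) :=
    fun c hc => by simpa [neg_mul] using tendsto_rpow_mul_exp_neg_mul_atTop_nhds_zero a c hc
  have hexp0 : ∀ c : ℝ, 0 < c → Tendsto (fun x : ℝ => Real.exp (-(c * x))) atTop (𝓝 0) :=
    fun c hc => Real.tendsto_exp_neg_atTop_nhds_zero.comp (tendsto_id.const_mul_atTop hc)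
  suffices H : Tendsto (fun x : ℝ => x ^ a * (poissonAverage u x).toReal) atTop (𝓝 f) by
    refine (ENNReal.tendsto_ofReal H).congr' ?_
    filter_upwards [eventually_ge_atTop 0] with x hx
    rw [ENNReal.ofReal_mul (by positivity), ENNReal.ofReal_toReal (hfin x)]
  refine tendsto_order.2 ⟨fun y hy => ?_, fun y hy => ?_⟩
  · have hc := hcont (fun ε => (1 + ε)⁻¹)
      (ContinuousAt.inv₀ (by fun_prop) (by norm_num)) (by norm_num)
    obtain ⟨ε, hε1, hε⟩ := ((hc.eventually (lt_mem_nhds hy)).and self_mem_nhdsWithin).exists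
    have hε : 0 < ε := hε
    obtain ⟨-, h1⟩ := tendsto_rpow_mul_comp hu (k := fun x => ⌈(1 + ε) * x⌉₊)
      (by positivity : 0 < 1 + ε) (tendsto_nat_ceil_mul_div_atTop (by positivity))
    have h2 := h1.mul ((hexp0 _ (upperTailRate_pos hε)).const_sub 1)
    rw [sub_zero, mul_one] at h2
    filter_upwards [h2.eventually (lt_mem_nhds hε1), eventually_ge_atTop 0] with x hx hx0
    refine hx.trans_le ?_
    rw [mul_assoc]
    refine mul_le_mul_of_nonneg_left ?_ (by positivity)
    exact (ENNReal.ofReal_le_iff_le_toReal (hfin x)).1 (le_poissonAverage hanti hu0 hε hx0)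
  · have hc := hcont (fun ε => ((1 + ε)⁻¹)⁻¹) (by simp only [inv_inv]; fun_prop) (by norm_num)
    obtain ⟨ε, hε1, hε⟩ := ((hc.eventually (gt_mem_nhds hy)).and self_mem_nhdsWithin).exists
    have hε : 0 < ε := hε
    obtain ⟨hk, h1⟩ := tendsto_rpow_mul_comp hu (k := fun x => ⌊(1 + ε)⁻¹ * x⌋₊)
      (by positivity : 0 < (1 + ε)⁻¹) (tendsto_nat_floor_mul_div_atTop (by positivity))
    have hr : 0 < tailRate ε / (1 + ε) := div_pos (tailRate_pos hε) (by positivity)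
    have h2 := h1.add ((hexp _ hr).mul_const (u 1))
    rw [zero_mul, add_zero] at h2
    filter_upwards [h2.eventually (gt_mem_nhds hε1), eventually_ge_atTop 0,
      hk.eventually_ge_atTop 1] with x hx hx0 hx1
    refine lt_of_le_of_lt ?_ hx
    have h3 := poissonAverage_le hu0 hanti hε hx0 hx1
    have h4 := ENNReal.toReal_le_of_le_ofReal
      (add_nonneg (hu0 _) (mul_nonneg (hu0 1) (Real.exp_pos _).le)) h3
    calc _ ≤ x ^ a * _ := mul_le_mul_of_nonneg_left h4 (by positivity)
      _ = _ := by ring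

/-- Size-biasing produces the mean L^d, which cancels the division by the volume; the remaining L^p
is (L^d)^(p/d). -/
theorem fRef_eq_poissonAverage {d : ℕ} {p L : ℝ} (hd : d ≠ 0) (hp : 1 ≤ p) (hL : 0 < L)
    {Ω : Type*} [MeasurableSpace Ω] (P : Measure Ω) [IsProbabilityMeasure P]
    (μ : Ω → Measure (EuclideanSpace ℝ (Fin d))) (hμ : IsPoissonPointProcess μ P) :
    fRef p μ P L =
      ENNReal.ofReal ((L ^ d) ^ (p / d : ℝ)) * poissonAverage (costPerPoint d p) (L ^ d) := by
  have hLd : 0 < L ^ d := pow_pos hL d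
  have hv0 : ENNReal.ofReal (L ^ d) ≠ 0 := by simpa using hLd
  have e : ∀ n : ℕ, meanCost d p n = n * ENNReal.ofReal (costPerPoint d p n) := fun n => by
    rw [meanCost_eq (by linarith), ENNReal.ofReal_mul (by positivity), ENNReal.ofReal_natCast]
  have hpow : (L ^ d) ^ (p / d : ℝ) = L ^ p := by
    rw [← Real.rpow_natCast, ← Real.rpow_mul hL.le]
    congr 1
    field_simp
  rw [fRef_eq hp hL P μ hμ, lintegral_congr e, lintegral_natCast_mul_poisson, hpow,
    ENNReal.ofReal_rpow_of_pos hL, poissonAverage]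
  change _ * (_ * (ENNReal.ofReal (L ^ d) * _)) = _
  rw [mul_left_comm, ← mul_assoc (ENNReal.ofReal (L ^ d))⁻¹,
    ENNReal.inv_mul_cancel hv0 ENNReal.ofReal_ne_top, one_mul]

end PoissonAverage
theorem mainTheorem2 (d : ℕ) (hd : 3 ≤ d) (p : ℝ) (hp : 1 ≤ p) :
    ∃ f : ℝ, 0 < f ∧
      (∀ (Ω : Type*) [MeasurableSpace Ω] (P : Measure Ω) [IsProbabilityMeasure P]
        (μ : Ω → Measure (EuclideanSpace ℝ (Fin d))), IsPoissonPointProcess μ P →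
          Tendsto (fun L : ℝ => fRef p μ P L) atTop (𝓝 (ENNReal.ofReal f))) ∧
      (∀ (Ω : Type*) [MeasurableSpace Ω] (P : Measure Ω) [IsProbabilityMeasure P]
        (X : ℕ → Ω → EuclideanSpace ℝ (Fin d)),
          (∀ i, pdf.IsUniform (X i) (cube d 1) P volume) → iIndepFun X P →
          Tendsto (fun n : ℕ => ENNReal.ofReal ((n : ℝ) ^ (p / (d : ℝ))) *
              ∫⁻ ω, transportCostOn p (cube d 1) (empiricalMeasure (fun i => X i ω) n) volume ∂P)
            atTop (𝓝 (ENNReal.ofReal f))) := by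
  obtain ⟨f, hf, hlim⟩ := exists_tendsto_costPerPoint hd hp
  refine ⟨f, hf, fun Ω _ P _ μ hμ => ?_, fun Ω _ P _ X hX hi => ?_⟩
  · have h := tendsto_rpow_mul_poissonAverage costPerPoint_nonneg
      (fun k n hk hkn => costPerPoint_anti hp hk hkn) hlim
    refine (h.comp (tendsto_pow_atTop (by omega : d ≠ 0))).congr' ?_
    filter_upwards [eventually_gt_atTop 0] with L hL
    exact (fRef_eq_poissonAverage (by omega) hp hL P μ hμ).symm
  · refine (ENNReal.tendsto_ofReal hlim).congr' ?_
    filter_upwards [eventually_ge_atTop 1] with n hn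
    rw [lintegral_transportCostOn_empiricalMeasure hp P X hX hi hn,
      ENNReal.ofReal_mul (by positivity)]
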